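/- Let $\mathbb{T}^3=(\mathbb{R}/2\pi\mathbb{Z})^3$ and let $\mathcal{S}=C^\infty(\mathbb{T}^3)$ be the Fréchet space of smooth real functions on $\mathbb{T}^3$, with standard partial derivatives $\partial_1,\partial_2,\partial_3$. Elements of $\mathcal{S}^{15}$ are written $(D_1,D_2,D_3,p_1,p_2,p_3,p_0,\zeta,\chi)$, where $D_1,D_2,D_3$ are vector fields on $\mathbb{T}^3$ (nine component functions) and the remaining six entries are functions. Let $N\subset\mathcal{S}^{15}$ be the set where $D_1,D_2,D_3$ are linearly independent at every point of $\mathbb{T}^3$; on $N$ define the structure functions $c_{ij}^k\in\mathcal{S}$ by $[D_i,D_j]=\sum_k c_{ij}^kD_k$. The constraint map $\mathbf{C}:N\to\mathcal{S}^4$ is $\mathbf{C}=(A,B_1,B_2,B_3)$ with \[ A=3p_0^2-p_2p_3-p_3p_1-p_1p_2, \] \[ B_i=-\tfrac12D_i(p_j+p_k)-\tfrac12c_{ij}^j(p_i-p_j)+\tfrac12c_{ki}^k(p_i-p_k)+p_iD_i(\zeta)+3p_0D_i(\chi) \] for $(i,j,k)\in\{(1,2,3),(2,3,1),(3,1,2)\}$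 (no summation convention). For a real topological vector space $E$, continuous symmetric bilinear maps $\beta^1,\dots,\beta^n:E\times E\to\mathbb{R}$ are said to define a good intersection if there is a decomposition into closed subspaces $E=E_1\oplus\dots\oplus E_n\oplus W$ with $\dim E_i<\infty$ such that $\beta^i|_{E_j\times E_k}=0$ unless $i=j=k$, and $\beta^i|_{E_i\times E_i}$ is indefinite (takes both positive and negative values on the diagonal) for every $i$. **Lemma (Local structure of the solution space).** Let $p_{10},p_{20},p_{30}>0$ be three pairwise different constants, and set \[ x_0=(\partial_1,\partial_2,\partial_3,p_{10},p_{20},p_{30},p_{00},0,0)\in N, \] where $p_{00}>0$ is the constant chosen so that $\mathbf{C}(x_0)=0$. Then there exist: an internal direct sum decomposition of Fréchet spaces $\mathcal{S}^{15}=U\oplus V$; open neighborhoods $\Omega_U\subset U$ and $\Omega_V\subset V$ of the respective origins; a smooth map of Fréchet spaces $\varphi:\Omega_U\to\Omega_V$ with $\varphi(0)=0$; and a smooth map $B:\Omega_U\to\mathbb{R}^3$ with $B(0)=0$ and $DB(0)=0$, the three components of whose second derivative $D^2B(0)$ define a good intersection on $U$; such that \[ \mathbf{C}^{-1}(\{0\})\cap(x_0+\Omega_U+\Omega_V)=\{\,x_0+(u+\varphi(u))\mid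 u\in\Omega_U,\ B(u)=0\,\}. \] Here a map from an open subset $\Omega$ of a Fréchet space $E$ to a Fréchet space $F$ is called smooth if its iterated directional derivatives of every order $k$ exist on $\Omega$ and define jointly continuous maps $\Omega\times E^k\to F$. -/

import Mathlib

open scoped ContDiff Topology

noncomputable section

namespace TorusConstraints

/-! ### Smooth functions on the torus -/

/-- Smooth real functions on `𝕋³ = (ℝ/2πℤ)³`, written as smooth functions on `ℝ³` that are
`2π`-periodic in each coordinate. -/
def smoothPeriodic : Subalgebra ℝ ((Fin 3 → ℝ) → ℝ) where
  carrier := {f | ContDiff ℝ ∞ f ∧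
    ∀ (x : Fin 3 → ℝ) (a : Fin 3), f (x + Pi.single a (2 * Real.pi)) = f x}
  mul_mem' := fun hf hg => ⟨hf.1.mul hg.1, fun x a => by simp [hf.2 x a, hg.2 x a]⟩
  add_mem' := fun hf hg => ⟨hf.1.add hg.1, fun x a => by simp [hf.2 x a, hg.2 x a]⟩
  algebraMap_mem' := fun _ => ⟨contDiff_const, fun _ _ => rfl⟩

/-- The space `𝒮 = C^∞(𝕋³)`. It is a type of its own, so that it carries the Fréchet topology
below and not the topology of pointwise convergence. -/
def SmoothTorus : Type := smoothPeriodic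

instance : CommRing SmoothTorus := inferInstanceAs (CommRing smoothPeriodic)

instance : Algebra ℝ SmoothTorus := inferInstanceAs (Algebra ℝ smoothPeriodic)

instance : FunLike SmoothTorus (Fin 3 → ℝ) ℝ where
  coe f := f.1
  coe_injective := fun _ _ h => Subtype.ext h

namespace SmoothTorus

theorem contDiff (f : SmoothTorus) : ContDiff ℝ ∞ (f : (Fin 3 → ℝ) → ℝ) := f.2.1

theorem periodic (f : SmoothTorus) (x : Fin 3 → ℝ) (a : Fin 3) :
    f (x + Pi.single a (2 * Real.pi)) = f x := f.2.2 x a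

@[ext] theorem ext {f g : SmoothTorus} (h : ∀ x, f x = g x) : f = g := DFunLike.ext f g h

@[simp] theorem add_apply (f g : SmoothTorus) (x : Fin 3 → ℝ) : (f + g) x = f x + g x := rfl

@[simp] theorem sub_apply (f g : SmoothTorus) (x : Fin 3 → ℝ) : (f - g) x = f x - g x := rfl

@[simp] theorem mul_apply (f g : SmoothTorus) (x : Fin 3 → ℝ) : (f * g) x = f x * g x := rfl

@[simp] theorem smul_apply (c : ℝ) (f : SmoothTorus) (x : Fin 3 → ℝ) : (c • f) x = c * f x := rfl

@[simp] theorem algebraMap_apply (c : ℝ) (x : Fin 3 → ℝ) :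
    (algebraMap ℝ SmoothTorus c) x = c := rfl

@[simp] theorem zero_apply (x : Fin 3 → ℝ) : (0 : SmoothTorus) x = 0 := rfl

@[simp] theorem one_apply (x : Fin 3 → ℝ) : (1 : SmoothTorus) x = 1 := rfl

/-- Evaluation at a point, as a ring homomorphism. -/
def evalHom (x : Fin 3 → ℝ) : SmoothTorus →+* ℝ where
  toFun f := f x
  map_one' := rfl
  map_mul' _ _ := rfl
  map_zero' := rfl
  map_add' _ _ := rfl

/-- A continuous function on `ℝ³` that is `2π`-periodic in each coordinate is bounded. -/
theorem bddAbove_of_periodic (g : (Fin 3 → ℝ) → ℝ) (hg : Continuous g)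
    (hp : ∀ (x : Fin 3 → ℝ) (a : Fin 3), g (x + Pi.single a (2 * Real.pi)) = g x) :
    BddAbove (Set.range g) := by
  have hz : ∀ (a : Fin 3) (n : ℤ) (x : Fin 3 → ℝ),
      g (x + n • Pi.single a (2 * Real.pi)) = g x := fun a n x =>
    Function.Periodic.zsmul (f := g) (c := Pi.single a (2 * Real.pi)) (fun y => hp y a) n x
  have hK : IsCompact (Set.Icc (0 : Fin 3 → ℝ) (fun _ => 2 * Real.pi)) := isCompact_Icc
  refine (hK.image hg).bddAbove.mono ?_
  rintro _ ⟨x, rfl⟩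
  choose n hn _ using fun a : Fin 3 =>
    existsUnique_add_zsmul_mem_Ico (by positivity : (0 : ℝ) < 2 * Real.pi) (x a) 0
  refine ⟨x + n 0 • Pi.single 0 (2 * Real.pi) + n 1 • Pi.single 1 (2 * Real.pi)
    + n 2 • Pi.single 2 (2 * Real.pi), ⟨?_, ?_⟩, by rw [hz, hz, hz]⟩
  · intro a
    have := (hn a).1
    fin_cases a <;> simpa using this
  · intro a
    have := (hn a).2
    fin_cases a <;> simpa using this.le

theorem bddAbove_iteratedFDeriv (k : ℕ) (f : SmoothTorus) :
    BddAbove (Set.range fun x => ‖iteratedFDeriv ℝ k f x‖) := by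
  refine bddAbove_of_periodic _ ?_ ?_
  · exact (f.contDiff.continuous_iteratedFDeriv (by exact_mod_cast le_top)).norm
  · intro x a
    have h := iteratedFDeriv_comp_add_right (𝕜 := ℝ) (f := (f : (Fin 3 → ℝ) → ℝ)) k
      (Pi.single a (2 * Real.pi)) x
    have h' : (fun z => f (z + Pi.single a (2 * Real.pi))) = f := funext fun z => f.periodic z a
    rw [h'] at h
    rw [← h]

/-- The `C^k` seminorm `f ↦ sup ‖D^k f‖`. -/
def seminorm (k : ℕ) : Seminorm ℝ SmoothTorus :=
  Seminorm.of (fun f => ⨆ x, ‖iteratedFDeriv ℝ k f x‖)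
    (fun f g => by
      refine ciSup_le fun x => ?_
      have h : iteratedFDeriv ℝ k (f + g : SmoothTorus) x
          = iteratedFDeriv ℝ k f x + iteratedFDeriv ℝ k g x :=
        iteratedFDeriv_add_apply (f.contDiff.contDiffAt.of_le (by exact_mod_cast le_top))
          (g.contDiff.contDiffAt.of_le (by exact_mod_cast le_top))
      rw [h]
      exact (norm_add_le _ _).trans
        (add_le_add (le_ciSup (bddAbove_iteratedFDeriv k f) x)
          (le_ciSup (bddAbove_iteratedFDeriv k g) x)))
    (fun c f => by
      rw [Real.mul_iSup_of_nonneg (norm_nonneg c)]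
      refine iSup_congr fun x => ?_
      have h : iteratedFDeriv ℝ k (c • f : SmoothTorus) x = c • iteratedFDeriv ℝ k f x :=
        iteratedFDeriv_const_smul_apply
          (f.contDiff.contDiffAt.of_le (by exact_mod_cast le_top))
      rw [h, norm_smul])

/-- The Fréchet topology of `C^∞(𝕋³)`: uniform convergence of all derivatives. -/
instance : TopologicalSpace SmoothTorus :=
  (SeminormFamily.moduleFilterBasis (𝕜 := ℝ) (fun k : ℕ => seminorm k)).topology

theorem withSeminorms : WithSeminorms (fun k : ℕ => seminorm k) := ⟨rfl⟩

/-- The partial derivative `∂_a`. -/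
def pderiv (a : Fin 3) (f : SmoothTorus) : SmoothTorus :=
  ⟨fun x => fderiv ℝ f x (Pi.single a 1), by
    refine ⟨(f.contDiff.fderiv_right (m := ∞) (by simp)).clm_apply contDiff_const, ?_⟩
    intro x b
    have h := fderiv_comp_add_right (𝕜 := ℝ) (f := (f : (Fin 3 → ℝ) → ℝ)) (x := x)
      (Pi.single b (2 * Real.pi))
    have h' : (fun z => f (z + Pi.single b (2 * Real.pi))) = f := funext fun z => f.periodic z b
    rw [h'] at h
    change fderiv ℝ f (x + Pi.single b (2 * Real.pi)) _ = fderiv ℝ f x _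
    rw [← h]⟩

theorem pderiv_apply (a : Fin 3) (f : SmoothTorus) (x : Fin 3 → ℝ) :
    pderiv a f x = fderiv ℝ f x (Pi.single a 1) := rfl

end SmoothTorus

open SmoothTorus

/-! ### Vector fields, frames and structure functions -/

/-- A vector field `X = ∑ₐ Xᵃ ∂ₐ` on the torus, given by its three components. -/
abbrev VField : Type := Fin 3 → SmoothTorus

/-- The action `X(f) = ∑ₐ Xᵃ ∂ₐ f` of a vector field on a function. -/
def VField.act (X : VField) (f : SmoothTorus) : SmoothTorus := ∑ a, X a * pderiv a f

/-- The commutator `[X, Y]`, with components `X(Yᵃ) - Y(Xᵃ)`. -/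
def VField.bracket (X Y : VField) : VField := fun a => X.act (Y a) - Y.act (X a)

/-- Three vector fields that are linearly independent at every point of the torus. -/
def IsFrame (D : Fin 3 → VField) : Prop :=
  ∀ x : Fin 3 → ℝ, LinearIndependent ℝ (fun i a => D i a x : Fin 3 → Fin 3 → ℝ)

/-- The structure function `c_{ij}^k` of a frame: the coefficient of `D_k` in `[D_i, D_j]`, obtained
by inverting the matrix `(D_i^a)` over the ring `C^∞(𝕋³)`. -/
def structureFn (D : Fin 3 → VField) (i j k : Fin 3) : SmoothTorus :=
  ∑ a, (D i).bracket (D j) a * (Matrix.of D)⁻¹ a k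

theorem IsFrame.isUnit_det {D : Fin 3 → VField} (hD : IsFrame D) :
    IsUnit (Matrix.of D).det := by
  set d : SmoothTorus := (Matrix.of D).det with hd
  have hne : ∀ x, d x ≠ 0 := by
    intro x
    have h1 : d x = (Matrix.of fun i a => D i a x).det := by
      change evalHom x (Matrix.of D).det = _
      rw [RingHom.map_det]
      rfl
    have h2 : IsUnit (Matrix.of fun i a => D i a x) :=
      Matrix.linearIndependent_rows_iff_isUnit.1 (hD x)
    rw [h1]
    exact ((Matrix.isUnit_iff_isUnit_det _).1 h2).ne_zero
  refine IsUnit.of_mul_eq_one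
    (⟨fun x => (d x)⁻¹, d.contDiff.inv hne, fun x a =>
      congrArg (fun r : ℝ => r⁻¹) (d.periodic x a)⟩ : SmoothTorus) ?_
  ext x
  exact mul_inv_cancel₀ (hne x)

/-- The structure functions of a frame satisfy `[D_i, D_j] = ∑ₖ c_{ij}^k D_k`. -/
theorem IsFrame.bracket_eq {D : Fin 3 → VField} (hD : IsFrame D) (i j a : Fin 3) :
    (D i).bracket (D j) a = ∑ k, structureFn D i j k * D k a := by
  have h := Matrix.nonsing_inv_mul (Matrix.of D) hD.isUnit_det
  have h2 : Matrix.vecMul (Matrix.vecMul ((D i).bracket (D j)) (Matrix.of D)⁻¹) (Matrix.of D)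
      = (D i).bracket (D j) := by
    rw [Matrix.vecMul_vecMul, h, Matrix.vecMul_one]
  exact (congrFun h2 a).symm

/-! ### The constraint map -/

/-- The space `𝒮¹⁵` of tuples `(D₁, D₂, D₃, p₁, p₂, p₃, p₀, ζ, χ)`: nine component functions of
the three vector fields and six further functions, with the product topology. -/
abbrev Tuple : Type :=
  (Fin 3 → VField) × (Fin 3 → SmoothTorus) × SmoothTorus × SmoothTorus × SmoothTorus

/-- The domain `N ⊆ 𝒮¹⁵` of the constraint map. -/
def domainN : Set Tuple := {x | IsFrame x.1}

/-- The component `A = 3 p₀² - p₂ p₃ - p₃ p₁ - p₁ p₂` (indices are shifted to `0, 1, 2`). -/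
def constraintA : Tuple → SmoothTorus
  | (_, p, p₀, _, _) => 3 * p₀ ^ 2 - p 1 * p 2 - p 2 * p 0 - p 0 * p 1

/-- The component `B_i = -½ D_i(p_j + p_k) - ½ c_{ij}^j (p_i - p_j) + ½ c_{ki}^k (p_i - p_k)
+ p_i D_i(ζ) + 3 p₀ D_i(χ)`, where `(i, j, k)` is the cyclic triple `(i, i + 1, i + 2)`
modulo `3`. -/
def constraintB (i : Fin 3) : Tuple → SmoothTorus
  | (D, p, p₀, ζ, χ) =>
    -((1 / 2 : ℝ) • (D i).act (p (i + 1) + p (i + 2)))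
      - (1 / 2 : ℝ) • (structureFn D i (i + 1) (i + 1) * (p i - p (i + 1)))
      + (1 / 2 : ℝ) • (structureFn D (i + 2) i (i + 2) * (p i - p (i + 2)))
      + p i * (D i).act ζ
      + 3 * p₀ * (D i).act χ

/-- The constraint map `C = (A, B₁, B₂, B₃)` with values in `𝒮⁴ = 𝒮 × 𝒮³`; it is meaningful on
`domainN`. -/
def constraintMap (x : Tuple) : SmoothTorus × (Fin 3 → SmoothTorus) :=
  (constraintA x, fun i => constraintB i x)

/-- The spatially homogeneous tuple
`(∂₁, ∂₂, ∂₃, p₁₀, p₂₀, p₃₀, p₀₀, 0, 0)` with constant `pᵢ₀` and `p₀₀`. -/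
def homogeneous (p : Fin 3 → ℝ) (p₀ : ℝ) : Tuple :=
  (fun i => Pi.single i 1, fun i => algebraMap ℝ SmoothTorus (p i),
    algebraMap ℝ SmoothTorus p₀, 0, 0)

/-! ### Smooth maps between Fréchet spaces -/

section Smooth

variable {E F : Type*} [AddCommGroup E] [Module ℝ E] [TopologicalSpace E]
  [AddCommGroup F] [Module ℝ F] [TopologicalSpace F]

/-- `f` has the directional derivative `f'` at `x` in the direction `v`. -/
def HasDirDerivAt (f : E → F) (f' : F) (x v : E) : Prop :=
  Filter.Tendsto (fun t : ℝ => t⁻¹ • (f (x + t • v) - f x)) (𝓝[≠] 0) (𝓝 f')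

/-- `D k x (h₁, …, h_k)` is the `k`-th derivative of `f` at `x ∈ Ω` in the directions
`h₁, …, h_k`, obtained by iterated directional derivatives, and every
`D k : Ω × Eᵏ → F` is jointly continuous. For an open set `Ω` of a Fréchet space, the existence of
such a `D` is smoothness of `f` on `Ω` in the usual sense, and `D` is unique on `Ω`. -/
structure HasSmoothDerivs (f : E → F) (D : (k : ℕ) → E → (Fin k → E) → F) (Ω : Set E) : Prop where
  zero : ∀ x ∈ Ω, ∀ h : Fin 0 → E, D 0 x h = f x
  succ : ∀ (k : ℕ), ∀ x ∈ Ω, ∀ (h : Fin k → E) (v : E),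
    HasDirDerivAt (fun y => D k y h) (D (k + 1) x (Fin.snoc (α := fun _ => E) h v)) x v
  cont : ∀ k : ℕ,
    ContinuousOn (fun q : E × (Fin k → E) => D k q.1 q.2) (Ω ×ˢ (Set.univ : Set (Fin k → E)))

/-- `f` is a smooth map on `Ω`, as a map of Fréchet spaces. -/
def IsSmoothOn (f : E → F) (Ω : Set E) : Prop := ∃ D, HasSmoothDerivs f D Ω

end Smooth

/-! ### Good intersections of real quadrics -/

/-- The bilinear forms `β¹, …, βⁿ` on `E` are continuous and symmetric, and they define a good
intersection: there is a decomposition `E = E₁ ⊕ … ⊕ Eₙ ⊕ W` into closed subspaces (the summand with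
index `none` is `W`) with `dim Eᵢ < ∞` such that `βⁱ` vanishes on `Eⱼ × Eₖ` unless `i = j = k`, and
`βⁱ` is indefinite on `Eᵢ`. -/
def IsGoodIntersection {E : Type*} [AddCommGroup E] [Module ℝ E] [TopologicalSpace E] {n : ℕ}
    (β : Fin n → LinearMap.BilinForm ℝ E) : Prop :=
  (∀ i, Continuous fun q : E × E => β i q.1 q.2) ∧
  (∀ i u w, β i u w = β i w u) ∧
  ∃ (V : Fin n → Submodule ℝ E) (W : Submodule ℝ E),
    DirectSum.IsInternal (fun o : Option (Fin n) => o.elim W V) ∧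
    IsClosed (W : Set E) ∧
    (∀ i, IsClosed (V i : Set E)) ∧
    (∀ i, FiniteDimensional ℝ (V i)) ∧
    (∀ i j k, ¬(i = j ∧ j = k) → ∀ u ∈ V j, ∀ w ∈ V k, β i u w = 0) ∧
    (∀ i, (∃ u ∈ V i, 0 < β i u u) ∧ ∃ u ∈ V i, β i u u < 0)

end TorusConstraints

end

/-! The proof is a Lyapunov–Schmidt reduction. The determinant of the frame is a unit on `N`, so
multiplying each `B_i` by it keeps the zero set and clears the denominators of the structure
functions: the constraints become polynomials in the fifteen components and their first derivatives
(`det_mul_constraintB`). At `x₀` the linearization of `A` is algebraic and contains `6 p₀₀` times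
the variation of the component `p₀`. The linearization of `B_i` is a combination of partial
derivatives, so its values have mean zero. Mean zero is also the only restriction. As the `p_i₀` are
pairwise different, multiples of `∂_b Δ⁻¹ f` can be placed in `D_i^b` for `b ≠ i` and in the `p_l`
so that the linearized `B_i` becomes `∑ ∂_b ∂_b Δ⁻¹ f = f - mean f`, while the other linearized
constraints vanish (`opB_liftB`, `opA_liftB`). With `T` the linearization and `L` this right inverse
modulo constants, `P = L T` is a continuous projection; `U` is its kernel and `V` its range. For `u`
in `U` the equation `z = u + P z - L C(z)`, where `C(z)` denotes the rescaled constraints of `x₀ +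
z`, is equivalent to `P z = z - u` together with the vanishing of all constraints except the three
mean values of the `B_i`. These mean values, evaluated at the solution `z`, are `B(u)`, and `φ(u) =
P z`.

The fixed-point equation loses no derivative: the `B_i` cost one and `∂_b Δ⁻¹` gains one. It is
therefore a contraction problem in Banach algebras of every order of smoothness, and the only danger
is a neighborhood that shrinks with the order. It is avoided with the weighted Wiener norms `∑ w(k)
|f̂(k)|` for `w(k) = (1 + |k|)(1 + |k|/(m+1))^s`. These weights are submultiplicative, so all
product and operator bounds are independent of `s` and `m`, and one radius serves all norms
(`uniformlyBounded_hatNonlinear`). For a fixed smooth function the norm tends to the base norm (`s =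
0`) as `m → ∞`, so a `u` that is small in the base norm is small in some norm of each order
(`exists_norm_embTuple_lt`). Hence the iteration converges in `𝒮¹⁵`, and the smooth inverses in the
Banach spaces combine to a smooth map of Fréchet spaces (`exists_hasSmoothDerivs_of_models`).

`DB(0) = 0` since the linearized `B_i` have mean zero. As the solution map is tangent to the
identity, `D²B(0)` is the second derivative of the mean of the rescaled `B_i`, restricted to `U`.
When neither the frame nor `χ` varies, this mean is exactly the mean of `p_i ∂_i ζ`, with `p_i` and
`ζ` the variations. Kernel directions built from `p_i = sin x_i` and from `ζ = cos x_i` span three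
hyperbolic planes for these forms, and their common orthogonal complement supplies `W`
(`isGoodIntersection_of_dual`). -/

/-! ### Fourier coefficients of smooth functions on the torus -/

noncomputable section

namespace TorusConstraints

open MeasureTheory UnitAddTorus Filter

/-- The Haar probability measure on the circle. -/
local instance : MeasureSpace UnitAddCircle := ⟨AddCircle.haarAddCircle⟩

local instance : Measure.IsAddHaarMeasure (volume : Measure UnitAddCircle) :=
  inferInstanceAs (Measure.IsAddHaarMeasure AddCircle.haarAddCircle)

local instance : IsProbabilityMeasure (volume : Measure UnitAddCircle) :=
  inferInstanceAs (IsProbabilityMeasure AddCircle.haarAddCircle)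

/-- The covering map `ℝ³ → (ℝ/ℤ)³`. -/
def cover (t : Fin 3 → ℝ) : UnitAddTorus (Fin 3) := fun a => (t a : UnitAddCircle)

theorem isOpenQuotientMap_cover : IsOpenQuotientMap cover :=
  IsOpenQuotientMap.piMap fun _ => QuotientAddGroup.isOpenQuotientMap_mk

/-- The covering map as a bundled continuous map. -/
def coverMap : C(Fin 3 → ℝ, UnitAddTorus (Fin 3)) := ⟨cover, isOpenQuotientMap_cover.continuous⟩

theorem isQuotientMap_coverMap : Topology.IsQuotientMap coverMap := isOpenQuotientMap_cover.isQuotientMap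

theorem mFourier_cover (k : Fin 3 → ℤ) (t : Fin 3 → ℝ) :
    mFourier k (cover t) = Complex.exp (Complex.I * ((∑ a, k a * (2 * Real.pi * t a) : ℝ) : ℂ)) := by
  simp only [mFourier, cover, ContinuousMap.coe_mk, fourier_coe_apply, Complex.ofReal_one, div_one,
    ← Complex.exp_sum]
  congr 1
  push_cast
  rw [Finset.mul_sum]
  exact Finset.sum_congr rfl fun a _ => by ring

theorem integrable_torus (F : C(UnitAddTorus (Fin 3), ℂ)) : Integrable F :=
  (BoundedContinuousFunction.mkOfCompact F).integrable _

theorem mFourierCoeff_add (F G : C(UnitAddTorus (Fin 3), ℂ)) (k : Fin 3 → ℤ) :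
    mFourierCoeff (F + G) k = mFourierCoeff F k + mFourierCoeff G k := by
  simp only [mFourierCoeff, Pi.add_apply, smul_add, ContinuousMap.coe_add]
  exact integral_add (integrable_torus (mFourier (-k) * F)) (integrable_torus (mFourier (-k) * G))

theorem mFourierCoeff_smul (c : ℂ) (F : C(UnitAddTorus (Fin 3), ℂ)) (k : Fin 3 → ℤ) :
    mFourierCoeff (c • F) k = c * mFourierCoeff F k := by
  simp only [mFourierCoeff, Pi.smul_apply, ContinuousMap.coe_smul, smul_eq_mul]
  rw [← integral_const_mul]
  exact integral_congr_ae (.of_forall fun t => by ring)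

theorem norm_mFourierCoeff_le (F : C(UnitAddTorus (Fin 3), ℂ)) (k : Fin 3 → ℤ) :
    ‖mFourierCoeff F k‖ ≤ ‖F‖ := by
  have h := norm_integral_le_of_norm_le_const (μ := (volume : Measure (UnitAddTorus (Fin 3))))
    (f := fun t => mFourier (-k) t • F t) (C := ‖F‖) (.of_forall fun t => by
      rw [norm_smul]
      calc _ ≤ ‖mFourier (-k)‖ * ‖F‖ := by
            gcongr
            · exact ContinuousMap.norm_coe_le_norm _ _
            · exact ContinuousMap.norm_coe_le_norm _ _
        _ = ‖F‖ := by rw [mFourier_norm, one_mul])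
  simpa [mFourierCoeff] using h

/-- The Fourier coefficient as a continuous linear functional. -/
def fourierCLM (k : Fin 3 → ℤ) : C(UnitAddTorus (Fin 3), ℂ) →L[ℂ] ℂ :=
  LinearMap.mkContinuous
    { toFun := fun F => mFourierCoeff F k
      map_add' := fun F G => mFourierCoeff_add F G k
      map_smul' := fun c F => mFourierCoeff_smul c F k } 1
    fun F => by simpa using norm_mFourierCoeff_le F k

theorem fourierCLM_apply (k : Fin 3 → ℤ) (F : C(UnitAddTorus (Fin 3), ℂ)) :
    fourierCLM k F = mFourierCoeff F k := rfl

theorem fourierCLM_mFourier_mul (k l : Fin 3 → ℤ) (F : C(UnitAddTorus (Fin 3), ℂ)) :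
    fourierCLM k (mFourier l * F) = fourierCLM (k - l) F := by
  simp only [fourierCLM_apply, mFourierCoeff, ContinuousMap.coe_mul, Pi.mul_apply, smul_eq_mul]
  refine integral_congr_ae (.of_forall fun t => ?_)
  simp only
  rw [← mul_assoc, ← mFourier_add]
  congr 2
  abel_nf

theorem fourierCLM_one (k : Fin 3 → ℤ) : fourierCLM k 1 = if k = 0 then 1 else 0 := by
  have h := (orthonormal_iff_ite.1 (orthonormal_mFourier (d := Fin 3))) k 0
  simp only [ContinuousMap.inner_toLp] at h
  rw [← h]
  simp only [fourierCLM_apply, mFourierCoeff]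
  refine integral_congr_ae (.of_forall fun t => ?_)
  simp [mFourier_neg, mFourier_zero]

theorem fourierCLM_mFourier (k l : Fin 3 → ℤ) :
    fourierCLM k (mFourier l) = if k = l then 1 else 0 := by
  have h := fourierCLM_mFourier_mul k l 1
  rw [mul_one] at h
  rw [h, fourierCLM_one]
  simp [sub_eq_zero]

namespace SmoothTorus

theorem periodic_int (f : SmoothTorus) (x : Fin 3 → ℝ) (n : Fin 3 → ℤ) :
    f (x + fun a => 2 * Real.pi * n a) = f x := by
  have hz : ∀ (a : Fin 3) (n : ℤ) (x : Fin 3 → ℝ),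
      f (x + n • Pi.single a (2 * Real.pi)) = f x := fun a n x =>
    Function.Periodic.zsmul (f := f) (c := Pi.single a (2 * Real.pi)) (fun y => f.periodic y a) n x
  have h : (x + fun a => 2 * Real.pi * n a) = x + n 0 • Pi.single 0 (2 * Real.pi)
      + n 1 • Pi.single 1 (2 * Real.pi) + n 2 • Pi.single 2 (2 * Real.pi) := by
    ext a
    fin_cases a <;> simp [mul_comm]
  rw [h, hz, hz, hz]

/-- A smooth periodic function, rescaled to have period `1`. -/
def rescaled (f : SmoothTorus) : C(Fin 3 → ℝ, ℂ) :=
  ⟨fun t => (f ((2 * Real.pi) • t) : ℂ), by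
    have := f.contDiff.continuous
    fun_prop⟩

theorem factorsThrough_rescaled (f : SmoothTorus) :
    Function.FactorsThrough (rescaled f) coverMap := by
  intro s t h
  replace h : cover s = cover t := h
  have h1 : ∀ a, ∃ n : ℤ, s a = t a + n := fun a => by
    have h2 : (s a : UnitAddCircle) = t a := congrFun h a
    rw [QuotientAddGroup.eq] at h2
    obtain ⟨n, hn⟩ := AddSubgroup.mem_zmultiples_iff.1 h2
    refine ⟨-n, ?_⟩
    have : (n : ℝ) = -s a + t a := by simpa using hn
    push_cast
    linarith
  choose n hn using h1
  have h3 : (2 * Real.pi) • s = (2 * Real.pi) • t + fun a => 2 * Real.pi * n a := by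
    ext a
    simp [hn a, mul_add]
  simp only [rescaled, ContinuousMap.coe_mk]
  rw [h3, periodic_int]

/-- A smooth periodic function, as a continuous function on the unit torus. -/
def toTorus (f : SmoothTorus) : C(UnitAddTorus (Fin 3), ℂ) :=
  isQuotientMap_coverMap.lift (rescaled f) (factorsThrough_rescaled f)

theorem toTorus_cover (f : SmoothTorus) (t : Fin 3 → ℝ) :
    f.toTorus (cover t) = f ((2 * Real.pi) • t) :=
  ContinuousMap.congr_fun
    (isQuotientMap_coverMap.lift_comp (rescaled f) (factorsThrough_rescaled f)) t

theorem torus_ext {F G : C(UnitAddTorus (Fin 3), ℂ)} (h : ∀ t, F (cover t) = G (cover t)) :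
    F = G := by
  ext y
  obtain ⟨t, rfl⟩ := isOpenQuotientMap_cover.surjective y
  exact h t

theorem toTorus_injective : Function.Injective toTorus := by
  intro f g h
  ext x
  have h1 := f.toTorus_cover ((2 * Real.pi)⁻¹ • x)
  rw [h, toTorus_cover, smul_smul, mul_inv_cancel₀ (by positivity), one_smul] at h1
  exact_mod_cast h1.symm

theorem toTorus_add (f g : SmoothTorus) : (f + g).toTorus = f.toTorus + g.toTorus :=
  torus_ext fun t => by simp [toTorus_cover]

theorem toTorus_mul (f g : SmoothTorus) : (f * g).toTorus = f.toTorus * g.toTorus :=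
  torus_ext fun t => by simp [toTorus_cover]

theorem toTorus_smul (c : ℝ) (f : SmoothTorus) : (c • f).toTorus = (c : ℂ) • f.toTorus :=
  torus_ext fun t => by simp [toTorus_cover]

theorem toTorus_one : (1 : SmoothTorus).toTorus = 1 :=
  torus_ext fun t => by simp [toTorus_cover]

/-- The Fourier coefficients, as linear functionals. -/
def coeff (k : Fin 3 → ℤ) : SmoothTorus →ₗ[ℝ] ℂ where
  toFun f := fourierCLM k f.toTorus
  map_add' f g := by rw [toTorus_add, map_add]
  map_smul' c f := by rw [toTorus_smul, map_smul]; simp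

theorem coeff_def (k : Fin 3 → ℤ) (f : SmoothTorus) : coeff k f = fourierCLM k f.toTorus := rfl

theorem coeff_one (k : Fin 3 → ℤ) : coeff k 1 = if k = 0 then 1 else 0 := by
  rw [coeff_def, toTorus_one, fourierCLM_one]

theorem coeff_neg (k : Fin 3 → ℤ) (f : SmoothTorus) :
    coeff (-k) f = (starRingEnd ℂ) (coeff k f) := by
  simp only [coeff_def, fourierCLM_apply, mFourierCoeff, ← integral_conj]
  refine integral_congr_ae (.of_forall fun y => ?_)
  obtain ⟨t, rfl⟩ := isOpenQuotientMap_cover.surjective y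
  simp [mFourier_neg, toTorus_cover]

theorem norm_coeff_le (k : Fin 3 → ℤ) (f : SmoothTorus) : ‖coeff k f‖ ≤ seminorm 0 f := by
  refine (norm_mFourierCoeff_le _ k).trans ?_
  have h0 : 0 ≤ seminorm 0 f := apply_nonneg _ _
  refine (ContinuousMap.norm_le _ h0).2 fun y => ?_
  obtain ⟨t, rfl⟩ := isOpenQuotientMap_cover.surjective y
  rw [toTorus_cover, Complex.norm_real]
  have := le_ciSup (bddAbove_iteratedFDeriv 0 f) ((2 * Real.pi) • t)
  rw [norm_iteratedFDeriv_zero] at this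
  exact this

/-- The translate `x ↦ f (x + s e_a)`. -/
def translate (a : Fin 3) (s : ℝ) (f : SmoothTorus) : SmoothTorus :=
  ⟨fun x => f (x + s • Pi.single a 1), f.contDiff.comp (contDiff_id.add contDiff_const), by
    intro x b
    have := f.periodic (x + s • Pi.single a 1) b
    rwa [add_right_comm] at this⟩

/-- Translation invariance of Haar measure moves the shift onto the character, which contributes a
phase. This replaces integration by parts in `coeff_pderiv`. -/
theorem coeff_translate (a : Fin 3) (s : ℝ) (f : SmoothTorus) (k : Fin 3 → ℤ) :
    coeff k (translate a s f) = Complex.exp (Complex.I * (k a * s)) * coeff k f := by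
  set c : UnitAddTorus (Fin 3) := cover ((s / (2 * Real.pi)) • Pi.single a 1) with hc
  have h1 : ∀ y, (translate a s f).toTorus y = f.toTorus (y + c) := by
    intro y
    obtain ⟨t, rfl⟩ := isOpenQuotientMap_cover.surjective y
    have : cover t + c = cover (t + (s / (2 * Real.pi)) • Pi.single a 1) := by
      ext b
      simp [hc, cover]
    rw [this, toTorus_cover, toTorus_cover, smul_add, smul_smul,
      mul_div_cancel₀ _ (by positivity : (2 * Real.pi) ≠ 0)]
    rfl
  have h2 : ∀ y, mFourier (-k) y = Complex.exp (Complex.I * (k a * s)) * mFourier (-k) (y + c) := by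
    intro y
    obtain ⟨t, rfl⟩ := isOpenQuotientMap_cover.surjective y
    have : cover t + c = cover (t + (s / (2 * Real.pi)) • Pi.single a 1) := by
      ext b
      simp [hc, cover]
    rw [this, mFourier_cover, mFourier_cover, ← Complex.exp_add]
    congr 1
    have hpi : (2 * Real.pi) ≠ 0 := by positivity
    have h4 : ∑ b, ((((-k) b : ℤ) : ℝ)) * (2 * Real.pi * (t + (s / (2 * Real.pi)) • Pi.single a 1 : Fin 3 → ℝ) b)
        = ∑ b, ((((-k) b : ℤ) : ℝ)) * (2 * Real.pi * t b) - k a * s := by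
      have h5 : ∀ b : Fin 3, ((((-k) b : ℤ) : ℝ)) *
          (2 * Real.pi * (t + (s / (2 * Real.pi)) • Pi.single a 1 : Fin 3 → ℝ) b)
          = ((((-k) b : ℤ) : ℝ)) * (2 * Real.pi * t b) - (if b = a then k a * s else 0) := by
        intro b
        by_cases hb : b = a
        · subst hb
          simp only [Pi.neg_apply, Pi.add_apply, Pi.smul_apply, Pi.single_eq_same, smul_eq_mul,
            if_true]
          push_cast
          field_simp
          ring
        · simp [hb]
      rw [Finset.sum_congr rfl fun b _ => h5 b, Finset.sum_sub_distrib]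
      simp
    rw [h4]
    push_cast
    ring
  simp only [coeff_def, fourierCLM_apply, mFourierCoeff, smul_eq_mul]
  rw [← integral_add_right_eq_self (fun y => mFourier (-k) y * f.toTorus y) c,
    ← integral_const_mul]
  refine integral_congr_ae (.of_forall fun y => ?_)
  simp only [h1]
  rw [h2 y]
  ring

/-- The coefficient of the translate is differentiated at `s = 0` in two ways: through the explicit
phase of `coeff_translate`, and under the integral sign, where the sup norm of `∂ₐ f` is a
dominating constant. -/
theorem coeff_pderiv (a : Fin 3) (f : SmoothTorus) (k : Fin 3 → ℤ) :
    coeff k (pderiv a f) = Complex.I * k a * coeff k f := by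
  have h1 : HasDerivAt (fun s : ℝ => coeff k (translate a s f)) (Complex.I * k a * coeff k f) 0 := by
    have h : HasDerivAt (fun s : ℝ => Complex.exp (Complex.I * (k a * s)) * coeff k f)
        (Complex.exp (Complex.I * (k a * (0 : ℝ))) * (Complex.I * (k a * 1)) * coeff k f) 0 :=
      (((((hasDerivAt_id (0 : ℝ)).ofReal_comp).const_mul _).const_mul _).cexp).mul_const _
    simp only [coeff_translate]
    convert h using 1
    simp
  have hpt : ∀ (s : ℝ) (y : UnitAddTorus (Fin 3)),
      HasDerivAt (fun s : ℝ => mFourier (-k) y • (translate a s f).toTorus y)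
        (mFourier (-k) y • (translate a s (pderiv a f)).toTorus y) s := by
    intro s y
    obtain ⟨t, rfl⟩ := isOpenQuotientMap_cover.surjective y
    simp only [toTorus_cover, smul_eq_mul]
    refine HasDerivAt.const_mul _ (HasDerivAt.ofReal_comp ?_)
    have hd : HasFDerivAt f (fderiv ℝ f ((2 * Real.pi) • t + s • Pi.single a 1))
        ((2 * Real.pi) • t + s • Pi.single a 1) :=
      (f.contDiff.differentiable (by simp) _).hasFDerivAt
    have hl : HasDerivAt (fun s : ℝ => (2 * Real.pi) • t + s • (Pi.single a 1 : Fin 3 → ℝ))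
        (Pi.single a 1) s := by
      have := ((hasDerivAt_id s).smul_const (Pi.single a 1 : Fin 3 → ℝ)).const_add
        ((2 * Real.pi) • t)
      simpa using this
    exact hd.comp_hasDerivAt s hl
  have h2 := hasDerivAt_integral_of_dominated_loc_of_deriv_le
    (μ := (volume : Measure (UnitAddTorus (Fin 3)))) (s := Set.univ) (x₀ := (0 : ℝ))
    (F := fun s y => mFourier (-k) y • (translate a s f).toTorus y)
    (F' := fun s y => mFourier (-k) y • (translate a s (pderiv a f)).toTorus y)
    (bound := fun _ => seminorm 0 (pderiv a f)) Filter.univ_mem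
    (.of_forall fun s => (integrable_torus (mFourier (-k) * (translate a s f).toTorus)).1)
    (integrable_torus (mFourier (-k) * (translate a 0 f).toTorus))
    (integrable_torus (mFourier (-k) * (translate a 0 (pderiv a f)).toTorus)).1
    (.of_forall fun y s _ => by
      rw [norm_smul]
      obtain ⟨t, rfl⟩ := isOpenQuotientMap_cover.surjective y
      have h3 : ‖mFourier (-k) (cover t)‖ ≤ 1 :=
        (ContinuousMap.norm_coe_le_norm _ _).trans mFourier_norm.le
      have h4 : ‖(translate a s (pderiv a f)).toTorus (cover t)‖ ≤ seminorm 0 (pderiv a f) := by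
        rw [toTorus_cover, Complex.norm_real]
        have := le_ciSup (bddAbove_iteratedFDeriv 0 (pderiv a f))
          ((2 * Real.pi) • t + s • Pi.single a 1)
        rw [norm_iteratedFDeriv_zero] at this
        exact this
      calc _ ≤ 1 * seminorm 0 (pderiv a f) := by gcongr
        _ = _ := one_mul _)
    (integrable_const _)
    (.of_forall fun y s _ => hpt s y)
  have h3 := h2.2.unique h1
  have h4 : translate a 0 (pderiv a f) = pderiv a f := by
    ext x
    change pderiv a f (x + (0 : ℝ) • Pi.single a 1) = _
    simp
  rw [← h3]
  simp only [h4]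
  rfl

end SmoothTorus

end TorusConstraints

end

/-! ### Decay of Fourier coefficients, inversion and synthesis -/

noncomputable section

namespace TorusConstraints

open UnitAddTorus Filter

/-- The exponent `6` is two per coordinate: the sup norm dominates each `|k a|`, so the term is at
most a product of three summable one-dimensional terms. -/
theorem summable_one_add_norm_inv_pow :
    Summable fun k : Fin 3 → ℤ => ((1 + ‖k‖) ^ 6)⁻¹ := by
  have h1 : Summable fun n : ℤ => ((1 + ‖n‖) ^ 2)⁻¹ := by
    have h := (Real.summable_one_div_int_pow (p := 2)).2 (by norm_num)
    refine Summable.of_norm_bounded_eventually (g := fun n : ℤ => 1 / (n : ℝ) ^ 2) h ?_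
    -- The comparison term `1 / 0 ^ 2` is `0` by convention, so `n = 0` has to be excluded.
    refine (Set.finite_singleton (0 : ℤ)).subset fun n hn => ?_
    by_contra hn0
    refine hn ?_
    have hn1 : (0 : ℝ) < ‖n‖ := norm_pos_iff.2 hn0
    change ‖((1 + ‖n‖) ^ 2)⁻¹‖ ≤ 1 / (n : ℝ) ^ 2
    rw [Real.norm_of_nonneg (by positivity), ← one_div]
    have : (n : ℝ) ^ 2 = ‖n‖ ^ 2 := by rw [Int.norm_eq_abs, sq_abs]
    rw [this]
    gcongr
    linarith
  have h2 := (h1.mul_of_nonneg (h1.mul_of_nonneg h1 (fun _ => by positivity)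
    (fun _ => by positivity)) (fun _ => by positivity) (fun _ => by positivity)).comp_injective
    (i := fun k : Fin 3 → ℤ => (k 0, k 1, k 2)) (by
      intro k l h
      simp only [Prod.mk.injEq] at h
      ext a
      fin_cases a
      exacts [h.1, h.2.1, h.2.2])
  refine Summable.of_nonneg_of_le (fun k => by positivity) (fun k => ?_) h2
  simp only [Function.comp_apply]
  rw [← mul_inv, ← mul_inv]
  have h3 : ∀ a, ‖k a‖ ≤ ‖k‖ := norm_le_pi_norm k
  have h4 : (1 + ‖k‖) ^ 6 = (1 + ‖k‖) ^ 2 * ((1 + ‖k‖) ^ 2 * (1 + ‖k‖) ^ 2) := by ring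
  rw [h4]
  gcongr <;> exact h3 _

namespace SmoothTorus

theorem seminorm_pderiv_le (n : ℕ) (a : Fin 3) (f : SmoothTorus) :
    seminorm n (pderiv a f) ≤ seminorm (n + 1) f := by
  refine ciSup_le fun x => ?_
  have h1 : ContDiff ℝ ∞ (fderiv ℝ f) := f.contDiff.fderiv_right (m := ∞) (by simp)
  have h2 := norm_iteratedFDeriv_clm_apply_const (𝕜 := ℝ) (f := fderiv ℝ f)
    (c := (Pi.single a 1 : Fin 3 → ℝ)) (x := x) (n := n) (N := ∞) h1.contDiffAt
    (by exact_mod_cast le_top)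
  refine h2.trans ?_
  rw [norm_iteratedFDeriv_fderiv]
  have h3 : ‖(Pi.single a 1 : Fin 3 → ℝ)‖ = 1 := by
    rw [Pi.norm_single]; simp
  rw [h3, one_mul]
  exact le_ciSup (bddAbove_iteratedFDeriv (n + 1) f) x

theorem seminorm_iterate_pderiv_le (n : ℕ) (a : Fin 3) (f : SmoothTorus) :
    ∀ m, seminorm m ((pderiv a)^[n] f) ≤ seminorm (m + n) f := by
  induction n generalizing f with
  | zero => exact fun m => le_rfl
  | succ n ih =>
    intro m
    rw [Function.iterate_succ_apply]
    refine (ih _ m).trans ?_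
    exact seminorm_pderiv_le (m + n) a f

theorem coeff_iterate_pderiv (n : ℕ) (a : Fin 3) (f : SmoothTorus) (k : Fin 3 → ℤ) :
    coeff k ((pderiv a)^[n] f) = (Complex.I * k a) ^ n * coeff k f := by
  induction n generalizing f with
  | zero => simp
  | succ n ih =>
    rw [Function.iterate_succ_apply, ih, coeff_pderiv]
    ring

/-- The sup norm of `k` is attained at some coordinate `a`, and `n` derivatives in that single
direction produce the full factor `‖k‖ ^ n`. -/
theorem norm_pow_mul_norm_coeff_le (n : ℕ) (f : SmoothTorus) (k : Fin 3 → ℤ) :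
    ‖k‖ ^ n * ‖coeff k f‖ ≤ seminorm n f := by
  obtain ⟨a, ha⟩ : ∃ a, ‖k‖ = ‖k a‖ := by
    obtain ⟨a, -, ha⟩ := Finset.exists_max_image Finset.univ (fun a => ‖k a‖) Finset.univ_nonempty
    refine ⟨a, le_antisymm ?_ (norm_le_pi_norm k a)⟩
    exact (pi_norm_le_iff_of_nonneg (norm_nonneg _)).2 fun b => ha b (Finset.mem_univ b)
  have h := (norm_coeff_le k ((pderiv a)^[n] f)).trans (seminorm_iterate_pderiv_le n a f 0)
  rw [coeff_iterate_pderiv, norm_mul, norm_pow, norm_mul, Complex.norm_I, one_mul,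
    Complex.norm_intCast, zero_add] at h
  rwa [ha, Int.norm_eq_abs]

theorem one_add_norm_pow_mul_norm_coeff_le (n : ℕ) (f : SmoothTorus) (k : Fin 3 → ℤ) :
    (1 + ‖k‖) ^ n * ‖coeff k f‖ ≤ 2 ^ n * (seminorm 0 f + seminorm n f) := by
  have h1 := norm_coeff_le k f
  have h2 := norm_pow_mul_norm_coeff_le n f k
  have h3 : (1 + ‖k‖) ^ n ≤ 2 ^ n * (1 + ‖k‖ ^ n) := by
    rcases le_total 1 ‖k‖ with h | h
    · calc (1 + ‖k‖) ^ n ≤ (2 * ‖k‖) ^ n := by gcongr; linarith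
        _ = 2 ^ n * ‖k‖ ^ n := mul_pow _ _ _
        _ ≤ _ := by gcongr; linarith
    · calc (1 + ‖k‖) ^ n ≤ 2 ^ n := by gcongr; linarith
        _ ≤ _ := by
          have : 0 ≤ ‖k‖ ^ n := by positivity
          have h2 : (0 : ℝ) < 2 ^ n := by positivity
          nlinarith
  calc (1 + ‖k‖) ^ n * ‖coeff k f‖ ≤ 2 ^ n * (1 + ‖k‖ ^ n) * ‖coeff k f‖ := by gcongr
    _ = 2 ^ n * (‖coeff k f‖ + ‖k‖ ^ n * ‖coeff k f‖) := by ring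
    _ ≤ _ := by gcongr

/-- The constant comparing weighted Fourier norms with the `C^n` seminorms. -/
def decayConst (n : ℕ) : ℝ := 2 ^ (n + 6) * ∑' k : Fin 3 → ℤ, ((1 + ‖k‖) ^ 6)⁻¹

/-- Six additional derivatives pay for a summable factor. -/
theorem one_add_norm_pow_mul_norm_coeff_le' (n : ℕ) (f : SmoothTorus) (k : Fin 3 → ℤ) :
    (1 + ‖k‖) ^ n * ‖coeff k f‖ ≤
      2 ^ (n + 6) * (seminorm 0 f + seminorm (n + 6) f) * ((1 + ‖k‖) ^ 6)⁻¹ := by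
  rw [← div_eq_mul_inv, le_div_iff₀ (by positivity)]
  refine le_trans (le_of_eq ?_) (one_add_norm_pow_mul_norm_coeff_le (n + 6) f k)
  ring

theorem summable_coeff (n : ℕ) (f : SmoothTorus) :
    Summable fun k => (1 + ‖k‖) ^ n * ‖coeff k f‖ :=
  Summable.of_nonneg_of_le (fun k => by positivity)
    (fun k => one_add_norm_pow_mul_norm_coeff_le' n f k)
    (summable_one_add_norm_inv_pow.mul_left _)

theorem tsum_coeff_le (n : ℕ) (f : SmoothTorus) :
    ∑' k, (1 + ‖k‖) ^ n * ‖coeff k f‖ ≤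
      decayConst n * (seminorm 0 f + seminorm (n + 6) f) := by
  refine (Summable.tsum_le_tsum (fun k => one_add_norm_pow_mul_norm_coeff_le' n f k)
    (summable_coeff n f) (summable_one_add_norm_inv_pow.mul_left _)).trans (le_of_eq ?_)
  rw [tsum_mul_left, decayConst]
  ring

theorem hasSum_toTorus (f : SmoothTorus) : HasSum (fun k => coeff k f • mFourier k) f.toTorus := by
  refine hasSum_mFourier_series_of_summable (Summable.of_norm ?_)
  simpa using! summable_coeff 0 f

theorem ext_coeff {f g : SmoothTorus} (h : ∀ k, coeff k f = coeff k g) : f = g := by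
  refine toTorus_injective ((hasSum_toTorus f).unique ?_)
  simp only [h]
  exact hasSum_toTorus g

/-- The Fourier series of `f` converges uniformly, so it may be multiplied by `g` and the continuous
coefficient functional applied term by term. -/
theorem hasSum_coeff_mul (f g : SmoothTorus) (n : Fin 3 → ℤ) :
    HasSum (fun k => coeff k f * coeff (n - k) g) (coeff n (f * g)) := by
  have h := (fourierCLM n).hasSum ((hasSum_toTorus f).mul_right g.toTorus)
  rw [← toTorus_mul] at h
  refine (funext fun k => ?_ : (fun k => coeff k f * coeff (n - k) g) = _) ▸ h
  rw [smul_mul_assoc, map_smul, fourierCLM_mFourier_mul, smul_eq_mul, coeff_def, coeff_def]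

/-- The real trigonometric monomial `Re (c e^{i t})`. -/
def reExp (c : ℂ) (t : ℝ) : ℝ := (c * Complex.exp (Complex.I * t)).re

theorem hasDerivAt_reExp (c : ℂ) (t : ℝ) : HasDerivAt (reExp c) (reExp (c * Complex.I) t) t := by
  have h : HasDerivAt (fun s : ℝ => c * Complex.exp (Complex.I * s))
      (c * (Complex.exp (Complex.I * t) * (Complex.I * 1))) t :=
    ((((hasDerivAt_id t).ofReal_comp).const_mul _).cexp).const_mul _
  have h2 := Complex.reCLM.hasFDerivAt.comp_hasDerivAt t h
  have e : reExp (c * Complex.I) t =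
      Complex.reCLM (c * (Complex.exp (Complex.I * t) * (Complex.I * 1))) := by
    change (c * Complex.I * Complex.exp (Complex.I * t)).re = _
    rw [Complex.reCLM_apply]
    congr 1
    ring
  rw [e]
  exact h2

theorem contDiff_reExp (c : ℂ) : ContDiff ℝ ∞ (reExp c) := by
  exact Complex.reCLM.contDiff.comp (contDiff_const.mul
    ((contDiff_const.mul Complex.ofRealCLM.contDiff).cexp))

theorem iteratedDeriv_reExp (c : ℂ) (n : ℕ) :
    iteratedDeriv n (reExp c) = reExp (c * Complex.I ^ n) := by
  induction n with
  | zero => simp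
  | succ n ih =>
    rw [iteratedDeriv_succ, ih]
    ext t
    rw [(hasDerivAt_reExp _ t).deriv, pow_succ, mul_assoc]

theorem abs_reExp_le (c : ℂ) (t : ℝ) : |reExp c t| ≤ ‖c‖ := by
  refine (Complex.abs_re_le_norm _).trans ?_
  rw [norm_mul, mul_comm Complex.I, Complex.norm_exp_ofReal_mul_I, mul_one]

/-- The linear form `x ↦ k · x`. -/
def dotCLM (k : Fin 3 → ℤ) : (Fin 3 → ℝ) →L[ℝ] ℝ :=
  ∑ a, (k a : ℝ) • ContinuousLinearMap.proj a

theorem dotCLM_apply (k : Fin 3 → ℤ) (x : Fin 3 → ℝ) : dotCLM k x = ∑ a, k a * x a := by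
  simp [dotCLM]

theorem norm_dotCLM_le (k : Fin 3 → ℤ) : ‖dotCLM k‖ ≤ 3 * ‖k‖ := by
  refine ContinuousLinearMap.opNorm_le_bound _ (by positivity) fun x => ?_
  rw [dotCLM_apply]
  refine (norm_sum_le _ _).trans ?_
  calc ∑ a, ‖(k a : ℝ) * x a‖ ≤ ∑ a : Fin 3, ‖k‖ * ‖x‖ := by
        refine Finset.sum_le_sum fun a _ => ?_
        rw [norm_mul]
        have h1 := norm_le_pi_norm k a
        have h2 := norm_le_pi_norm x a
        rw [Int.norm_eq_abs] at h1
        rw [Real.norm_eq_abs]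
        gcongr
    _ = _ := by simp; ring

theorem norm_iteratedFDeriv_reExp_le (c : ℂ) (k : Fin 3 → ℤ) (n : ℕ) (x : Fin 3 → ℝ) :
    ‖iteratedFDeriv ℝ n (fun x => reExp c (dotCLM k x)) x‖ ≤ 3 ^ n * ((1 + ‖k‖) ^ n * ‖c‖) := by
  have h := (dotCLM k).iteratedFDeriv_comp_right (contDiff_reExp c) x (i := n)
    (by exact_mod_cast le_top)
  have h' : (fun x => reExp c (dotCLM k x)) = reExp c ∘ dotCLM k := rfl
  rw [h', h]
  refine (ContinuousMultilinearMap.norm_compContinuousLinearMap_le _ _).trans ?_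
  rw [norm_iteratedFDeriv_eq_norm_iteratedDeriv, iteratedDeriv_reExp, Finset.prod_const,
    Finset.card_univ, Fintype.card_fin]
  have h1 : ‖reExp (c * Complex.I ^ n) (dotCLM k x)‖ ≤ ‖c‖ := by
    refine (abs_reExp_le _ _).trans (le_of_eq ?_)
    simp
  calc _ ≤ ‖c‖ * (3 * ‖k‖) ^ n := by gcongr; exact norm_dotCLM_le k
    _ ≤ ‖c‖ * (3 * (1 + ‖k‖)) ^ n := by gcongr; linarith
    _ = _ := by rw [mul_pow]; ring

theorem eq_tsum_reExp (f : SmoothTorus) (x : Fin 3 → ℝ) :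
    f x = ∑' k, reExp (coeff k f) (dotCLM k x) := by
  have h := (ContinuousMap.evalCLM ℂ (cover ((2 * Real.pi)⁻¹ • x))).hasSum (hasSum_toTorus f)
  have h2 := Complex.reCLM.hasSum h
  have hpi : (2 * Real.pi) ≠ 0 := by positivity
  have h3 : Complex.reCLM ((ContinuousMap.evalCLM ℂ (cover ((2 * Real.pi)⁻¹ • x))) f.toTorus)
      = f x := by
    simp only [ContinuousMap.evalCLM_apply, toTorus_cover, smul_smul, mul_inv_cancel₀ hpi, one_smul]
    simp
  rw [h3] at h2
  rw [← h2.tsum_eq]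
  refine tsum_congr fun k => ?_
  have h4 : dotCLM k x = ∑ a, (k a : ℝ) * (2 * Real.pi * ((2 * Real.pi)⁻¹ • x) a) := by
    rw [dotCLM_apply]
    refine Finset.sum_congr rfl fun a _ => ?_
    simp only [Pi.smul_apply, smul_eq_mul]
    rw [← mul_assoc (2 * Real.pi), mul_inv_cancel₀ hpi, one_mul]
  simp only [ContinuousMap.evalCLM_apply, ContinuousMap.smul_apply,
    mFourier_cover, Complex.reCLM_apply, reExp, smul_eq_mul, h4]

/-- Termwise differentiation of the Fourier series. Together with `tsum_coeff_le` it shows that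
weighted `ℓ¹` norms of Fourier coefficients generate the Fréchet topology. -/
theorem seminorm_le_tsum (n : ℕ) (f : SmoothTorus) :
    seminorm n f ≤ 3 ^ n * ∑' k, (1 + ‖k‖) ^ n * ‖coeff k f‖ := by
  refine ciSup_le fun x => ?_
  have h1 : (f : (Fin 3 → ℝ) → ℝ) = fun x => ∑' k, reExp (coeff k f) (dotCLM k x) :=
    funext (eq_tsum_reExp f)
  rw [h1, iteratedFDeriv_tsum_apply (N := ⊤) (f := fun k x => reExp (coeff k f) (dotCLM k x))
    (v := fun n k => 3 ^ n * ((1 + ‖k‖) ^ n * ‖coeff k f‖))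
    (fun k => (contDiff_reExp _).comp (dotCLM k).contDiff)
    (fun n _ => (summable_coeff n f).mul_left _)
    (fun n k x _ => norm_iteratedFDeriv_reExp_le _ k n x) le_top, ← tsum_mul_left]
  exact tsum_of_norm_bounded ((summable_coeff n f).mul_left _).hasSum
    fun k => norm_iteratedFDeriv_reExp_le _ k n x

/-- A rapidly decreasing family with the reality condition is the family of Fourier coefficients of
a smooth real function. -/
theorem exists_coeff_eq (c : (Fin 3 → ℤ) → ℂ)
    (hc : ∀ n : ℕ, Summable fun k => (1 + ‖k‖) ^ n * ‖c k‖)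
    (hconj : ∀ k, c (-k) = (starRingEnd ℂ) (c k)) : ∃ f : SmoothTorus, ∀ k, coeff k f = c k := by
  have hc0 : Summable fun k => ‖c k‖ := by simpa using hc 0
  have hsm : ContDiff ℝ ∞ fun x => ∑' k, reExp (c k) (dotCLM k x) :=
    contDiff_tsum (N := ⊤) (v := fun n k => 3 ^ n * ((1 + ‖k‖) ^ n * ‖c k‖))
      (fun k => (contDiff_reExp _).comp (dotCLM k).contDiff)
      (fun n _ => (hc n).mul_left _) (fun n k x _ => norm_iteratedFDeriv_reExp_le _ k n x)
  let f : SmoothTorus := ⟨fun x => ∑' k, reExp (c k) (dotCLM k x), hsm, fun x a => by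
    refine tsum_congr fun k => ?_
    rw [map_add]
    have h1 : dotCLM k (Pi.single a (2 * Real.pi)) = k a * (2 * Real.pi) := by
      rw [dotCLM_apply, Finset.sum_eq_single a (fun b _ hb => by simp [hb]) (by simp)]
      simp
    have h2 : Complex.exp (Complex.I * ((k a * (2 * Real.pi) : ℝ) : ℂ)) = 1 := by
      rw [← Complex.exp_int_mul_two_pi_mul_I (k a)]
      congr 1
      push_cast
      ring
    rw [reExp, h1, Complex.ofReal_add, mul_add, Complex.exp_add, h2, mul_one]
    rfl⟩
  have hsum : Summable fun k => c k • mFourier (d := Fin 3) k :=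
    Summable.of_norm (by simpa [norm_smul, mFourier_norm] using hc0)
  have hf : f.toTorus = ∑' k, c k • mFourier k := by
    refine torus_ext fun t => ?_
    have h1 := (ContinuousMap.evalCLM ℂ (cover t)).hasSum hsum.hasSum
    have h2 : ∀ k, ((ContinuousMap.evalCLM ℂ (cover t)) (c k • mFourier k)) =
        c k * Complex.exp (Complex.I * (dotCLM k ((2 * Real.pi) • t) : ℝ)) := by
      intro k
      simp only [ContinuousMap.evalCLM_apply, ContinuousMap.smul_apply, mFourier_cover,
        smul_eq_mul, dotCLM_apply, Pi.smul_apply]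
    -- By the reality condition, conjugation amounts to the substitution `k ↦ -k` in the series. The
    -- sum is therefore real, and the real part in the definition of `f` loses nothing.
    have h3 : (starRingEnd ℂ) ((∑' k, c k • mFourier k : C(UnitAddTorus (Fin 3), ℂ)) (cover t))
        = (∑' k, c k • mFourier k : C(UnitAddTorus (Fin 3), ℂ)) (cover t) := by
      have h4 := (Complex.conjCLE : ℂ →L[ℝ] ℂ).hasSum h1
      have h5 := (Equiv.neg (Fin 3 → ℤ)).hasSum_iff.2 h4
      refine HasSum.unique (f := fun k => (ContinuousMap.evalCLM ℂ (cover t)) (c k • mFourier k))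
        ?_ h1
      convert h5 using 1
      · ext k
        simp [hconj, mFourier_neg]
      · simp
    rw [toTorus_cover]
    have h6 := Complex.reCLM.hasSum h1
    have h7 : f ((2 * Real.pi) • t) = ((∑' k, c k • mFourier k :
        C(UnitAddTorus (Fin 3), ℂ)) (cover t)).re := by
      change ∑' k, reExp (c k) (dotCLM k ((2 * Real.pi) • t)) = _
      rw [← ContinuousMap.evalCLM_apply ℂ, ← Complex.reCLM_apply, ← h6.tsum_eq]
      refine tsum_congr fun k => ?_
      simp only [h2, Complex.reCLM_apply, reExp]
    rw [h7]
    exact Complex.conj_eq_iff_re.1 h3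
  refine ⟨f, fun k => ?_⟩
  rw [coeff_def, hf]
  have h1 := (fourierCLM k).hasSum hsum.hasSum
  refine h1.unique ?_
  have h2 : ∀ l, (fourierCLM k) (c l • mFourier l) = if l = k then c k else 0 := by
    intro l
    rw [map_smul, fourierCLM_mFourier]
    by_cases h : l = k
    · simp [h]
    · simp [h, Ne.symm h]
  have h3 : (fun l => (fourierCLM k) (c l • mFourier l)) = fun l => if l = k then c k else 0 :=
    funext h2
  rw [h3]
  exact hasSum_ite_eq k (c k)

end SmoothTorus

end TorusConstraints

end

/-! ### Weighted Wiener algebras -/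

noncomputable section

namespace TorusConstraints

open UnitAddTorus Filter

/-- A submultiplicative weight on `ℤ³` of polynomial growth. -/
structure Weight where
  /-- The value of the weight at a frequency. -/
  val : (Fin 3 → ℤ) → ℝ
  one_le : ∀ k, 1 ≤ val k
  val_add_le : ∀ k l, val (k + l) ≤ val k * val l
  growth : ∃ n : ℕ, ∀ k, val k ≤ (1 + ‖k‖) ^ n

namespace Weight

theorem pos (w : Weight) (k : Fin 3 → ℤ) : 0 < w.val k := zero_lt_one.trans_le (w.one_le k)

/-- The weight `(1 + |k| / (m + 1))^s`. -/
def low (s m : ℕ) : Weight where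
  -- For fixed `m` this grows like the usual Sobolev weight of order `s`, but it tends to `1` at
  -- each frequency as `m → ∞`.
  val k := (1 + ‖k‖ / (m + 1)) ^ s
  one_le k := one_le_pow₀ (by
    have : 0 ≤ ‖k‖ / (m + 1 : ℝ) := by positivity
    linarith)
  val_add_le k l := by
    rw [← mul_pow]
    gcongr
    have h1 : ‖k + l‖ / (m + 1 : ℝ) ≤ ‖k‖ / (m + 1) + ‖l‖ / (m + 1) := by
      rw [← add_div]
      gcongr
      exact norm_add_le k l
    have h2 : 0 ≤ ‖k‖ / (m + 1 : ℝ) * (‖l‖ / (m + 1)) := by positivity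
    nlinarith
  growth := ⟨s, fun k => by
    gcongr
    exact div_le_self (norm_nonneg _) (by linarith [(Nat.cast_nonneg m : (0 : ℝ) ≤ m)])⟩

/-- The weight `(1 + |k|) (1 + |k| / (m + 1))^s`. -/
def high (s m : ℕ) : Weight where
  val k := (1 + ‖k‖) * (low s m).val k
  one_le k := one_le_mul_of_one_le_of_one_le (by linarith [norm_nonneg k]) ((low s m).one_le k)
  val_add_le k l := by
    have h1 := (low s m).val_add_le k l
    have h2 : 1 + ‖k + l‖ ≤ (1 + ‖k‖) * (1 + ‖l‖) := by
      nlinarith [norm_add_le k l, norm_nonneg k, norm_nonneg l]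
    calc _ ≤ ((1 + ‖k‖) * (1 + ‖l‖)) * ((low s m).val k * (low s m).val l) := by
          gcongr
          exact ((low s m).pos _).le
      _ = _ := by ring
  growth := by
    obtain ⟨n, hn⟩ := (low s m).growth
    refine ⟨n + 1, fun k => ?_⟩
    rw [pow_succ']
    gcongr
    exact hn k

theorem high_val (s m : ℕ) (k : Fin 3 → ℤ) : (high s m).val k = (1 + ‖k‖) * (low s m).val k := rfl

theorem low_val (s m : ℕ) (k : Fin 3 → ℤ) : (low s m).val k = (1 + ‖k‖ / (m + 1)) ^ s := rfl

end Weight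

namespace SmoothTorus

theorem summable_weight (w : Weight) (f : SmoothTorus) :
    Summable fun k => w.val k * ‖coeff k f‖ := by
  obtain ⟨n, hn⟩ := w.growth
  refine Summable.of_nonneg_of_le (fun k => mul_nonneg (w.pos k).le (norm_nonneg _))
    (fun k => ?_) (summable_coeff n f)
  gcongr
  exact hn k

/-- The weighted Wiener norm `∑ₖ w(k) |f̂(k)|`. -/
def wnorm (w : Weight) (f : SmoothTorus) : ℝ := ∑' k, w.val k * ‖coeff k f‖

theorem norm_coeff_le_wnorm (w : Weight) (f : SmoothTorus) (k : Fin 3 → ℤ) :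
    ‖coeff k f‖ ≤ wnorm w f := by
  refine le_trans ?_ ((summable_weight w f).le_tsum k
    fun l _ => mul_nonneg (w.pos l).le (norm_nonneg _))
  exact le_mul_of_one_le_left (norm_nonneg _) (w.one_le k)

/-- A map that multiplies each Fourier coefficient by a bounded factor is bounded. -/
theorem wnorm_le_of_coeff_le {w w' : Weight} {C : ℝ} {f g : SmoothTorus}
    (h : ∀ k, w'.val k * ‖coeff k g‖ ≤ C * (w.val k * ‖coeff k f‖)) :
    wnorm w' g ≤ C * wnorm w f := by
  rw [wnorm, wnorm, ← tsum_mul_left]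
  exact (summable_weight w' g).tsum_le_tsum h ((summable_weight w f).mul_left C)

theorem wnorm_add_le (w : Weight) (f g : SmoothTorus) : wnorm w (f + g) ≤ wnorm w f + wnorm w g := by
  rw [wnorm, wnorm, wnorm, ← (summable_weight w f).tsum_add (summable_weight w g)]
  refine (summable_weight w _).tsum_le_tsum (fun k => ?_)
    ((summable_weight w f).add (summable_weight w g))
  rw [map_add, ← mul_add]
  exact mul_le_mul_of_nonneg_left (norm_add_le _ _) (w.pos k).le

theorem wnorm_smul (w : Weight) (c : ℝ) (f : SmoothTorus) : wnorm w (c • f) = |c| * wnorm w f := by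
  rw [wnorm, wnorm, ← tsum_mul_left]
  refine tsum_congr fun k => ?_
  rw [map_smul, norm_smul, Real.norm_eq_abs]
  ring

/-- Young's inequality for convolutions in `ℓ¹`, with the weight distributed by its
submultiplicativity. The constant is `1` for every weight, which is the source of all bounds uniform
in `s` and `m`. -/
theorem wnorm_mul_le (w : Weight) (f g : SmoothTorus) : wnorm w (f * g) ≤ wnorm w f * wnorm w g := by
  set a := fun k => w.val k * ‖coeff k f‖ with ha
  set b := fun k => w.val k * ‖coeff k g‖ with hb
  have ha0 : ∀ k, 0 ≤ a k := fun k => mul_nonneg (w.pos k).le (norm_nonneg _)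
  have hb0 : ∀ k, 0 ≤ b k := fun k => mul_nonneg (w.pos k).le (norm_nonneg _)
  have has : Summable a := summable_weight w f
  have hbs : Summable b := summable_weight w g
  have hprod : Summable fun q : (Fin 3 → ℤ) × (Fin 3 → ℤ) => a q.1 * b q.2 :=
    has.mul_of_nonneg hbs ha0 hb0
  -- The substitution `(n, k) ↦ (k, n - k)` turns the double series of the product into a series of
  -- convolutions.
  let e : (Fin 3 → ℤ) × (Fin 3 → ℤ) ≃ (Fin 3 → ℤ) × (Fin 3 → ℤ) :=
    { toFun := fun q => (q.2, q.1 - q.2)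
      invFun := fun q => (q.1 + q.2, q.1)
      left_inv := fun q => by simp
      right_inv := fun q => by simp }
  have hprod' : Summable fun q : (Fin 3 → ℤ) × (Fin 3 → ℤ) => a q.2 * b (q.1 - q.2) :=
    e.summable_iff.2 hprod
  have h1 : wnorm w f * wnorm w g = ∑' n, ∑' k, a k * b (n - k) := by
    rw [wnorm, wnorm, has.tsum_mul_tsum hbs hprod, ← hprod'.tsum_prod,
      ← e.tsum_eq fun q : (Fin 3 → ℤ) × (Fin 3 → ℤ) => a q.1 * b q.2]
    rfl
  rw [h1]
  refine (summable_weight w _).tsum_le_tsum (fun n => ?_) hprod'.prod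
  have h2 : Summable fun k => a k * b (n - k) := hprod'.prod_factor n
  rw [← (hasSum_coeff_mul f g n).tsum_eq]
  have h3 : ∀ k, w.val n * ‖coeff k f * coeff (n - k) g‖ ≤ a k * b (n - k) := by
    intro k
    have h4 := w.val_add_le k (n - k)
    rw [add_sub_cancel] at h4
    rw [norm_mul]
    calc _ ≤ (w.val k * w.val (n - k)) * (‖coeff k f‖ * ‖coeff (n - k) g‖) := by gcongr
      _ = _ := by simp only [ha, hb]; ring
  have h5 : Summable fun k => w.val n * ‖coeff k f * coeff (n - k) g‖ :=
    Summable.of_nonneg_of_le (fun k => mul_nonneg (w.pos n).le (norm_nonneg _)) h3 h2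
  have h6 : Summable fun k => ‖coeff k f * coeff (n - k) g‖ :=
    (summable_mul_left_iff (w.pos n).ne').1 h5
  calc _ ≤ w.val n * ∑' k, ‖coeff k f * coeff (n - k) g‖ :=
        mul_le_mul_of_nonneg_left (norm_tsum_le_tsum_norm h6) (w.pos n).le
    _ = ∑' k, w.val n * ‖coeff k f * coeff (n - k) g‖ := tsum_mul_left.symm
    _ ≤ _ := h5.tsum_le_tsum h3 h2

theorem eq_zero_of_wnorm_eq_zero (w : Weight) (f : SmoothTorus) (h : wnorm w f = 0) : f = 0 := by
  refine ext_coeff fun k => ?_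
  have := norm_coeff_le_wnorm w f k
  rw [h] at this
  rw [map_zero]
  exact norm_le_zero_iff.1 this

/-- The weighted Wiener norm as a ring norm. -/
def ringNorm (w : Weight) : RingNorm SmoothTorus where
  toFun := wnorm w
  map_zero' := by simp [wnorm]
  add_le' := wnorm_add_le w
  neg' f := by simp [wnorm]
  mul_le' := wnorm_mul_le w
  eq_zero_of_map_eq_zero' := eq_zero_of_wnorm_eq_zero w

end SmoothTorus

/-- The space of smooth functions with a weighted Wiener norm. -/
def WAlg (_ : Weight) : Type := SmoothTorus

namespace WAlg

variable (w : Weight)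

instance : CommRing (WAlg w) := inferInstanceAs (CommRing SmoothTorus)

instance : Algebra ℝ (WAlg w) := inferInstanceAs (Algebra ℝ SmoothTorus)

instance : NormedRing (WAlg w) := RingNorm.toNormedRing (SmoothTorus.ringNorm w)

instance : NormedCommRing (WAlg w) where
  mul_comm := mul_comm (G := SmoothTorus)

theorem norm_def (f : WAlg w) : ‖f‖ = SmoothTorus.wnorm w f := rfl

instance : NormedAlgebra ℝ (WAlg w) where
  smul := (· • ·)
  algebraMap := algebraMap ℝ SmoothTorus
  commutes' := Algebra.commutes (A := SmoothTorus)
  smul_def' := Algebra.smul_def (A := SmoothTorus)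
  norm_smul_le c f := by
    rw [norm_def, norm_def, Real.norm_eq_abs]
    exact (SmoothTorus.wnorm_smul w c f).le

end WAlg

/-- The Banach algebra obtained by completing `WAlg w`. -/
abbrev Hat (w : Weight) : Type := UniformSpace.Completion (WAlg w)

namespace Hat

variable {w w' : Weight}

/-- The embedding of smooth functions into the Banach algebra `Hat w`. -/
def emb (w : Weight) : SmoothTorus →ₐ[ℝ] Hat w where
  toFun f := UniformSpace.Completion.coe' (α := WAlg w) f
  map_one' := rfl
  map_mul' f g := UniformSpace.Completion.coe_mul (α := WAlg w) f g
  map_zero' := rfl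
  map_add' f g := UniformSpace.Completion.coe_add (α := WAlg w) f g
  commutes' _ := rfl

theorem norm_emb (w : Weight) (f : SmoothTorus) : ‖emb w f‖ = SmoothTorus.wnorm w f :=
  UniformSpace.Completion.norm_coe (E := WAlg w) f

theorem denseRange_emb (w : Weight) : DenseRange (emb w) :=
  UniformSpace.Completion.denseRange_coe (α := WAlg w)

theorem norm_algebraMap_le (w : Weight) (c : ℝ) :
    ‖algebraMap ℝ (Hat w) c‖ ≤ |c| * SmoothTorus.wnorm w 1 := by
  have : algebraMap ℝ (Hat w) c = emb w (c • 1) := by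
    rw [map_smul, map_one, Algebra.algebraMap_eq_smul_one]
  rw [this, norm_emb, SmoothTorus.wnorm_smul]

section Lift

variable {Y : Type*} [NormedAddCommGroup Y] [NormedSpace ℝ Y] [CompleteSpace Y]

/-- A linear map on smooth functions that is bounded in a weighted norm. -/
def bounded (T : SmoothTorus →ₗ[ℝ] Y) (C : ℝ) (h : ∀ f, ‖T f‖ ≤ C * SmoothTorus.wnorm w f) :
    WAlg w →L[ℝ] Y :=
  LinearMap.mkContinuous
    { toFun := fun f => T f
      map_add' := T.map_add
      map_smul' := T.map_smul } C h

/-- The extension to the completion of a bounded linear map on smooth functions. -/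
def lift (T : SmoothTorus →ₗ[ℝ] Y) (C : ℝ) (h : ∀ f, ‖T f‖ ≤ C * SmoothTorus.wnorm w f) :
    Hat w →L[ℝ] Y :=
  (bounded T C h).extend UniformSpace.Completion.toComplL

theorem lift_emb (T : SmoothTorus →ₗ[ℝ] Y) (C : ℝ) (h : ∀ f, ‖T f‖ ≤ C * SmoothTorus.wnorm w f)
    (f : SmoothTorus) : lift T C h (emb w f) = T f :=
  ContinuousLinearMap.extend_eq (bounded T C h)
    (UniformSpace.Completion.denseRange_coe (α := WAlg w))
    (UniformSpace.Completion.isUniformInducing_coe (α := WAlg w)) f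

theorem norm_lift_le (T : SmoothTorus →ₗ[ℝ] Y) {C : ℝ} (hC : 0 ≤ C)
    (h : ∀ f, ‖T f‖ ≤ C * SmoothTorus.wnorm w f) : ‖lift T C h‖ ≤ C := by
  have h1 := (bounded T C h).opNorm_extend_le (e := UniformSpace.Completion.toComplL (𝕜 := ℝ))
    (N := 1) (UniformSpace.Completion.denseRange_coe (α := WAlg w)) (fun x => by
      rw [NNReal.coe_one, one_mul]
      exact (UniformSpace.Completion.norm_coe x).ge)
  rw [NNReal.coe_one, one_mul] at h1
  exact h1.trans (LinearMap.mkContinuous_norm_le _ hC _)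

end Lift

end Hat

end TorusConstraints

end

/-! ### Operators on smooth functions and the Fréchet topology in terms of Wiener norms -/

noncomputable section

namespace TorusConstraints

open UnitAddTorus Filter

instance : IsTopologicalAddGroup SmoothTorus := SmoothTorus.withSeminorms.topologicalAddGroup

instance : ContinuousSMul ℝ SmoothTorus := SmoothTorus.withSeminorms.continuousSMul

/-- At fixed `m` the rescaling costs only the constant `(m + 1) ^ s`. Every choice of `m` as a
function of `s` thus gives the same topology. -/
theorem Weight.pow_le_high (s m : ℕ) (k : Fin 3 → ℤ) :
    (1 + ‖k‖) ^ s ≤ ((m : ℝ) + 1) ^ s * (Weight.high s m).val k := by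
  rw [Weight.high_val, Weight.low_val]
  calc (1 + ‖k‖) ^ s ≤ ((m + 1) * (1 + ‖k‖ / (m + 1))) ^ s := by
        gcongr
        rw [mul_add, mul_div_cancel₀ _ (by positivity : (m + 1 : ℝ) ≠ 0)]
        linarith [(Nat.cast_nonneg m : (0 : ℝ) ≤ m)]
    _ = 1 * ((m + 1) ^ s * (1 + ‖k‖ / (m + 1)) ^ s) := by rw [mul_pow, one_mul]
    _ ≤ (1 + ‖k‖) * ((m + 1) ^ s * (1 + ‖k‖ / (m + 1)) ^ s) := by
        gcongr
        linarith [norm_nonneg k]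
    _ = _ := by ring

namespace SmoothTorus

/-- The partial derivative as a linear map. -/
def pderivₗ (a : Fin 3) : SmoothTorus →ₗ[ℝ] SmoothTorus where
  toFun := pderiv a
  map_add' f g := ext_coeff fun k => by simp only [map_add, coeff_pderiv, mul_add]
  map_smul' c f := ext_coeff fun k => by
    simp only [map_smul, coeff_pderiv, RingHom.id_apply, Complex.real_smul]
    ring

@[simp] theorem pderivₗ_apply (a : Fin 3) (f : SmoothTorus) : pderivₗ a f = pderiv a f := rfl

theorem coeff_zero_im (f : SmoothTorus) : (coeff 0 f).im = 0 := by
  have h := coeff_neg 0 f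
  rw [neg_zero] at h
  exact Complex.conj_eq_iff_im.1 h.symm

/-- The mean value of a function on the torus. -/
def mean : SmoothTorus →ₗ[ℝ] ℝ := Complex.reLm.comp (coeff 0)

theorem coeff_zero_eq_mean (f : SmoothTorus) : coeff 0 f = (mean f : ℂ) :=
  Complex.ext rfl (coeff_zero_im f)

theorem mean_pderiv (a : Fin 3) (f : SmoothTorus) : mean (pderiv a f) = 0 := by
  have h := coeff_pderiv a f 0
  simp only [Pi.zero_apply, Int.cast_zero, mul_zero, zero_mul] at h
  change (coeff 0 (pderiv a f)).re = 0
  rw [h, Complex.zero_re]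

theorem mean_one : mean 1 = 1 := by
  change (coeff 0 1).re = 1
  rw [coeff_one]
  simp

theorem abs_mean_le (w : Weight) (f : SmoothTorus) : ‖mean f‖ ≤ 1 * wnorm w f := by
  rw [one_mul]
  exact (Complex.abs_re_le_norm _).trans (norm_coeff_le_wnorm w f 0)

/-- The Fourier multiplier of the operator `∂ₐ Δ⁻¹`. -/
def symbol (a : Fin 3) (k : Fin 3 → ℤ) : ℂ := -(Complex.I * k a) / (∑ b, (k b : ℂ) ^ 2)

theorem sum_sq_eq (k : Fin 3 → ℤ) : (∑ b, (k b : ℂ) ^ 2) = ((∑ b, (k b : ℝ) ^ 2 : ℝ) : ℂ) := by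
  push_cast
  rfl

theorem norm_sq_le_sum_sq (k : Fin 3 → ℤ) : ‖k‖ ^ 2 ≤ ∑ b, (k b : ℝ) ^ 2 := by
  obtain ⟨a, ha⟩ : ∃ a, ‖k‖ = ‖k a‖ := by
    obtain ⟨a, -, ha⟩ := Finset.exists_max_image Finset.univ (fun a => ‖k a‖) Finset.univ_nonempty
    refine ⟨a, le_antisymm ?_ (norm_le_pi_norm k a)⟩
    exact (pi_norm_le_iff_of_nonneg (norm_nonneg _)).2 fun b => ha b (Finset.mem_univ b)
  rw [ha, Int.norm_eq_abs, sq_abs]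
  exact Finset.single_le_sum (f := fun b => (k b : ℝ) ^ 2) (fun b _ => sq_nonneg _)
    (Finset.mem_univ a)

/-- The symbol has size at most `|k_a| / |k|²`, so it gains one derivative. At `k = 0` it is `0 /
0`, which is `0`. -/
theorem norm_symbol_le (a : Fin 3) (k : Fin 3 → ℤ) : (1 + ‖k‖) * ‖symbol a k‖ ≤ 2 := by
  by_cases hk : k = 0
  · simp [symbol, hk]
  have h1 : 1 ≤ ‖k‖ := by
    obtain ⟨b, hb⟩ := Function.ne_iff.1 hk
    refine le_trans ?_ (norm_le_pi_norm k b)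
    rw [Int.norm_eq_abs]
    exact_mod_cast Int.one_le_abs hb
  have h2 := norm_sq_le_sum_sq k
  have h3 : ‖(k a : ℂ)‖ ≤ ‖k‖ := by
    rw [Complex.norm_intCast, ← Int.norm_eq_abs]
    exact norm_le_pi_norm k a
  have h4 : 0 < ∑ b, (k b : ℝ) ^ 2 := lt_of_lt_of_le (by positivity) h2
  rw [symbol, norm_div, norm_neg, norm_mul, Complex.norm_I, one_mul, sum_sq_eq, Complex.norm_real,
    Real.norm_of_nonneg h4.le, mul_div_assoc', div_le_iff₀ h4]
  calc (1 + ‖k‖) * ‖(k a : ℂ)‖ ≤ (‖k‖ + ‖k‖) * ‖k‖ := by gcongr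
    _ = 2 * ‖k‖ ^ 2 := by ring
    _ ≤ _ := by gcongr

theorem norm_symbol_le_two (a : Fin 3) (k : Fin 3 → ℤ) : ‖symbol a k‖ ≤ 2 :=
  le_trans (le_mul_of_one_le_left (norm_nonneg _) (by linarith [norm_nonneg k])) (norm_symbol_le a k)

theorem exists_coeff_eq_symbol_mul (a : Fin 3) (f : SmoothTorus) :
    ∃ g : SmoothTorus, ∀ k, coeff k g = symbol a k * coeff k f := by
  refine exists_coeff_eq _ (fun n => ?_) fun k => ?_
  · refine Summable.of_nonneg_of_le (fun k => by positivity) (fun k => ?_)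
      ((summable_coeff n f).mul_left 2)
    rw [norm_mul]
    have := norm_symbol_le_two a k
    calc _ ≤ (1 + ‖k‖) ^ n * (2 * ‖coeff k f‖) := by gcongr
      _ = _ := by ring
  · rw [map_mul, ← coeff_neg]
    congr 1
    simp [symbol, neg_div]

/-- The operator `∂ₐ Δ⁻¹`, which vanishes on constants. -/
def invLap (a : Fin 3) : SmoothTorus →ₗ[ℝ] SmoothTorus where
  toFun f := (exists_coeff_eq_symbol_mul a f).choose
  map_add' f g := ext_coeff fun k => by
    rw [map_add, (exists_coeff_eq_symbol_mul a _).choose_spec,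
      (exists_coeff_eq_symbol_mul a _).choose_spec, (exists_coeff_eq_symbol_mul a _).choose_spec,
      map_add, mul_add]
  map_smul' c f := ext_coeff fun k => by
    rw [RingHom.id_apply, map_smul, (exists_coeff_eq_symbol_mul a _).choose_spec,
      (exists_coeff_eq_symbol_mul a _).choose_spec, map_smul, Complex.real_smul, Complex.real_smul]
    ring

theorem coeff_invLap (a : Fin 3) (f : SmoothTorus) (k : Fin 3 → ℤ) :
    coeff k (invLap a f) = symbol a k * coeff k f := (exists_coeff_eq_symbol_mul a f).choose_spec k

/-- Off `k = 0` the symbols multiply to `∑ k_a² / |k|² = 1`. Only the zero frequency is lost, and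
this loss is the origin of the three obstructions. -/
theorem sum_pderiv_invLap (f : SmoothTorus) :
    ∑ a, pderiv a (invLap a f) = f - mean f • (1 : SmoothTorus) := by
  refine ext_coeff fun k => ?_
  simp only [map_sum, map_sub, map_smul, coeff_pderiv, coeff_invLap, coeff_one]
  by_cases hk : k = 0
  · subst hk
    simp [coeff_zero_eq_mean]
  have h4 : (∑ b, (k b : ℂ) ^ 2) ≠ 0 := by
    rw [sum_sq_eq, Complex.ofReal_ne_zero]
    refine (lt_of_lt_of_le ?_ (norm_sq_le_sum_sq k)).ne'
    have := norm_pos_iff.2 hk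
    positivity
  have h5 : ∀ a, Complex.I * k a * (symbol a k * coeff k f)
      = (k a : ℂ) ^ 2 * (coeff k f / ∑ b, (k b : ℂ) ^ 2) := by
    intro a
    rw [symbol]
    linear_combination (-(k a : ℂ) ^ 2 * (coeff k f / ∑ b, (k b : ℂ) ^ 2)) * Complex.I_sq
  rw [Finset.sum_congr rfl fun a _ => h5 a, ← Finset.sum_mul, mul_div_cancel₀ _ h4]
  simp [hk]

theorem invLap_one (a : Fin 3) : invLap a 1 = 0 := by
  refine ext_coeff fun k => ?_
  rw [coeff_invLap, coeff_one, map_zero]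
  by_cases hk : k = 0
  · simp [hk, symbol]
  · simp [hk]

theorem wnorm_low_le (s m : ℕ) (f : SmoothTorus) :
    wnorm (Weight.low s m) f ≤ 1 * wnorm (Weight.high s m) f := by
  refine wnorm_le_of_coeff_le fun k => ?_
  rw [one_mul, Weight.high_val]
  have := (Weight.low s m).pos k
  gcongr
  exact le_mul_of_one_le_left this.le (by linarith [norm_nonneg k])

theorem wnorm_pderiv_le (a : Fin 3) (s m : ℕ) (f : SmoothTorus) :
    wnorm (Weight.low s m) (pderiv a f) ≤ 1 * wnorm (Weight.high s m) f := by
  refine wnorm_le_of_coeff_le fun k => ?_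
  have h1 := (Weight.low s m).pos k
  have h2 : ‖(k a : ℂ)‖ ≤ ‖k‖ := by
    rw [Complex.norm_intCast, ← Int.norm_eq_abs]
    exact norm_le_pi_norm k a
  rw [one_mul, Weight.high_val, coeff_pderiv, norm_mul, norm_mul, Complex.norm_I, one_mul]
  calc _ ≤ (Weight.low s m).val k * ((1 + ‖k‖) * ‖coeff k f‖) := by
        gcongr
        linarith
    _ = _ := by ring

/-- The high weight is the low one times `1 + ‖k‖`, exactly the factor that the symbol compensates.
The constant depends on neither `s` nor `m`. -/
theorem wnorm_invLap_le (a : Fin 3) (s m : ℕ) (f : SmoothTorus) :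
    wnorm (Weight.high s m) (invLap a f) ≤ 2 * wnorm (Weight.low s m) f := by
  refine wnorm_le_of_coeff_le fun k => ?_
  have h1 := (Weight.low s m).pos k
  rw [Weight.high_val, coeff_invLap, norm_mul]
  calc _ = (Weight.low s m).val k * (((1 + ‖k‖) * ‖symbol a k‖) * ‖coeff k f‖) := by ring
    _ ≤ (Weight.low s m).val k * (2 * ‖coeff k f‖) := by
        gcongr
        exact norm_symbol_le a k
    _ = _ := by ring

theorem wnorm_high_zero_le (s m : ℕ) (f : SmoothTorus) :
    wnorm (Weight.high 0 0) f ≤ wnorm (Weight.high s m) f := by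
  rw [← one_mul (wnorm (Weight.high s m) f)]
  refine wnorm_le_of_coeff_le fun k => ?_
  rw [one_mul, Weight.high_val, Weight.high_val]
  have h1 := (Weight.low s m).one_le k
  have h2 : (Weight.low 0 0).val k = 1 := pow_zero _
  rw [h2]
  gcongr

/-- Dominated convergence, with the weight at `m = 0` as majorant. This lets smallness in the base
norm propagate to every order of smoothness at the price of a large `m`. -/
theorem tendsto_wnorm_high (s : ℕ) (f : SmoothTorus) :
    Tendsto (fun m => wnorm (Weight.high s m) f) atTop (𝓝 (wnorm (Weight.high 0 0) f)) := by
  refine tendsto_tsum_of_dominated_convergence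
    (bound := fun k => (Weight.high s 0).val k * ‖coeff k f‖) (summable_weight _ f) (fun k => ?_)
    (.of_forall fun m k => ?_)
  · refine Tendsto.mul_const _ ?_
    simp only [Weight.high_val, Weight.low_val, pow_zero]
    refine Tendsto.const_mul _ ?_
    have h1 : Tendsto (fun m : ℕ => ‖k‖ / ((m : ℝ) + 1)) atTop (𝓝 0) :=
      tendsto_const_nhds.div_atTop (tendsto_atTop_add_const_right _ _ tendsto_natCast_atTop_atTop)
    simpa using (h1.const_add 1).pow s
  · rw [Real.norm_of_nonneg (mul_nonneg ((Weight.high s m).pos k).le (norm_nonneg _))]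
    simp only [Weight.high_val, Weight.low_val]
    gcongr
    simp

theorem exists_wnorm_le (w : Weight) : ∃ (C : ℝ) (n : ℕ), 0 ≤ C ∧ ∀ f,
    wnorm w f ≤ C * (seminorm 0 f + seminorm n f) := by
  obtain ⟨n, hn⟩ := w.growth
  refine ⟨decayConst n, n + 6, ?_, fun f => le_trans ?_ (tsum_coeff_le n f)⟩
  · exact mul_nonneg (by positivity) (tsum_nonneg fun k => by positivity)
  · refine (summable_weight w f).tsum_le_tsum (fun k => ?_) (summable_coeff n f)
    gcongr
    exact hn k

theorem continuous_of_bound {Y : Type*} [SeminormedAddCommGroup Y] [NormedSpace ℝ Y]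
    (T : SmoothTorus →ₗ[ℝ] Y) (w : Weight) (C : ℝ) (hC : 0 ≤ C)
    (h : ∀ f, ‖T f‖ ≤ C * wnorm w f) : Continuous T := by
  obtain ⟨C', n, hC', hw⟩ := exists_wnorm_le w
  refine withSeminorms.continuous_normedSpace_rng Y T
    ⟨{0, n}, ⟨2 * (C * C'), by positivity⟩, fun f => ?_⟩
  have h1 : ∀ i ∈ ({0, n} : Finset ℕ), seminorm i f ≤ ({0, n} : Finset ℕ).sup seminorm f :=
    fun i hi => Seminorm.le_finset_sup_apply hi
  have h2 := h1 0 (by simp)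
  have h3 := h1 n (by simp)
  change ‖T f‖ ≤ 2 * (C * C') * (({0, n} : Finset ℕ).sup seminorm f)
  calc ‖T f‖ ≤ C * (C' * (seminorm 0 f + seminorm n f)) :=
        (h f).trans (mul_le_mul_of_nonneg_left (hw f) hC)
    _ ≤ C * (C' * (({0, n} : Finset ℕ).sup seminorm f + ({0, n} : Finset ℕ).sup seminorm f)) := by
        gcongr
    _ = _ := by ring

theorem continuous_emb (w : Weight) : Continuous (Hat.emb w) :=
  continuous_of_bound (Hat.emb w).toLinearMap w 1 zero_le_one fun f => by
    rw [one_mul]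
    exact (Hat.norm_emb w f).le

theorem seminorm_le_wnorm (s m : ℕ) (f : SmoothTorus) :
    seminorm s f ≤ (3 ^ s * (m + 1) ^ s) * wnorm (Weight.high s m) f := by
  refine (seminorm_le_tsum s f).trans ?_
  rw [mul_assoc, wnorm, ← tsum_mul_left (a := ((m : ℝ) + 1) ^ s)]
  refine mul_le_mul_of_nonneg_left ?_ (by positivity)
  refine (summable_coeff s f).tsum_le_tsum (fun k => ?_) ((summable_weight _ f).mul_left _)
  rw [← mul_assoc]
  gcongr
  exact Weight.pow_le_high s m k

/-- The freedom in `m` matters: the value needed at order `s` depends on the point around which the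
equation is solved. -/
theorem tendsto_iff_emb {ι : Type*} {l : Filter ι} (m : ℕ → ℕ) (u : ι → SmoothTorus)
    (f : SmoothTorus) : Tendsto u l (𝓝 f) ↔
      ∀ s, Tendsto (fun i => Hat.emb (Weight.high s (m s)) (u i)) l
        (𝓝 (Hat.emb (Weight.high s (m s)) f)) := by
  refine ⟨fun h s => ((continuous_emb _).tendsto f).comp h, fun h => ?_⟩
  rw [withSeminorms.tendsto_nhds]
  intro s ε hε
  have h1 := (tendsto_iff_norm_sub_tendsto_zero.1 (h s)).const_mul
    (((3 : ℝ) ^ s * ((m s : ℝ) + 1) ^ s))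
  rw [mul_zero] at h1
  filter_upwards [h1.eventually_lt_const hε] with i hi
  refine lt_of_le_of_lt (seminorm_le_wnorm s (m s) _) ?_
  rwa [← Hat.norm_emb, map_sub]

/-- Completeness in the form needed for the iteration. The limit is formed coefficient by
coefficient, and `exists_coeff_eq` synthesizes it to a smooth function. -/
theorem exists_tendsto_of_cauchySeq (m : ℕ → ℕ) (u : ℕ → SmoothTorus)
    (h : ∀ s, CauchySeq fun i => Hat.emb (Weight.high s (m s)) (u i)) :
    ∃ f, Tendsto u atTop (𝓝 f) := by
  have hc : ∀ s, ∀ ε > 0, ∃ N, ∀ i ≥ N, ∀ j ≥ N, wnorm (Weight.high s (m s)) (u i - u j) < ε := by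
    intro s ε hε
    obtain ⟨N, hN⟩ := Metric.cauchySeq_iff.1 (h s) ε hε
    refine ⟨N, fun i hi j hj => ?_⟩
    have := hN i hi j hj
    rwa [dist_eq_norm, ← map_sub, Hat.norm_emb] at this
  have hk : ∀ k, ∃ c, Tendsto (fun i => coeff k (u i)) atTop (𝓝 c) := by
    intro k
    refine cauchySeq_tendsto_of_complete (Metric.cauchySeq_iff.2 fun ε hε => ?_)
    obtain ⟨N, hN⟩ := hc 0 ε hε
    refine ⟨N, fun i hi j hj => ?_⟩
    rw [dist_eq_norm, ← map_sub]
    exact (norm_coeff_le_wnorm _ _ k).trans_lt (hN i hi j hj)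
  choose c hlim using hk
  -- The limit is taken in finite partial sums, where the Cauchy bound survives without any
  -- knowledge of the summability of the limit coefficients.
  have hbound : ∀ s, ∀ ε > 0, ∃ N, ∀ j ≥ N, ∀ F : Finset (Fin 3 → ℤ),
      ∑ k ∈ F, (Weight.high s (m s)).val k * ‖c k - coeff k (u j)‖ ≤ ε := by
    intro s ε hε
    obtain ⟨N, hN⟩ := hc s ε hε
    refine ⟨N, fun j hj F => ?_⟩
    have h1 : Tendsto (fun i => ∑ k ∈ F, (Weight.high s (m s)).val k * ‖coeff k (u i) - coeff k (u j)‖)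
        atTop (𝓝 (∑ k ∈ F, (Weight.high s (m s)).val k * ‖c k - coeff k (u j)‖)) :=
      tendsto_finsetSum _ fun k _ => (((hlim k).sub_const _).norm).const_mul _
    refine le_of_tendsto h1 ?_
    filter_upwards [eventually_ge_atTop N] with i hi
    refine le_trans ?_ (hN i hi j hj).le
    simp only [← map_sub]
    exact (summable_weight _ _).sum_le_tsum F
      fun k _ => mul_nonneg ((Weight.high s (m s)).pos k).le (norm_nonneg _)
  have hdiff : ∀ s, ∃ j, Summable fun k => (Weight.high s (m s)).val k * ‖c k - coeff k (u j)‖ := by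
    intro s
    obtain ⟨N, hN⟩ := hbound s 1 one_pos
    exact ⟨N, summable_of_sum_le
      (fun k => mul_nonneg ((Weight.high s (m s)).pos k).le (norm_nonneg _)) (hN N le_rfl)⟩
  obtain ⟨f, hf⟩ := exists_coeff_eq c (fun n => by
    obtain ⟨j, hj⟩ := hdiff n
    have h1 : Summable fun k => (Weight.high n (m n)).val k * ‖c k‖ := by
      refine Summable.of_nonneg_of_le
        (fun k => mul_nonneg ((Weight.high n (m n)).pos k).le (norm_nonneg _)) (fun k => ?_)
        (hj.add (summable_weight (Weight.high n (m n)) (u j)))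
      rw [← mul_add]
      refine mul_le_mul_of_nonneg_left ?_ ((Weight.high n (m n)).pos k).le
      calc ‖c k‖ = ‖(c k - coeff k (u j)) + coeff k (u j)‖ := by rw [sub_add_cancel]
        _ ≤ _ := norm_add_le _ _
    refine Summable.of_nonneg_of_le (fun k => by positivity) (fun k => ?_)
      (h1.mul_left (((m n : ℝ) + 1) ^ n))
    rw [← mul_assoc]
    gcongr
    exact Weight.pow_le_high n (m n) k) fun k => by
    refine tendsto_nhds_unique (hlim (-k)) ?_
    simp only [coeff_neg]
    exact (Complex.continuous_conj.tendsto _).comp (hlim k)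
  refine ⟨f, (tendsto_iff_emb m u f).2 fun s => ?_⟩
  rw [tendsto_iff_norm_sub_tendsto_zero, Metric.tendsto_atTop]
  intro ε hε
  obtain ⟨N, hN⟩ := hbound s (ε / 2) (half_pos hε)
  refine ⟨N, fun j hj => ?_⟩
  rw [Real.dist_eq, sub_zero, abs_norm, ← map_sub, Hat.norm_emb]
  refine lt_of_le_of_lt ?_ (half_lt_self hε)
  refine (summable_weight _ _).tsum_le_of_sum_le fun F => ?_
  refine le_trans (le_of_eq ?_) (hN j hj F)
  refine Finset.sum_congr rfl fun k _ => ?_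
  rw [map_sub, hf, norm_sub_rev]

end SmoothTorus

instance : T2Space SmoothTorus := by
  have : T1Space SmoothTorus := SmoothTorus.withSeminorms.T1_of_separating fun f hf => by
    by_contra! h
    refine hf (SmoothTorus.ext_coeff fun k => ?_)
    have h1 := SmoothTorus.norm_coeff_le k f
    rw [h 0] at h1
    rw [map_zero, norm_le_zero_iff.1 h1]
  infer_instance

end TorusConstraints

end

/-! ### Smooth maps between Fréchet spaces from compatible maps between Banach spaces -/

noncomputable section

namespace TorusConstraints

open Filter

section Calculus

/-- `HasSmoothDerivs` appends the newest direction at the end, `iteratedFDeriv` peels it off at the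
front. The reversal `Fin.rev` mediates between the two conventions. -/
theorem comp_snoc_rev {E X : Type*} (L : E → X) {k : ℕ} (h : Fin k → E) (v : E) :
    (fun m : Fin (k + 1) => L (Fin.snoc (α := fun _ => E) h v m.rev)) =
      Fin.cons (L v) fun m => L (h m.rev) := by
  ext m
  refine Fin.cases ?_ (fun m => ?_) m
  · simp
  · simp [Fin.rev_succ]

variable {E F G : Type*} [AddCommGroup E] [Module ℝ E] [TopologicalSpace E]
  [AddCommGroup F] [Module ℝ F] [TopologicalSpace F]
  [AddCommGroup G] [Module ℝ G] [TopologicalSpace G]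

theorem clm_snoc (L : G →L[ℝ] E) {k : ℕ} (h : Fin k → G) (v : G) :
    (fun m => L (Fin.snoc (α := fun _ => G) h v m)) =
      Fin.snoc (α := fun _ => E) (fun m => L (h m)) (L v) := by
  ext m
  refine Fin.lastCases ?_ (fun m => ?_) m
  · simp
  · simp

theorem HasSmoothDerivs.clm_comp {f : E → F} {D : (k : ℕ) → E → (Fin k → E) → F} {Ω : Set E}
    (hf : HasSmoothDerivs f D Ω) (T : F →L[ℝ] G) :
    HasSmoothDerivs (fun x => T (f x)) (fun k x h => T (D k x h)) Ω where
  zero x hx h := by rw [hf.zero x hx h]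
  succ k x hx h v := by
    have := (T.continuous.tendsto _).comp (hf.succ k x hx h v)
    refine this.congr fun t => ?_
    simp
  cont k := T.continuous.comp_continuousOn (hf.cont k)

theorem HasSmoothDerivs.comp_clm {f : E → F} {D : (k : ℕ) → E → (Fin k → E) → F} {Ω : Set E}
    (hf : HasSmoothDerivs f D Ω) (L : G →L[ℝ] E) :
    HasSmoothDerivs (fun x => f (L x)) (fun k x h => D k (L x) fun m => L (h m)) (L ⁻¹' Ω) where
  zero x hx h := hf.zero _ hx _
  succ k x hx h v := by
    have := hf.succ k (L x) hx (fun m => L (h m)) (L v)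
    rw [HasDirDerivAt] at this ⊢
    rw [clm_snoc]
    refine this.congr fun t => ?_
    simp
  cont k := by
    refine (hf.cont k).comp (f := fun q : G × (Fin k → G) => (L q.1, fun m => L (q.2 m))) ?_ ?_
    · refine Continuous.continuousOn ?_
      have := L.continuous
      fun_prop
    · intro q hq
      exact ⟨hq.1, Set.mem_univ _⟩

/-- The directional derivative of an iterated derivative. -/
theorem tendsto_iteratedFDeriv_slope {X Y : Type*} [NormedAddCommGroup X] [NormedSpace ℝ X]
    [NormedAddCommGroup Y] [NormedSpace ℝ Y] {g : X → Y} {x : X} (hg : ContDiffAt ℝ ∞ g x)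
    (k : ℕ) (w : Fin k → X) (v : X) :
    Tendsto (fun t : ℝ => t⁻¹ • (iteratedFDeriv ℝ k g (x + t • v) w - iteratedFDeriv ℝ k g x w))
      (𝓝[≠] 0) (𝓝 (iteratedFDeriv ℝ (k + 1) g x (Fin.cons v w))) := by
  have h1 : DifferentiableAt ℝ (iteratedFDeriv ℝ k g) x :=
    hg.differentiableAt_iteratedFDeriv (by exact_mod_cast ENat.natCast_lt_top k)
  have h2 : HasDerivAt (fun t : ℝ => x + t • v) v 0 := by
    simpa using ((hasDerivAt_id (0 : ℝ)).smul_const v).const_add x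
  have h3 : HasFDerivAt (iteratedFDeriv ℝ k g) (fderiv ℝ (iteratedFDeriv ℝ k g) x)
      (x + (0 : ℝ) • v) := by simpa using h1.hasFDerivAt
  have h4 := h3.comp_hasDerivAt (0 : ℝ) h2
  have h5 := (ContinuousMultilinearMap.apply ℝ (fun _ : Fin k => X) Y w).hasFDerivAt.comp_hasDerivAt
    (0 : ℝ) h4
  have h6 := h5.tendsto_slope_zero
  rw [iteratedFDeriv_succ_apply_left]
  simpa using h6

/-- A map between topological vector spaces that is compatible with smooth maps between normed
spaces, which determine the topology and the completeness of the target, is smooth. -/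
theorem exists_hasSmoothDerivs_of_models [IsTopologicalAddGroup E] [ContinuousSMul ℝ E]
    [T2Space F]
    {ι : Type*} {X Y : ι → Type*}
    [∀ a, NormedAddCommGroup (X a)] [∀ a, NormedSpace ℝ (X a)]
    [∀ a, NormedAddCommGroup (Y a)] [∀ a, NormedSpace ℝ (Y a)] (i : ∀ a, E →L[ℝ] X a)
    (j : ∀ a, F →L[ℝ] Y a) (g : ∀ a, X a → Y a) (O : ι → Set E) (Ω : Set E) (f : E → F)
    (hO : ∀ a, IsOpen (O a)) (hΩ : IsOpen Ω)
    (hg : ∀ a, ∀ x ∈ O a, ContDiffAt ℝ ∞ (g a) (i a x))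
    (hfg : ∀ a, ∀ x ∈ O a, j a (f x) = g a (i a x))
    (hind : ∀ x ∈ Ω, ∀ y, (⨅ (a) (_ : x ∈ O a), comap (j a) (𝓝 (j a y))) ≤ 𝓝 y)
    (hcomp : ∀ x ∈ Ω, ∀ u : ℕ → F, (∀ a, x ∈ O a → CauchySeq fun n => j a (u n)) →
      ∃ y, Tendsto u atTop (𝓝 y)) :
    ∃ D, HasSmoothDerivs f D Ω ∧ ∀ a, ∀ x ∈ Ω, x ∈ O a → ∀ k h,
      j a (D k x h) = iteratedFDeriv ℝ k (g a) (i a x) fun m => i a (h m.rev) := by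
  classical
  have htend : ∀ x ∈ Ω, ∀ (l : Filter F) (y : F),
      (∀ a, x ∈ O a → Tendsto (j a) l (𝓝 (j a y))) → l ≤ 𝓝 y := by
    intro x hx l y h
    refine le_trans ?_ (hind x hx y)
    simp only [le_iInf_iff]
    exact fun a ha => tendsto_iff_comap.1 (h a ha)
  have hline : ∀ (x v : E) (s : Set E), IsOpen s → x ∈ s → ∀ᶠ t in 𝓝 (0 : ℝ), x + t • v ∈ s := by
    intro x v s hs hx
    have : Continuous fun t : ℝ => x + t • v := by fun_prop
    refine this.continuousAt.eventually_mem (hs.mem_nhds ?_)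
    simpa using hx
  -- A candidate derivative must have the prescribed image in every model that is valid near `x`.
  -- Existence of such a vector is proved by induction on `k`.
  set P : (k : ℕ) → E → (Fin k → E) → F → Prop := fun k x h d =>
    ∀ a, x ∈ O a → j a d = iteratedFDeriv ℝ k (g a) (i a x) fun m => i a (h m.rev) with hP
  let D : (k : ℕ) → E → (Fin k → E) → F := fun k x h =>
    if hd : ∃ d, P k x h d then hd.choose else 0
  have hslope : ∀ k, (∀ x ∈ Ω, ∀ h, P k x h (D k x h)) → ∀ x ∈ Ω, ∀ (h : Fin k → E) (v : E),
      ∀ a, x ∈ O a → Tendsto (fun t : ℝ => j a (t⁻¹ • (D k (x + t • v) h - D k x h))) (𝓝[≠] 0)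
        (𝓝 (iteratedFDeriv ℝ (k + 1) (g a) (i a x)
          fun m => i a (Fin.snoc (α := fun _ => E) h v m.rev))) := by
    intro k hk x hx h v a ha
    rw [comp_snoc_rev]
    refine (tendsto_iteratedFDeriv_slope (hg a x ha) k (fun m => i a (h m.rev)) (i a v)).congr' ?_
    filter_upwards [nhdsWithin_le_nhds (hline x v Ω hΩ hx),
      nhdsWithin_le_nhds (hline x v (O a) (hO a) ha)] with t ht1 ht2
    rw [map_smul, map_sub, hk _ ht1 h a ht2, hk x hx h a ha, map_add, map_smul]
  have hD : ∀ k, ∀ x ∈ Ω, ∀ h, P k x h (D k x h) := by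
    intro k
    induction k with
    | zero =>
      intro x hx h
      have hex : ∃ d, P 0 x h d := ⟨f x, fun a ha => by
        rw [iteratedFDeriv_zero_apply, hfg a x ha]⟩
      simp only [D, dif_pos hex]
      exact hex.choose_spec
    | succ k ih =>
      intro x hx h
      -- The next derivative is obtained in `F` as the limit of difference quotients along `1 / (n +
      -- 1)`. They converge in every valid model, hence are Cauchy there, and `hcomp` supplies the
      -- limit.
      have hseq : Tendsto (fun n : ℕ => ((n : ℝ) + 1)⁻¹) atTop (𝓝[≠] 0) := by
        refine tendsto_nhdsWithin_iff.2 ⟨?_, .of_forall fun n => ?_⟩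
        · simpa using tendsto_one_div_add_atTop_nhds_zero_nat (𝕜 := ℝ)
        · exact inv_ne_zero (Nat.cast_add_one_ne_zero n)
      have hlim := fun a ha => (hslope k ih x hx (Fin.init h) (h (Fin.last k)) a ha).comp hseq
      obtain ⟨d, hd⟩ := hcomp x hx _ fun a ha => (hlim a ha).cauchySeq
      have hex : ∃ d, P (k + 1) x h d := ⟨d, fun a ha => by
        refine tendsto_nhds_unique (((j a).continuous.tendsto d).comp hd) ?_
        have h1 := hlim a ha
        rw [Fin.snoc_init_self] at h1
        exact h1⟩
      simp only [D, dif_pos hex]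
      exact hex.choose_spec
  refine ⟨D, ⟨fun x hx h => ?_, fun k x hx h v => ?_, fun k => ?_⟩, fun a x hx ha k h =>
    hD k x hx h a ha⟩
  -- Both points have the same images in all valid models, so the Hausdorff property of `F`
  -- identifies them.
  · have h1 : pure (f x) ≤ 𝓝 (D 0 x h) := htend x hx _ _ fun a ha => by
      have h1 := hD 0 x hx h a ha
      rw [iteratedFDeriv_zero_apply, ← hfg a x ha] at h1
      rw [h1]
      exact tendsto_pure_nhds _ _
    exact (pure_le_nhds_iff.1 h1).symm
  · refine htend x hx _ _ fun a ha => tendsto_map'_iff.2 ?_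
    · rw [hD (k + 1) x hx _ a ha]
      exact hslope k (hD k) x hx h v a ha
  · rintro ⟨x, h⟩ ⟨hx, -⟩
    refine htend x hx _ _ fun a ha => tendsto_map'_iff.2 ?_
    rw [hD k x hx h a ha]
    have h1 : ContinuousAt (fun q : E × (Fin k → E) =>
        iteratedFDeriv ℝ k (g a) (i a q.1) fun m => i a (q.2 m.rev)) (x, h) := by
      have h2 : ContinuousAt (iteratedFDeriv ℝ k (g a)) (i a x) :=
        ((hg a x ha).differentiableAt_iteratedFDeriv
          (by exact_mod_cast ENat.natCast_lt_top k)).continuousAt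
      have h3 : ContinuousAt (fun q : E × (Fin k → E) => iteratedFDeriv ℝ k (g a) (i a q.1))
          (x, h) :=
        ContinuousAt.comp (f := fun q : E × (Fin k → E) => i a q.1) h2
          ((i a).continuous.comp continuous_fst).continuousAt
      have h4 : ContinuousAt (fun q : E × (Fin k → E) => fun m : Fin k => i a (q.2 m.rev))
          (x, h) := by
        have := (i a).continuous
        exact Continuous.continuousAt (by fun_prop)
      exact (ContinuousEval.continuous_eval.tendsto _).comp (h3.prodMk h4)
    refine (h1.tendsto.mono_left nhdsWithin_le_nhds).congr' ?_
    have h5 : ∀ᶠ q in 𝓝[Ω ×ˢ Set.univ] (x, h), q.1 ∈ Ω :=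
      eventually_nhdsWithin_of_forall fun q hq => hq.1
    have h6 : ∀ᶠ q : E × (Fin k → E) in 𝓝[Ω ×ˢ Set.univ] (x, h), q.1 ∈ O a :=
      nhdsWithin_le_nhds (continuous_fst.continuousAt.eventually_mem ((hO a).mem_nhds ha))
    filter_upwards [h5, h6] with q hq1 hq2
    exact (hD k q.1 hq1 q.2 a hq2).symm

end Calculus

/-! ### Inverting perturbations of the identity on a scale of Banach spaces -/

section Banach

variable {X : Type*} [NormedAddCommGroup X] [NormedSpace ℝ X] {Ψ : X → X} {ε : ℝ}

/-- A smooth map whose derivative has norm at most `1/2` on the ball of radius `ε`. -/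
structure IsHalfContraction (Ψ : X → X) (ε : ℝ) : Prop where
  pos : 0 < ε
  contDiff : ContDiff ℝ ∞ Ψ
  map_zero : Ψ 0 = 0
  norm_fderiv_le : ∀ z, ‖z‖ < ε → ‖fderiv ℝ Ψ z‖ ≤ 1 / 2

namespace IsHalfContraction

theorem norm_sub_le (h : IsHalfContraction Ψ ε) {y z : X} (hy : ‖y‖ < ε) (hz : ‖z‖ < ε) :
    ‖Ψ y - Ψ z‖ ≤ 1 / 2 * ‖y - z‖ :=
  (convex_ball (0 : X) ε).norm_image_sub_le_of_norm_fderiv_le (𝕜 := ℝ)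
    (fun x _ => h.contDiff.differentiable (by simp) x)
    (fun x hx => h.norm_fderiv_le x (by simpa using hx)) (by simpa using hz) (by simpa using hy)

theorem norm_le (h : IsHalfContraction Ψ ε) {z : X} (hz : ‖z‖ < ε) : ‖Ψ z‖ ≤ 1 / 2 * ‖z‖ := by
  have h1 := h.norm_sub_le hz (z := 0) (by simpa using h.pos)
  simpa [h.map_zero] using h1

theorem injOn (h : IsHalfContraction Ψ ε) : Set.InjOn (fun z => z - Ψ z) (Metric.ball 0 ε) := by
  intro y hy z hz hyz
  have h1 := h.norm_sub_le (y := y) (z := z) (by simpa using hy) (by simpa using hz)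
  have h2 : y - z = Ψ y - Ψ z := by
    have h3 : y - Ψ y = z - Ψ z := hyz
    rw [sub_eq_sub_iff_add_eq_add] at h3 ⊢
    rw [h3]
    abel
  rw [← h2] at h1
  have h4 : ‖y - z‖ = 0 := by linarith [norm_nonneg (y - z)]
  exact sub_eq_zero.1 (norm_eq_zero.1 h4)

/-- The inverse of `z ↦ z - Ψ z` on the ball of radius `ε`. -/
def inv (Ψ : X → X) (ε : ℝ) : X → X :=
  Function.invFunOn (fun z => z - Ψ z) (Metric.ball 0 ε)

theorem inv_apply (h : IsHalfContraction Ψ ε) {z : X} (hz : ‖z‖ < ε) :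
    inv Ψ ε (z - Ψ z) = z :=
  h.injOn.leftInvOn_invFunOn (by simpa using hz)

/-- The derivative `1 - Ψ'(z)` is invertible by the Neumann series, so the inverse function theorem
applies. Injectivity on the ball identifies its local inverse with the one global choice `inv`. -/
theorem exists_localInverse [CompleteSpace X] (h : IsHalfContraction Ψ ε) {z : X} (hz : ‖z‖ < ε) :
    ContDiffAt ℝ ∞ (inv Ψ ε) (z - Ψ z) := by
  have hlt : ‖fderiv ℝ Ψ z‖ < 1 := (h.norm_fderiv_le z hz).trans_lt (by norm_num)
  let A : X ≃L[ℝ] X := ContinuousLinearEquiv.ofUnit (Units.oneSub (fderiv ℝ Ψ z) hlt)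
  have hA : HasFDerivAt (fun z => z - Ψ z) (A : X →L[ℝ] X) z :=
    (hasFDerivAt_id z).sub (h.contDiff.differentiable (by simp) z).hasFDerivAt
  have hc : ContDiffAt ℝ ∞ (fun z => z - Ψ z) z :=
    contDiffAt_id.sub h.contDiff.contDiffAt
  have hinv := hc.to_localInverse hA (by simp)
  refine hinv.congr_of_eventuallyEq ?_
  have h1 := (hc.hasStrictFDerivAt' hA (by simp)).eventually_right_inverse
  have h2 : ∀ᶠ y in 𝓝 (z - Ψ z), hc.localInverse hA (by simp) y ∈ Metric.ball (0 : X) ε := by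
    refine hinv.continuousAt.eventually_mem (Metric.isOpen_ball.mem_nhds ?_)
    rw [hc.localInverse_apply_image hA (by simp)]
    simpa using hz
  filter_upwards [h1, h2] with y hy1 hy2
  have h3 := h.inv_apply (z := hc.localInverse hA (by simp) y) (by simpa using hy2)
  rw [← h3]
  congr 1
  exact hy1.symm

/-- The chain rule for `inv ∘ (1 - Ψ) = id` near `0`, where `1 - Ψ` has derivative `1`. -/
theorem hasFDerivAt_inv_zero [CompleteSpace X] (h : IsHalfContraction Ψ ε)
    (h0 : fderiv ℝ Ψ 0 = 0) : HasFDerivAt (inv Ψ ε) (ContinuousLinearMap.id ℝ X) 0 := by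
  have hz : ‖(0 : X)‖ < ε := by simpa using h.pos
  have hc := h.exists_localInverse hz
  rw [h.map_zero, sub_zero] at hc
  have hd : HasFDerivAt (inv Ψ ε) (fderiv ℝ (inv Ψ ε) 0) (0 - Ψ 0) := by
    rw [h.map_zero, sub_zero]
    exact (hc.differentiableAt (by simp)).hasFDerivAt
  have hA : HasFDerivAt (fun z => z - Ψ z) (ContinuousLinearMap.id ℝ X - fderiv ℝ Ψ 0) 0 :=
    (hasFDerivAt_id 0).sub (h.contDiff.differentiable (by simp) 0).hasFDerivAt
  rw [h0, sub_zero] at hA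
  have h1 := hd.comp (0 : X) hA
  rw [ContinuousLinearMap.comp_id] at h1
  have h2 : (inv Ψ ε ∘ fun z => z - Ψ z) =ᶠ[𝓝 0] id := by
    filter_upwards [Metric.ball_mem_nhds (0 : X) h.pos] with z hz
    exact h.inv_apply (by simpa using hz)
  have h3 := (h1.congr_of_eventuallyEq h2.symm).unique (hasFDerivAt_id 0)
  rw [h3] at hd
  rw [h.map_zero, sub_zero] at hd
  exact hd

/-- The geometric series with ratio `1/2` gives the factor `2`. The hypothesis `‖c‖ < ε / 2`
therefore keeps all iterates in the ball where `Ψ` contracts. -/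
theorem norm_iterate_le (h : IsHalfContraction Ψ ε) {c : X} (hc : ‖c‖ < ε / 2) {y : ℕ → X}
    (h0 : y 0 = 0) (hs : ∀ n, y (n + 1) = c + Ψ (y n)) (n : ℕ) : ‖y n‖ ≤ 2 * ‖c‖ := by
  induction n with
  | zero => simp [h0]
  | succ n ih =>
    rw [hs]
    have h1 := h.norm_le (z := y n) (by linarith)
    linarith [norm_add_le c (Ψ (y n))]

theorem cauchySeq_iterate (h : IsHalfContraction Ψ ε) {c : X} (hc : ‖c‖ < ε / 2) {y : ℕ → X}
    (h0 : y 0 = 0) (hs : ∀ n, y (n + 1) = c + Ψ (y n)) : CauchySeq y := by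
  have hb := h.norm_iterate_le hc h0 hs
  refine cauchySeq_of_le_geometric (1 / 2) ‖c‖ (by norm_num) fun n => ?_
  induction n with
  | zero => rw [hs 0, h0, h.map_zero]; simp
  | succ n ih =>
    rw [dist_eq_norm] at ih ⊢
    rw [hs (n + 1)]
    nth_rewrite 1 [hs n]
    rw [add_sub_add_left_eq_sub]
    refine (h.norm_sub_le (by linarith [hb n]) (by linarith [hb (n + 1)])).trans ?_
    rw [pow_succ]
    linarith

end IsHalfContraction

end Banach

/-! ### The fixed-point equation on the whole scale of norms -/

section Scale

variable {E : Type*} [AddCommGroup E] [Module ℝ E] [TopologicalSpace E]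
  {ι : Type*} {X : ι → Type*}
  [∀ a, NormedAddCommGroup (X a)] [∀ a, NormedSpace ℝ (X a)]

/-- Compatible contractions on a scale of Banach spaces around a topological vector space `E`. The
topology of `E` is determined, and its completeness follows, from those norms for which a given
vector of small base norm is small. -/
structure ContractionScale (i : ∀ a, E →L[ℝ] X a) (base : ι) (ψ : E → E) (Ψ : ∀ a, X a → X a)
    (ε : ℝ) : Prop where
  contraction : ∀ a, IsHalfContraction (Ψ a) ε
  comm : ∀ a z, i a (ψ z) = Ψ a (i a z)
  injective : Function.Injective (i base)
  base_le : ∀ a z, ‖i base z‖ ≤ ‖i a z‖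
  inducing : ∀ u, ‖i base u‖ < ε / 2 → ∀ y,
    (⨅ (a) (_ : ‖i a u‖ < ε / 2), comap (i a) (𝓝 (i a y))) ≤ 𝓝 y
  complete : ∀ u, ‖i base u‖ < ε / 2 → ∀ s : ℕ → E,
    (∀ a, ‖i a u‖ < ε / 2 → CauchySeq fun n => i a (s n)) → ∃ y, Tendsto s atTop (𝓝 y)

namespace ContractionScale

variable {i : ∀ a, E →L[ℝ] X a} {base : ι} {ψ : E → E} {Ψ : ∀ a, X a → X a} {ε : ℝ}

/-- Picard iteration takes place in `E` itself and is Cauchy in every norm in which `u` is small, so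
it converges in `E`. The equation for the limit is checked in the base space alone, by injectivity.
-/
theorem exists_solution (h : ContractionScale i base ψ Ψ ε) (u : E) (hu : ‖i base u‖ < ε / 2) :
    ∃ z, z = u + ψ z ∧ ∀ a, ‖i a u‖ < ε / 2 → ‖i a z‖ ≤ 2 * ‖i a u‖ := by
  let s : ℕ → E := fun n => Nat.rec 0 (fun _ z => u + ψ z) n
  have hs : ∀ a n, i a (s (n + 1)) = i a u + Ψ a (i a (s n)) := fun a n => by
    rw [← h.comm, ← map_add]
  have h0 : ∀ a, i a (s 0) = 0 := fun a => map_zero _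
  obtain ⟨z, hz⟩ := h.complete u hu s fun a ha =>
    (h.contraction a).cauchySeq_iterate (y := fun n => i a (s n)) ha (h0 a) (hs a)
  have hlim : ∀ a, Tendsto (fun n => i a (s n)) atTop (𝓝 (i a z)) := fun a =>
    ((i a).continuous.tendsto z).comp hz
  refine ⟨z, h.injective ?_, fun a ha => ?_⟩
  · rw [map_add, h.comm]
    refine tendsto_nhds_unique ((tendsto_add_atTop_iff_nat 1).2 (hlim base)) ?_
    simp only [hs]
    exact (((h.contraction base).contDiff.continuous.tendsto _).comp (hlim base)).const_add _
  · exact le_of_tendsto (hlim a).norm (.of_forall fun n =>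
      (h.contraction a).norm_iterate_le (y := fun n => i a (s n)) ha (h0 a) (hs a) n)

open Classical in
/-- The solution `z` of `z = u + ψ z`. -/
def sol (h : ContractionScale i base ψ Ψ ε) (u : E) : E :=
  if hu : ‖i base u‖ < ε / 2 then (h.exists_solution u hu).choose else 0

variable (h : ContractionScale i base ψ Ψ ε)

include h in
theorem eq_of_norm_lt {y z u : E} (hy : ‖i base y‖ < ε) (hz : ‖i base z‖ < ε) (hyu : y = u + ψ y)
    (hzu : z = u + ψ z) : y = z := by
  refine h.injective ((h.contraction base).injOn (by simpa using hy) (by simpa using hz) ?_)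
  simp only [← h.comm, ← map_sub]
  congr 1
  rw [← sub_eq_iff_eq_add] at hyu hzu
  rw [hyu, hzu]

theorem sol_eq {u : E} (hu : ‖i base u‖ < ε / 2) : h.sol u = u + ψ (h.sol u) := by
  simp only [sol, dif_pos hu]
  exact (h.exists_solution u hu).choose_spec.1

theorem norm_sol_le {u : E} {a : ι} (hu : ‖i a u‖ < ε / 2) : ‖i a (h.sol u)‖ ≤ 2 * ‖i a u‖ := by
  have hu' : ‖i base u‖ < ε / 2 := (h.base_le a u).trans_lt hu
  simp only [sol, dif_pos hu']
  exact (h.exists_solution u hu').choose_spec.2 a hu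

theorem norm_sol_lt {u : E} {a : ι} (hu : ‖i a u‖ < ε / 2) : ‖i a (h.sol u)‖ < ε := by
  linarith [h.norm_sol_le hu]

theorem sol_eq_of_eq {u z : E} (hu : ‖i base u‖ < ε / 2) (hz : ‖i base z‖ < ε)
    (hzu : z = u + ψ z) : z = h.sol u :=
  h.eq_of_norm_lt hz (h.norm_sol_lt hu) hzu (h.sol_eq hu)

/-- The solution in `E` is seen by each valid Banach space as its own inverse map, which is smooth.
This is the compatibility required by `exists_hasSmoothDerivs_of_models`. -/
theorem emb_sol {u : E} {a : ι} (hu : ‖i a u‖ < ε / 2) :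
    i a (h.sol u) = IsHalfContraction.inv (Ψ a) ε (i a u) := by
  have hu' : ‖i base u‖ < ε / 2 := (h.base_le a u).trans_lt hu
  have h1 := (h.contraction a).inv_apply (h.norm_sol_lt hu)
  rw [← h.comm, ← map_sub] at h1
  nth_rewrite 1 [h.sol_eq hu'] at h1
  rw [add_sub_cancel_right] at h1
  exact h1.symm

include h in
theorem contDiffAt_inv [∀ a, CompleteSpace (X a)] {u : E} {a : ι} (hu : ‖i a u‖ < ε / 2) :
    ContDiffAt ℝ ∞ (IsHalfContraction.inv (Ψ a) ε) (i a u) := by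
  have hu' : ‖i base u‖ < ε / 2 := (h.base_le a u).trans_lt hu
  have h1 := (h.contraction a).exists_localInverse (h.norm_sol_lt hu)
  rw [← h.comm, ← map_sub] at h1
  nth_rewrite 1 [h.sol_eq hu'] at h1
  rwa [add_sub_cancel_right] at h1

theorem isSmoothOn_sol [∀ a, CompleteSpace (X a)] [T2Space E] [IsTopologicalAddGroup E] [ContinuousSMul ℝ E] :
    IsSmoothOn h.sol {u | ‖i base u‖ < ε / 2} := by
  have hopen : ∀ a, IsOpen {u | ‖i a u‖ < ε / 2} := fun a =>
    isOpen_lt (i a).continuous.norm continuous_const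
  obtain ⟨D, hD, -⟩ := exists_hasSmoothDerivs_of_models i i
    (fun a => IsHalfContraction.inv (Ψ a) ε) (fun a => {u | ‖i a u‖ < ε / 2})
    {u | ‖i base u‖ < ε / 2} h.sol hopen (hopen base) (fun a u hu => h.contDiffAt_inv hu)
    (fun a u hu => h.emb_sol hu) h.inducing h.complete
  exact ⟨D, hD⟩

/-- A finite-dimensional quantity of the solution is smooth, with derivatives computed in the base
Banach space. -/
theorem exists_hasSmoothDerivs_comp_sol [∀ a, CompleteSpace (X a)] [IsTopologicalAddGroup E]
    [ContinuousSMul ℝ E]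
    {Y : Type*} [NormedAddCommGroup Y] [NormedSpace ℝ Y] [CompleteSpace Y] (q : E → Y)
    (Q : X base → Y) (hQ : ContDiff ℝ ∞ Q) (hq : ∀ z, q z = Q (i base z)) :
    ∃ D, HasSmoothDerivs (fun u => q (h.sol u)) D {u | ‖i base u‖ < ε / 2} ∧
      ∀ x, ‖i base x‖ < ε / 2 → ∀ k v, D k x v =
        iteratedFDeriv ℝ k (Q ∘ IsHalfContraction.inv (Ψ base) ε) (i base x)
          fun m => i base (v m.rev) := by
  have hopen : IsOpen {u | ‖i base u‖ < ε / 2} := isOpen_lt (i base).continuous.norm continuous_const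
  obtain ⟨D, hD, hD2⟩ := exists_hasSmoothDerivs_of_models (ι := Unit) (fun _ => i base)
    (fun _ => ContinuousLinearMap.id ℝ Y) (fun _ => Q ∘ IsHalfContraction.inv (Ψ base) ε)
    (fun _ => {u | ‖i base u‖ < ε / 2}) {u | ‖i base u‖ < ε / 2} (fun u => q (h.sol u))
    (fun _ => hopen) hopen (fun _ u hu => hQ.contDiffAt.comp _ (h.contDiffAt_inv hu))
    (fun _ u hu => by
      simp only [ContinuousLinearMap.id_apply, Function.comp_apply]
      rw [hq, h.emb_sol hu])
    (fun u hu y => by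
      simp only [iInf_const]
      rw [iInf_pos hu]
      exact le_of_eq comap_id)
    (fun u hu s hs => cauchySeq_tendsto_of_complete (hs () hu))
  exact ⟨D, hD, fun x hx k v => hD2 () x hx hx k v⟩

end ContractionScale

end Scale

end TorusConstraints

end

/-! ### Families of maps with uniform bounds on the unit ball -/

noncomputable section

namespace TorusConstraints

theorem norm_smul_clm_le {X Y : Type*} [NormedAddCommGroup X] [NormedSpace ℝ X]
    [NormedCommRing Y] [NormedAlgebra ℝ Y] (c : Y) (T : X →L[ℝ] Y) : ‖c • T‖ ≤ ‖c‖ * ‖T‖ := by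
  refine ContinuousLinearMap.opNorm_le_bound _ (by positivity) fun x => ?_
  rw [smul_apply, smul_eq_mul, mul_assoc]
  refine (norm_mul_le _ _).trans ?_
  gcongr
  exact T.le_opNorm x

section Bounded

variable {X Y Z : Type*} [NormedAddCommGroup X] [NormedSpace ℝ X]
  [NormedAddCommGroup Y] [NormedSpace ℝ Y] [NormedAddCommGroup Z] [NormedSpace ℝ Z]

/-- A smooth map that is bounded by `C` in `C^{1,1}` on the unit ball. -/
structure BoundedOnBall (C : ℝ) (f : X → Y) : Prop where
  contDiff : ContDiff ℝ ∞ f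
  norm_le : ∀ z, ‖z‖ < 1 → ‖f z‖ ≤ C
  norm_fderiv_le : ∀ z, ‖z‖ < 1 → ‖fderiv ℝ f z‖ ≤ C
  norm_fderiv_sub_le : ∀ y z, ‖y‖ < 1 → ‖z‖ < 1 → ‖fderiv ℝ f y - fderiv ℝ f z‖ ≤ C * ‖y - z‖

namespace BoundedOnBall

variable {C C' : ℝ} {f g : X → Y}

theorem differentiableAt (hf : BoundedOnBall C f) (z : X) : DifferentiableAt ℝ f z :=
  hf.contDiff.differentiable (by simp) z

theorem nonneg (hf : BoundedOnBall C f) : 0 ≤ C :=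
  (norm_nonneg _).trans (hf.norm_le 0 (by simp))

theorem norm_sub_le (hf : BoundedOnBall C f) {y z : X} (hy : ‖y‖ < 1) (hz : ‖z‖ < 1) :
    ‖f y - f z‖ ≤ C * ‖y - z‖ :=
  (convex_ball (0 : X) 1).norm_image_sub_le_of_norm_fderiv_le (𝕜 := ℝ)
    (fun x _ => hf.differentiableAt x)
    (fun x hx => hf.norm_fderiv_le x (by simpa using hx)) (by simpa using hz) (by simpa using hy)

theorem const {c : Y} (h : ‖c‖ ≤ C) : BoundedOnBall C fun _ : X => c where
  contDiff := contDiff_const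
  norm_le _ _ := h
  norm_fderiv_le z _ := by simpa using (norm_nonneg c).trans h
  norm_fderiv_sub_le y z _ _ := by
    have := (norm_nonneg c).trans h
    simp only [fderiv_fun_const, Pi.zero_apply, sub_self, norm_zero]
    positivity

theorem clm {T : X →L[ℝ] Y} (h : ‖T‖ ≤ C) : BoundedOnBall C T where
  contDiff := T.contDiff
  norm_le z hz := by
    have h1 := T.le_opNorm z
    have h2 : ‖T‖ * ‖z‖ ≤ ‖T‖ := mul_le_of_le_one_right (norm_nonneg _) hz.le
    linarith
  norm_fderiv_le z _ := by simpa using h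
  norm_fderiv_sub_le y z _ _ := by
    have := (norm_nonneg T).trans h
    simp only [ContinuousLinearMap.fderiv, sub_self, norm_zero]
    positivity

theorem add (hf : BoundedOnBall C f) (hg : BoundedOnBall C' g) :
    BoundedOnBall (C + C') fun z => f z + g z where
  contDiff := hf.contDiff.add hg.contDiff
  norm_le z hz := (norm_add_le _ _).trans (add_le_add (hf.norm_le z hz) (hg.norm_le z hz))
  norm_fderiv_le z hz := by
    rw [fderiv_fun_add (hf.differentiableAt z) (hg.differentiableAt z)]
    exact (norm_add_le _ _).trans (add_le_add (hf.norm_fderiv_le z hz) (hg.norm_fderiv_le z hz))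
  norm_fderiv_sub_le y z hy hz := by
    rw [fderiv_fun_add (hf.differentiableAt z) (hg.differentiableAt z),
      fderiv_fun_add (hf.differentiableAt y) (hg.differentiableAt y), add_sub_add_comm, add_mul]
    exact (norm_add_le _ _).trans
      (add_le_add (hf.norm_fderiv_sub_le y z hy hz) (hg.norm_fderiv_sub_le y z hy hz))

theorem fderiv_clm_comp (hf : BoundedOnBall C f) (T : Y →L[ℝ] Z) (z : X) :
    fderiv ℝ (fun z => T (f z)) z = T.comp (fderiv ℝ f z) :=
  (T.hasFDerivAt.comp z (hf.differentiableAt z).hasFDerivAt).fderiv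

theorem clm_comp (hf : BoundedOnBall C f) {T : Y →L[ℝ] Z} (h : ‖T‖ ≤ C') :
    BoundedOnBall (C' * C) fun z => T (f z) where
  contDiff := T.contDiff.comp hf.contDiff
  norm_le z hz := by
    have := hf.nonneg
    calc ‖T (f z)‖ ≤ ‖T‖ * ‖f z‖ := T.le_opNorm _
      _ ≤ C' * C := by
        gcongr
        · exact (norm_nonneg T).trans h
        · exact hf.norm_le z hz
  norm_fderiv_le z hz := by
    rw [hf.fderiv_clm_comp]
    calc _ ≤ ‖T‖ * ‖fderiv ℝ f z‖ := T.opNorm_comp_le _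
      _ ≤ C' * C := by
        gcongr
        · exact (norm_nonneg T).trans h
        · exact hf.norm_fderiv_le z hz
  norm_fderiv_sub_le y z hy hz := by
    rw [hf.fderiv_clm_comp, hf.fderiv_clm_comp, ← ContinuousLinearMap.comp_sub]
    calc _ ≤ ‖T‖ * ‖fderiv ℝ f y - fderiv ℝ f z‖ := T.opNorm_comp_le _
      _ ≤ C' * (C * ‖y - z‖) := by
        gcongr
        · exact (norm_nonneg T).trans h
        · exact hf.norm_fderiv_sub_le y z hy hz
      _ = _ := by ring

/-- The constant `4` comes from the increment of the derivative: the product rule splits it into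
four terms, each at most `C C' ‖y - z‖`. -/
theorem mul {Y : Type*} [NormedCommRing Y] [NormedAlgebra ℝ Y] {f g : X → Y}
    (hf : BoundedOnBall C f) (hg : BoundedOnBall C' g) :
    BoundedOnBall (4 * (C * C')) fun z => f z * g z where
  contDiff := hf.contDiff.mul hg.contDiff
  norm_le z hz := by
    have h1 := hf.nonneg
    have h2 := hg.nonneg
    have h3 : ‖f z * g z‖ ≤ C * C' := by
      refine (norm_mul_le _ _).trans ?_
      gcongr
      · exact hf.norm_le z hz
      · exact hg.norm_le z hz
    nlinarith [mul_nonneg h1 h2]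
  norm_fderiv_le z hz := by
    have h1 := hf.nonneg
    have h2 := hg.nonneg
    rw [fderiv_fun_mul (hf.differentiableAt z) (hg.differentiableAt z)]
    calc _ ≤ ‖f z‖ * ‖fderiv ℝ g z‖ + ‖g z‖ * ‖fderiv ℝ f z‖ :=
          (norm_add_le _ _).trans (add_le_add (norm_smul_clm_le _ _) (norm_smul_clm_le _ _))
      _ ≤ C * C' + C' * C := by
          gcongr
          · exact hf.norm_le z hz
          · exact hg.norm_fderiv_le z hz
          · exact hg.norm_le z hz
          · exact hf.norm_fderiv_le z hz
      _ ≤ _ := by nlinarith [mul_nonneg h1 h2]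
  norm_fderiv_sub_le y z hy hz := by
    have h1 := hf.nonneg
    have h2 := hg.nonneg
    rw [fderiv_fun_mul (hf.differentiableAt z) (hg.differentiableAt z),
      fderiv_fun_mul (hf.differentiableAt y) (hg.differentiableAt y)]
    have h3 : f y • fderiv ℝ g y + g y • fderiv ℝ f y
        - (f z • fderiv ℝ g z + g z • fderiv ℝ f z)
        = ((f y - f z) • fderiv ℝ g y + f z • (fderiv ℝ g y - fderiv ℝ g z))
        + ((g y - g z) • fderiv ℝ f y + g z • (fderiv ℝ f y - fderiv ℝ f z)) := by
      module
    rw [h3]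
    have h4 : ‖(f y - f z) • fderiv ℝ g y‖ ≤ (C * ‖y - z‖) * C' :=
      (norm_smul_clm_le _ _).trans (mul_le_mul (hf.norm_sub_le hy hz) (hg.norm_fderiv_le y hy)
        (norm_nonneg _) (by positivity))
    have h5 : ‖f z • (fderiv ℝ g y - fderiv ℝ g z)‖ ≤ C * (C' * ‖y - z‖) :=
      (norm_smul_clm_le _ _).trans (mul_le_mul (hf.norm_le z hz) (hg.norm_fderiv_sub_le y z hy hz)
        (norm_nonneg _) h1)
    have h6 : ‖(g y - g z) • fderiv ℝ f y‖ ≤ (C' * ‖y - z‖) * C :=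
      (norm_smul_clm_le _ _).trans (mul_le_mul (hg.norm_sub_le hy hz) (hf.norm_fderiv_le y hy)
        (norm_nonneg _) (by positivity))
    have h7 : ‖g z • (fderiv ℝ f y - fderiv ℝ f z)‖ ≤ C' * (C * ‖y - z‖) :=
      (norm_smul_clm_le _ _).trans (mul_le_mul (hg.norm_le z hz) (hf.norm_fderiv_sub_le y z hy hz)
        (norm_nonneg _) h2)
    calc _ ≤ _ := (norm_add_le _ _).trans (add_le_add (norm_add_le _ _) (norm_add_le _ _))
      _ ≤ (C * ‖y - z‖) * C' + C * (C' * ‖y - z‖) + ((C' * ‖y - z‖) * C + C' * (C * ‖y - z‖)) :=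
          add_le_add (add_le_add h4 h5) (add_le_add h6 h7)
      _ = _ := by ring

end BoundedOnBall

end Bounded

/-- A family of maps that are bounded in `C^{1,1}` on the unit balls, uniformly in the family. -/
def UniformlyBounded {ι : Type*} {X Y : ι → Type*} [∀ a, NormedAddCommGroup (X a)]
    [∀ a, NormedSpace ℝ (X a)] [∀ a, NormedAddCommGroup (Y a)] [∀ a, NormedSpace ℝ (Y a)]
    (f : ∀ a, X a → Y a) : Prop := ∃ C, ∀ a, BoundedOnBall C (f a)

namespace UniformlyBounded

variable {ι : Type*} {X Y Z : ι → Type*} [∀ a, NormedAddCommGroup (X a)]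
  [∀ a, NormedSpace ℝ (X a)] [∀ a, NormedAddCommGroup (Y a)] [∀ a, NormedSpace ℝ (Y a)]
  [∀ a, NormedAddCommGroup (Z a)] [∀ a, NormedSpace ℝ (Z a)]
  {f g : ∀ a, X a → Y a}

theorem contDiff (hf : UniformlyBounded f) (a : ι) : ContDiff ℝ ∞ (f a) :=
  hf.choose_spec a |>.contDiff

theorem clm (T : ∀ a, X a →L[ℝ] Y a) {C : ℝ} (h : ∀ a, ‖T a‖ ≤ C) :
    UniformlyBounded fun a z => T a z := ⟨C, fun a => .clm (h a)⟩

theorem const (c : ∀ a, Y a) {C : ℝ} (h : ∀ a, ‖c a‖ ≤ C) :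
    UniformlyBounded fun a (_ : X a) => c a := ⟨C, fun a => .const (h a)⟩

theorem add (hf : UniformlyBounded f) (hg : UniformlyBounded g) :
    UniformlyBounded fun a z => f a z + g a z := by
  obtain ⟨C, hC⟩ := hf
  obtain ⟨C', hC'⟩ := hg
  exact ⟨C + C', fun a => (hC a).add (hC' a)⟩

theorem clm_comp (hf : UniformlyBounded f) (T : ∀ a, Y a →L[ℝ] Z a) {C : ℝ} (h : ∀ a, ‖T a‖ ≤ C) :
    UniformlyBounded fun a z => T a (f a z) := by
  obtain ⟨C', hC'⟩ := hf
  exact ⟨C * C', fun a => (hC' a).clm_comp (h a)⟩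

theorem smul (hf : UniformlyBounded f) (c : ℝ) : UniformlyBounded fun a z => c • f a z := by
  refine hf.clm_comp (fun a => c • ContinuousLinearMap.id ℝ (Y a)) (C := |c|) fun a => ?_
  rw [norm_smul, Real.norm_eq_abs]
  exact mul_le_of_le_one_right (abs_nonneg c) ContinuousLinearMap.norm_id_le

theorem neg (hf : UniformlyBounded f) : UniformlyBounded fun a z => -f a z := by
  simpa using hf.smul (-1)

theorem sub (hf : UniformlyBounded f) (hg : UniformlyBounded g) :
    UniformlyBounded fun a z => f a z - g a z := by
  simpa [sub_eq_add_neg] using hf.add hg.neg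

theorem sum {κ : Type*} (s : Finset κ) {f : κ → ∀ a, X a → Y a}
    (hf : ∀ k, UniformlyBounded (f k)) : UniformlyBounded fun a z => ∑ k ∈ s, f k a z := by
  classical
  induction s using Finset.induction_on with
  | empty => exact ⟨0, fun a => by simpa using BoundedOnBall.const (c := (0 : Y a)) (by simp)⟩
  | insert k s hk ih =>
    simp only [Finset.sum_insert hk]
    exact (hf k).add ih

theorem mul {Y : ι → Type*} [∀ a, NormedCommRing (Y a)] [∀ a, NormedAlgebra ℝ (Y a)]
    {f g : ∀ a, X a → Y a} (hf : UniformlyBounded f) (hg : UniformlyBounded g) :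
    UniformlyBounded fun a z => f a z * g a z := by
  obtain ⟨C, hC⟩ := hf
  obtain ⟨C', hC'⟩ := hg
  exact ⟨_, fun a => (hC a).mul (hC' a)⟩

/-- A uniformly bounded family without constant and linear part consists of contractions on a
common ball. -/
theorem exists_isHalfContraction {f : ∀ a, X a → X a} (hf : UniformlyBounded f)
    (h0 : ∀ a, f a 0 = 0) (h1 : ∀ a, fderiv ℝ (f a) 0 = 0) :
    ∃ ε > 0, ∀ ε', 0 < ε' → ε' ≤ ε → ∀ a, IsHalfContraction (f a) ε' := by
  obtain ⟨C, hC⟩ := hf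
  -- The derivative vanishes at `0` and is `C`-Lipschitz on the unit ball, so on a smaller ball it
  -- is at most `C` times the radius. The shape `|C| + 1` keeps the denominator positive.
  refine ⟨min 1 (1 / (2 * (|C| + 1))), by positivity, fun ε' hε' hle a => ⟨hε', (hC a).contDiff, h0 a,
    fun z hz => ?_⟩⟩
  have hz1 : ‖z‖ < 1 := hz.trans_le (hle.trans (min_le_left _ _))
  have hz2 : ‖z‖ ≤ 1 / (2 * (|C| + 1)) := hz.le.trans (hle.trans (min_le_right _ _))
  have h2 := (hC a).norm_fderiv_sub_le z 0 hz1 (by simp)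
  rw [h1, sub_zero, sub_zero] at h2
  calc _ ≤ C * ‖z‖ := h2
    _ ≤ (|C| + 1) * (1 / (2 * (|C| + 1))) := by
        gcongr
        linarith [le_abs_self C]
    _ = 1 / 2 := by field_simp

end UniformlyBounded

/-- If one factor vanishes at the base point, the product rule sees only the value of the other
factor. Every summand of the rescaled `B_i` is of this kind, as derivatives of the background are
zero. -/
theorem hasFDerivAt_mul_of_eq_zero {X Y : Type*} [NormedAddCommGroup X] [NormedSpace ℝ X]
    [NormedCommRing Y] [NormedAlgebra ℝ Y] {f g : X → Y} {c : ℝ} {g' : X →L[ℝ] Y}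
    (hf : DifferentiableAt ℝ f 0) (hf0 : f 0 = algebraMap ℝ Y c) (hg : HasFDerivAt g g' 0)
    (hg0 : g 0 = 0) : HasFDerivAt (fun z => f z * g z) (c • g') 0 := by
  have h : c • g' = f 0 • g' + g 0 • fderiv ℝ f 0 := by
    ext z
    simp [hf0, hg0, Algebra.smul_def]
  rw [h]
  exact hf.hasFDerivAt.mul hg

end TorusConstraints

end

/-! ### The constraints as polynomials in the components and their derivatives -/

noncomputable section

namespace TorusConstraints

open SmoothTorus

/-- The index set of the fifteen component functions of a tuple. -/
abbrev Slot : Type := (Fin 3 × Fin 3) ⊕ Fin 3 ⊕ Fin 3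

namespace Slot

/-- The slot of the component `D_i^a`. -/
abbrev frame (i a : Fin 3) : Slot := .inl (i, a)

/-- The slot of the component `p_i`. -/
abbrev mom (i : Fin 3) : Slot := .inr (.inl i)

/-- The slot of the component `p₀`. -/
abbrev mom₀ : Slot := .inr (.inr 0)

/-- The slot of the component `ζ`. -/
abbrev zeta : Slot := .inr (.inr 1)

/-- The slot of the component `χ`. -/
abbrev chi : Slot := .inr (.inr 2)

end Slot

open Slot

/-- The component functions of a tuple. -/
def comp : Slot → Tuple →ₗ[ℝ] SmoothTorus
  | .inl (i, a) => { toFun := fun x => x.1 i a, map_add' := fun _ _ => rfl, map_smul' := fun _ _ => rfl }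
  | .inr (.inl i) => { toFun := fun x => x.2.1 i, map_add' := fun _ _ => rfl,
                       map_smul' := fun _ _ => rfl }
  | .inr (.inr 0) => { toFun := fun x => x.2.2.1, map_add' := fun _ _ => rfl,
                       map_smul' := fun _ _ => rfl }
  | .inr (.inr 1) => { toFun := fun x => x.2.2.2.1, map_add' := fun _ _ => rfl,
                       map_smul' := fun _ _ => rfl }
  | .inr (.inr 2) => { toFun := fun x => x.2.2.2.2, map_add' := fun _ _ => rfl,
                       map_smul' := fun _ _ => rfl }

/-- The tuple with given component functions. -/
def assemble : (Slot → SmoothTorus) →ₗ[ℝ] Tuple where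
  toFun c := (fun i a => c (frame i a), fun i => c (mom i), c mom₀, c zeta, c chi)
  map_add' _ _ := rfl
  map_smul' _ _ := rfl

theorem comp_assemble (n : Slot) (c : Slot → SmoothTorus) : comp n (assemble c) = c n := by
  rcases n with ⟨i, a⟩ | i | m
  · rfl
  · rfl
  · fin_cases m <;> rfl

theorem tuple_ext {x y : Tuple} (h : ∀ n, comp n x = comp n y) : x = y := by
  refine Prod.ext ?_ (Prod.ext ?_ (Prod.ext ?_ (Prod.ext ?_ ?_)))
  · funext i a
    exact h (frame i a)
  · funext i
    exact h (mom i)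
  · exact h mom₀
  · exact h zeta
  · exact h chi

theorem continuous_comp (n : Slot) : Continuous (comp n) := by
  rcases n with ⟨i, a⟩ | i | m
  · change Continuous fun x : Tuple => x.1 i a
    fun_prop
  · change Continuous fun x : Tuple => x.2.1 i
    fun_prop
  · fin_cases m
    · change Continuous fun x : Tuple => x.2.2.1
      fun_prop
    · change Continuous fun x : Tuple => x.2.2.2.1
      fun_prop
    · change Continuous fun x : Tuple => x.2.2.2.2
      fun_prop

theorem continuous_assemble : Continuous assemble := by
  change Continuous fun c : Slot → SmoothTorus =>
    (((fun i a => c (frame i a)), (fun i => c (mom i)), c mom₀, c zeta, c chi) : Tuple)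
  fun_prop

section Polynomials

variable {A : Type*} [CommRing A] [Algebra ℝ A] (v : Slot → A) (dv : Fin 3 → Slot → A)

/-- The cofactors of the frame matrix. -/
def cofactor (b j : Fin 3) : A :=
  v (frame (j + 1) (b + 1)) * v (frame (j + 2) (b + 2))
    - v (frame (j + 1) (b + 2)) * v (frame (j + 2) (b + 1))

/-- The determinant of the frame matrix. -/
def frameDet : A := ∑ a, v (frame 0 a) * cofactor v a 0

/-- The commutator of two vectors of the frame. -/
def comm (i j b : Fin 3) : A :=
  ∑ a, (v (frame i a) * dv a (frame j b) - v (frame j a) * dv a (frame i b))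

/-- The structure functions, multiplied by the determinant. -/
def scaledStructure (i j k : Fin 3) : A := ∑ b, cofactor v b k * comm v dv i j b

/-- The derivative of a component in the direction of a vector of the frame. -/
def frameDeriv (i : Fin 3) (n : Slot) : A := ∑ a, v (frame i a) * dv a n

/-- The constraint `A` as a polynomial. -/
def polyA : A :=
  (3 : ℝ) • (v mom₀ * v mom₀) - v (mom 1) * v (mom 2) - v (mom 2) * v (mom 0)
    - v (mom 0) * v (mom 1)

/-- The constraint `B_i`, multiplied by the determinant of the frame, as a polynomial. -/
def polyB (i : Fin 3) : A :=
  (-(1 / 2 : ℝ)) • (frameDet v * (frameDeriv v dv i (mom (i + 1)) + frameDeriv v dv i (mom (i + 2))))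
    - (1 / 2 : ℝ) • ((v (mom i) - v (mom (i + 1))) * scaledStructure v dv i (i + 1) (i + 1))
    + (1 / 2 : ℝ) • ((v (mom i) - v (mom (i + 2))) * scaledStructure v dv (i + 2) i (i + 2))
    + (frameDet v * v (mom i)) * frameDeriv v dv i zeta
    + (3 : ℝ) • ((frameDet v * v mom₀) * frameDeriv v dv i chi)

variable {A' : Type*} [CommRing A'] [Algebra ℝ A'] (F : A →ₐ[ℝ] A')

theorem map_polyA : F (polyA v) = polyA fun n => F (v n) := by
  simp [polyA]

theorem map_polyB (i : Fin 3) : F (polyB v dv i) = polyB (fun n => F (v n)) (fun a n => F (dv a n)) i := by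
  simp [polyB, frameDet, frameDeriv, scaledStructure, comm, cofactor]

end Polynomials

/-! ### The linearized constraints -/

section Linear

variable {M : Type*} [AddCommGroup M] [Module ℝ M] (p : Fin 3 → ℝ) (p₀ : ℝ)

/-- The linearization of the constraint `A`. -/
def linA (v : Slot → M) : M :=
  (6 * p₀) • v mom₀ - ∑ i, (p (i + 1) + p (i + 2)) • v (mom i)

/-- The linearization of the constraint `B_i`, as a function of the derivatives. -/
def linB (i : Fin 3) (dv : Fin 3 → Slot → M) : M :=
  (-(1 / 2 : ℝ)) • (dv i (mom (i + 1)) + dv i (mom (i + 2)))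
    - (1 / 2 : ℝ) • ((p i - p (i + 1)) • (dv i (frame (i + 1) (i + 1)) - dv (i + 1) (frame i (i + 1))))
    + (1 / 2 : ℝ) • ((p i - p (i + 2)) • (dv (i + 2) (frame i (i + 2)) - dv i (frame (i + 2) (i + 2))))
    + p i • dv i zeta + (3 : ℝ) • (p₀ • dv i chi)

variable {M' : Type*} [AddCommGroup M'] [Module ℝ M'] (T : M →ₗ[ℝ] M')

theorem map_linA (v : Slot → M) : T (linA p p₀ v) = linA p p₀ fun n => T (v n) := by
  simp [linA]

theorem map_linB (i : Fin 3) (dv : Fin 3 → Slot → M) :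
    T (linB p p₀ i dv) = linB p p₀ i fun a n => T (dv a n) := by
  simp [linB]

end Linear

/-! ### Comparison with the constraint map -/

theorem frameDet_comp (x : Tuple) : frameDet (fun n => comp n x) = (Matrix.of x.1).det := by
  rw [Matrix.det_fin_three]
  simp only [frameDet, cofactor, Fin.sum_univ_three, Matrix.of_apply]
  change x.1 0 0 * (x.1 1 1 * x.1 2 2 - x.1 1 2 * x.1 2 1)
    + x.1 0 1 * (x.1 1 2 * x.1 2 0 - x.1 1 0 * x.1 2 2)
    + x.1 0 2 * (x.1 1 0 * x.1 2 1 - x.1 1 1 * x.1 2 0) = _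
  ring

/-- The cyclic indices `b + 1`, `b + 2` modulo `3` absorb the checkerboard signs of the adjugate. -/
theorem cofactor_comp (x : Tuple) (b j : Fin 3) :
    cofactor (fun n => comp n x) b j = (Matrix.of x.1).adjugate b j := by
  rw [Matrix.adjugate_fin_three]
  change x.1 (j + 1) (b + 1) * x.1 (j + 2) (b + 2) - x.1 (j + 1) (b + 2) * x.1 (j + 2) (b + 1) = _
  fin_cases b <;> fin_cases j <;> simp <;> ring

theorem scaledStructure_comp {x : Tuple} (hx : IsFrame x.1) (i j k : Fin 3) :
    scaledStructure (fun n => comp n x) (fun a n => pderiv a (comp n x)) i j k =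
      (Matrix.of x.1).det * structureFn x.1 i j k := by
  rw [scaledStructure, structureFn, Finset.mul_sum]
  refine Finset.sum_congr rfl fun b _ => ?_
  rw [Matrix.inv_def, Matrix.smul_apply, smul_eq_mul, cofactor_comp]
  have h := Ring.mul_inverse_cancel _ hx.isUnit_det
  have h2 : comm (fun n => comp n x) (fun a n => pderiv a (comp n x)) i j b
      = (x.1 i).bracket (x.1 j) b := by
    simp only [comm, VField.bracket, VField.act, Finset.sum_sub_distrib]
    rfl
  rw [h2]
  linear_combination (-((x.1 i).bracket (x.1 j) b * (Matrix.of x.1).adjugate b k)) * h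

theorem constraintA_eq (x : Tuple) : constraintA x = polyA fun n => comp n x := by
  obtain ⟨D, p, p₀, ζ, χ⟩ := x
  change 3 * p₀ ^ 2 - p 1 * p 2 - p 2 * p 0 - p 0 * p 1
    = (3 : ℝ) • (p₀ * p₀) - p 1 * p 2 - p 2 * p 0 - p 0 * p 1
  rw [Algebra.smul_def, map_ofNat]
  ring

/-- The determinant clears the only denominators, those of the inverse frame matrix in the structure
functions. Bounds for sums and products then suffice to control the constraints. -/
theorem det_mul_constraintB {x : Tuple} (hx : IsFrame x.1) (i : Fin 3) :
    polyB (fun n => comp n x) (fun a n => pderiv a (comp n x)) i =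
      (Matrix.of x.1).det * constraintB i x := by
  rw [polyB, scaledStructure_comp hx, scaledStructure_comp hx, frameDet_comp]
  obtain ⟨D, p, p₀, ζ, χ⟩ := x
  have h1 : (D i).act (p (i + 1) + p (i + 2)) = (D i).act (p (i + 1)) + (D i).act (p (i + 2)) := by
    simp only [VField.act, ← pderivₗ_apply, map_add, mul_add, Finset.sum_add_distrib]
  simp only [constraintB, h1]
  change (-(1 / 2 : ℝ)) • ((Matrix.of D).det * ((D i).act (p (i + 1)) + (D i).act (p (i + 2))))
    - (1 / 2 : ℝ) • ((p i - p (i + 1)) * ((Matrix.of D).det * structureFn D i (i + 1) (i + 1)))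
    + (1 / 2 : ℝ) • ((p i - p (i + 2)) * ((Matrix.of D).det * structureFn D (i + 2) i (i + 2)))
    + ((Matrix.of D).det * p i) * (D i).act ζ
    + (3 : ℝ) • (((Matrix.of D).det * p₀) * (D i).act χ) = _
  have h3 : ∀ y : SmoothTorus, (3 : ℝ) • y = 3 * y := fun y => by
    rw [Algebra.smul_def, map_ofNat]
  rw [h3]
  simp only [Algebra.smul_def, map_neg]
  ring

/-- The background values of the components. -/
def background (p : Fin 3 → ℝ) (p₀ : ℝ) : Slot → ℝ
  | .inl (i, a) => if i = a then 1 else 0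
  | .inr (.inl i) => p i
  | .inr (.inr 0) => p₀
  | .inr (.inr 1) => 0
  | .inr (.inr 2) => 0

theorem comp_homogeneous (p : Fin 3 → ℝ) (p₀ : ℝ) (n : Slot) :
    comp n (homogeneous p p₀) = algebraMap ℝ SmoothTorus (background p p₀ n) := by
  rcases n with ⟨i, a⟩ | i | m
  · change (Pi.single i 1 : VField) a = algebraMap ℝ SmoothTorus (if i = a then 1 else 0)
    by_cases h : i = a
    · subst h
      simp
    · rw [if_neg h, map_zero, Pi.single_eq_of_ne' h]
  · rfl
  · fin_cases m
    · rfl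
    · exact (map_zero _).symm
    · exact (map_zero _).symm

theorem pderiv_algebraMap (a : Fin 3) (c : ℝ) : pderiv a (algebraMap ℝ SmoothTorus c) = 0 := by
  ext x
  change fderiv ℝ (fun _ => c) x (Pi.single a 1) = 0
  simp

end TorusConstraints

end

/-! ### The scale of Banach spaces for the constraint equations -/

noncomputable section

namespace TorusConstraints

open SmoothTorus Slot Filter

theorem wnorm_one (s m : ℕ) : wnorm (Weight.high s m) 1 = 1 := by
  rw [wnorm, tsum_eq_single 0]
  · simp [coeff_one, Weight.high_val, Weight.low_val]
  · intro k hk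
    simp [coeff_one, hk]

theorem wnorm_low_one_le (s m : ℕ) : wnorm (Weight.low s m) 1 ≤ 1 := by
  simpa [wnorm_one] using wnorm_low_le s m 1

/-- The algebra in which the components of a tuple live. -/
abbrev HighAlg (a : ℕ × ℕ) : Type := Hat (Weight.high a.1 a.2)

/-- The algebra in which the derivatives of the components of a tuple live. -/
abbrev LowAlg (a : ℕ × ℕ) : Type := Hat (Weight.low a.1 a.2)

/-- The Banach space of tuples. -/
abbrev BTuple (a : ℕ × ℕ) : Type := Slot → HighAlg a

/-- The embedding of smooth tuples into a Banach space. -/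
def embTuple (a : ℕ × ℕ) : Tuple →L[ℝ] BTuple a :=
  ContinuousLinearMap.pi fun n =>
    ⟨(Hat.emb (Weight.high a.1 a.2)).toLinearMap.comp (comp n),
      (continuous_emb _).comp (continuous_comp n)⟩

theorem embTuple_apply (a : ℕ × ℕ) (z : Tuple) (n : Slot) :
    embTuple a z n = Hat.emb (Weight.high a.1 a.2) (comp n z) := rfl

/-- The components in the algebra for the derivatives. -/
def lowVal (a : ℕ × ℕ) (n : Slot) : BTuple a →L[ℝ] LowAlg a :=
  (Hat.lift (w := Weight.high a.1 a.2) (Hat.emb (Weight.low a.1 a.2)).toLinearMap 1 fun f =>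
    (Hat.norm_emb _ f).le.trans (wnorm_low_le a.1 a.2 f)).comp (ContinuousLinearMap.proj n)

/-- The partial derivatives of the components. -/
def lowDeriv (a : ℕ × ℕ) (b : Fin 3) (n : Slot) : BTuple a →L[ℝ] LowAlg a :=
  (Hat.lift (w := Weight.high a.1 a.2) ((Hat.emb (Weight.low a.1 a.2)).toLinearMap.comp (pderivₗ b))
    1 fun f => (Hat.norm_emb _ _).le.trans (wnorm_pderiv_le b a.1 a.2 f)).comp
    (ContinuousLinearMap.proj n)

/-- The operator `∂_b Δ⁻¹`, which gains a derivative. -/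
def highInvLap (a : ℕ × ℕ) (b : Fin 3) : LowAlg a →L[ℝ] HighAlg a :=
  Hat.lift (w := Weight.low a.1 a.2) ((Hat.emb (Weight.high a.1 a.2)).toLinearMap.comp (invLap b))
    2 fun f => (Hat.norm_emb _ _).le.trans (wnorm_invLap_le b a.1 a.2 f)

theorem lowVal_emb (a : ℕ × ℕ) (n : Slot) (z : Tuple) :
    lowVal a n (embTuple a z) = Hat.emb (Weight.low a.1 a.2) (comp n z) :=
  Hat.lift_emb _ _ _ _

theorem lowDeriv_emb (a : ℕ × ℕ) (b : Fin 3) (n : Slot) (z : Tuple) :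
    lowDeriv a b n (embTuple a z) = Hat.emb (Weight.low a.1 a.2) (pderiv b (comp n z)) :=
  Hat.lift_emb _ _ _ _

theorem highInvLap_emb (a : ℕ × ℕ) (b : Fin 3) (f : SmoothTorus) :
    highInvLap a b (Hat.emb (Weight.low a.1 a.2) f) = Hat.emb (Weight.high a.1 a.2) (invLap b f) :=
  Hat.lift_emb _ _ _ _

theorem norm_proj_le (a : ℕ × ℕ) (n : Slot) :
    ‖(ContinuousLinearMap.proj n : BTuple a →L[ℝ] HighAlg a)‖ ≤ 1 :=
  ContinuousLinearMap.opNorm_le_bound _ zero_le_one fun z => by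
    rw [one_mul]
    exact norm_le_pi_norm z n

theorem norm_lowVal_le (a : ℕ × ℕ) (n : Slot) : ‖lowVal a n‖ ≤ 1 :=
  (ContinuousLinearMap.opNorm_comp_le _ _).trans
    (mul_le_one₀ (Hat.norm_lift_le _ zero_le_one _) (norm_nonneg _) (norm_proj_le a n))

theorem norm_lowDeriv_le (a : ℕ × ℕ) (b : Fin 3) (n : Slot) : ‖lowDeriv a b n‖ ≤ 1 :=
  (ContinuousLinearMap.opNorm_comp_le _ _).trans
    (mul_le_one₀ (Hat.norm_lift_le _ zero_le_one _) (norm_nonneg _) (norm_proj_le a n))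

theorem norm_highInvLap_le (a : ℕ × ℕ) (b : Fin 3) : ‖highInvLap a b‖ ≤ 2 :=
  Hat.norm_lift_le _ zero_le_two _

/-! ### The right inverse of the linearization -/

section RightInverse

variable (p : Fin 3 → ℝ) (p₀ : ℝ)

/-- The coefficients of the right inverse for the constraint `A`. -/
def coeffA : Slot → ℝ
  | .inr (.inr 0) => (6 * p₀)⁻¹
  | _ => 0

/-- The coefficients of the right inverse for the constraint `B_i`. -/
def coeffB (i : Fin 3) : Slot → ℝ
  -- The factor cancels `(p i - p b) / 2` in front of `∂_b D_i^b`; this is where the `p i` must be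
  -- pairwise different.
  | .inl (l, b) => if l = i ∧ b ≠ i then 2 / (p i - p b) else 0
  -- With these signs `p_{i+1} + p_{i+2}` has coefficient `-2`, which supplies `∂_i ∂_i Δ⁻¹`, while
  -- the other two pairs cancel and leave the remaining `B_j` untouched.
  | .inr (.inl l) => if l = i then 1 else -1
  -- Chosen so that the linearization of `A` vanishes on the lift.
  | .inr (.inr 0) => (6 * p₀)⁻¹ * ∑ l, (p (l + 1) + p (l + 2)) * (if l = i then 1 else -1)
  | _ => 0

/-- The direction of the operator `∂_b Δ⁻¹` in the right inverse for `B_i`. -/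
def axis (i : Fin 3) : Slot → Fin 3
  | .inl (_, b) => b
  | _ => i

/-- The right inverse of the linearization of `A`. -/
def liftA (f : SmoothTorus) : Tuple := assemble fun n => coeffA p₀ n • f

/-- The right inverse of the linearization of `B_i`. -/
def liftB (i : Fin 3) (f : SmoothTorus) : Tuple :=
  assemble fun n => coeffB p p₀ i n • invLap (axis i n) f

/-- The deviation of the constraint `A` from its linearization. -/
def resA (z : Tuple) : SmoothTorus :=
  linA p p₀ (fun n => comp n z)
    - polyA fun n => algebraMap ℝ SmoothTorus (background p p₀ n) + comp n z

/-- The deviation of the rescaled constraint `B_i` from its linearization. -/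
def resB (i : Fin 3) (z : Tuple) : SmoothTorus :=
  linB p p₀ i (fun a n => pderiv a (comp n z))
    - polyB (fun n => algebraMap ℝ SmoothTorus (background p p₀ n) + comp n z)
      (fun a n => pderiv a (comp n z)) i

/-- The nonlinear part of the constraint equations, as a map from tuples to tuples. -/
def nonlinear (z : Tuple) : Tuple := liftA p₀ (resA p p₀ z) + ∑ i, liftB p p₀ i (resB p p₀ i z)

/-- The map `liftA` on the completions. -/
def hatLiftA (a : ℕ × ℕ) : HighAlg a →L[ℝ] BTuple a :=
  ContinuousLinearMap.pi fun n => coeffA p₀ n • ContinuousLinearMap.id ℝ _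

/-- The map `liftB` on the completions. -/
def hatLiftB (a : ℕ × ℕ) (i : Fin 3) : LowAlg a →L[ℝ] BTuple a :=
  ContinuousLinearMap.pi fun n => coeffB p p₀ i n • highInvLap a (axis i n)

/-- The value of the perturbed components on the completions. -/
def hatVal (a : ℕ × ℕ) (z : BTuple a) (n : Slot) : HighAlg a :=
  algebraMap ℝ (HighAlg a) (background p p₀ n) + z n

/-- The value of the perturbed components in the algebra for the derivatives. -/
def hatLowVal (a : ℕ × ℕ) (z : BTuple a) (n : Slot) : LowAlg a :=
  algebraMap ℝ (LowAlg a) (background p p₀ n) + lowVal a n z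

/-- The rescaled constraint `B_i` on the completions. -/
def hatPolyB (a : ℕ × ℕ) (i : Fin 3) (z : BTuple a) : LowAlg a :=
  polyB (hatLowVal p p₀ a z) (fun b n => lowDeriv a b n z) i

/-- The map `resA` on the completions. -/
def hatResA (a : ℕ × ℕ) (z : BTuple a) : HighAlg a :=
  linA p p₀ z - polyA (hatVal p p₀ a z)

/-- The map `resB` on the completions. -/
def hatResB (a : ℕ × ℕ) (i : Fin 3) (z : BTuple a) : LowAlg a :=
  linB p p₀ i (fun b n => lowDeriv a b n) z - hatPolyB p p₀ a i z

/-- The map `nonlinear` on the completions. -/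
def hatNonlinear (a : ℕ × ℕ) (z : BTuple a) : BTuple a :=
  hatLiftA p₀ a (hatResA p p₀ a z) + ∑ i, hatLiftB p p₀ a i (hatResB p p₀ a i z)

theorem linB_clm_apply {X Y : Type*} [NormedAddCommGroup X] [NormedSpace ℝ X]
    [NormedAddCommGroup Y] [NormedSpace ℝ Y] (i : Fin 3) (T : Fin 3 → Slot → X →L[ℝ] Y) (z : X) :
    linB p p₀ i T z = linB p p₀ i fun a n => T a n z := by
  simp [linB]

theorem hatPolyB_emb (a : ℕ × ℕ) (i : Fin 3) (z : Tuple) :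
    hatPolyB p p₀ a i (embTuple a z) = Hat.emb (Weight.low a.1 a.2)
      (polyB (fun n => algebraMap ℝ SmoothTorus (background p p₀ n) + comp n z)
      (fun a n => pderiv a (comp n z)) i) := by
  rw [map_polyB, hatPolyB]
  congr 1
  · funext n
    rw [hatLowVal, lowVal_emb, map_add, AlgHom.commutes]
  · funext b n
    rw [lowDeriv_emb]

theorem hatResA_emb (a : ℕ × ℕ) (z : Tuple) :
    hatResA p p₀ a (embTuple a z) = Hat.emb (Weight.high a.1 a.2) (resA p p₀ z) := by
  rw [resA, map_sub, map_polyA, hatResA]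
  congr 1
  · exact (map_linA p p₀ (Hat.emb (Weight.high a.1 a.2)).toLinearMap _).symm
  · congr 1
    funext n
    rw [hatVal, map_add, AlgHom.commutes, embTuple_apply]

theorem hatResB_emb (a : ℕ × ℕ) (i : Fin 3) (z : Tuple) :
    hatResB p p₀ a i (embTuple a z) = Hat.emb (Weight.low a.1 a.2) (resB p p₀ i z) := by
  rw [resB, map_sub, hatResB, hatPolyB_emb, linB_clm_apply]
  congr 1
  simp only [lowDeriv_emb]
  exact (map_linB p p₀ (Hat.emb (Weight.low a.1 a.2)).toLinearMap i _).symm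

theorem hatNonlinear_emb (a : ℕ × ℕ) (z : Tuple) :
    embTuple a (nonlinear p p₀ z) = hatNonlinear p p₀ a (embTuple a z) := by
  rw [nonlinear, hatNonlinear, map_add, map_sum]
  congr 1
  · funext n
    rw [embTuple_apply, liftA, comp_assemble, map_smul, hatResA_emb]
    rfl
  · refine Finset.sum_congr rfl fun i _ => ?_
    funext n
    rw [embTuple_apply, liftB, comp_assemble, map_smul, hatResB_emb, ← highInvLap_emb]
    rfl

/-! ### Uniform bounds -/

theorem norm_pi_le {a : ℕ × ℕ} {Y : Type*} [NormedAddCommGroup Y] [NormedSpace ℝ Y]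
    (T : Slot → Y →L[ℝ] HighAlg a) (C : Slot → ℝ) (h : ∀ n, ‖T n‖ ≤ C n) :
    ‖(ContinuousLinearMap.pi T : Y →L[ℝ] BTuple a)‖ ≤ ∑ n, C n := by
  have hC : ∀ n, 0 ≤ C n := fun n => (norm_nonneg _).trans (h n)
  refine ContinuousLinearMap.opNorm_le_bound _ (Finset.sum_nonneg fun n _ => hC n) fun y => ?_
  refine (pi_norm_le_iff_of_nonneg
    (mul_nonneg (Finset.sum_nonneg fun n _ => hC n) (norm_nonneg _))).2 fun n => ?_
  refine ((T n).le_opNorm y).trans ?_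
  gcongr
  exact (h n).trans (Finset.single_le_sum (fun n _ => hC n) (Finset.mem_univ n))

theorem norm_hatLiftA_le (a : ℕ × ℕ) : ‖hatLiftA p₀ a‖ ≤ ∑ n, |coeffA p₀ n| :=
  norm_pi_le _ _ fun n => by
    rw [norm_smul, Real.norm_eq_abs]
    exact mul_le_of_le_one_right (abs_nonneg _) ContinuousLinearMap.norm_id_le

theorem norm_hatLiftB_le (a : ℕ × ℕ) (i : Fin 3) :
    ‖hatLiftB p p₀ a i‖ ≤ ∑ n, |coeffB p p₀ i n| * 2 :=
  norm_pi_le _ _ fun n => by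
    rw [norm_smul, Real.norm_eq_abs]
    gcongr
    exact norm_highInvLap_le a _

theorem uniformlyBounded_proj (n : Slot) : UniformlyBounded fun a (z : BTuple a) => z n :=
  UniformlyBounded.clm (X := BTuple) (Y := HighAlg)
    (fun a => (ContinuousLinearMap.proj n : BTuple a →L[ℝ] HighAlg a)) fun a => norm_proj_le a n

theorem uniformlyBounded_hatVal (n : Slot) :
    UniformlyBounded fun a (z : BTuple a) => hatVal p p₀ a z n := by
  refine (UniformlyBounded.const (X := BTuple) (Y := HighAlg)
    (fun a => algebraMap ℝ (HighAlg a) (background p p₀ n))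
    (C := |background p p₀ n|) fun a => ?_).add (uniformlyBounded_proj n)
  simpa [wnorm_one] using Hat.norm_algebraMap_le (Weight.high a.1 a.2) (background p p₀ n)

theorem uniformlyBounded_hatLowVal (n : Slot) :
    UniformlyBounded fun a (z : BTuple a) => hatLowVal p p₀ a z n := by
  refine (UniformlyBounded.const (fun a => algebraMap ℝ (LowAlg a) (background p p₀ n))
    (C := |background p p₀ n|) fun a => ?_).add
    (.clm (fun a => lowVal a n) fun a => norm_lowVal_le a n)
  exact (Hat.norm_algebraMap_le (Weight.low a.1 a.2) _).trans
    (mul_le_of_le_one_right (abs_nonneg _) (wnorm_low_one_le a.1 a.2))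

theorem uniformlyBounded_lowDeriv (b : Fin 3) (n : Slot) :
    UniformlyBounded fun a (z : BTuple a) => lowDeriv a b n z :=
  .clm (fun a => lowDeriv a b n) fun a => norm_lowDeriv_le a b n

theorem uniformlyBounded_cofactor (b j : Fin 3) :
    UniformlyBounded fun a (z : BTuple a) => cofactor (hatLowVal p p₀ a z) b j :=
  have h := uniformlyBounded_hatLowVal p p₀
  ((h _).mul (h _)).sub ((h _).mul (h _))

theorem uniformlyBounded_frameDet :
    UniformlyBounded fun a (z : BTuple a) => frameDet (hatLowVal p p₀ a z) :=
  .sum _ fun b => (uniformlyBounded_hatLowVal p p₀ _).mul (uniformlyBounded_cofactor p p₀ b 0)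

theorem UniformlyBounded.polyB {A : ℕ × ℕ → Type*} [∀ a, NormedCommRing (A a)]
    [∀ a, NormedAlgebra ℝ (A a)] {v : ∀ a, BTuple a → Slot → A a}
    {dv : ∀ a, BTuple a → Fin 3 → Slot → A a} (hv : ∀ n, UniformlyBounded fun a z => v a z n)
    (hdv : ∀ b n, UniformlyBounded fun a z => dv a z b n) (i : Fin 3) :
    UniformlyBounded fun a z => polyB (v a z) (dv a z) i := by
  have hc : ∀ b j, UniformlyBounded fun a z => cofactor (v a z) b j := fun b j =>
    ((hv _).mul (hv _)).sub ((hv _).mul (hv _))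
  have hd : UniformlyBounded fun a z => frameDet (v a z) :=
    .sum _ fun b => (hv _).mul (hc b 0)
  have hf : ∀ n, UniformlyBounded fun a z => frameDeriv (v a z) (dv a z) i n := fun n =>
    .sum _ fun b => (hv _).mul (hdv b n)
  have hm : ∀ i j b, UniformlyBounded fun a z => comm (v a z) (dv a z) i j b := fun i j b =>
    .sum _ fun c => ((hv _).mul (hdv c _)).sub ((hv _).mul (hdv c _))
  have hs : ∀ i j k, UniformlyBounded fun a z => scaledStructure (v a z) (dv a z) i j k :=
    fun i j k => .sum _ fun b => (hc b k).mul (hm i j b)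
  have h1 := (hd.mul ((hf (mom (i + 1))).add (hf (mom (i + 2))))).smul (-(1 / 2 : ℝ))
  have h2 := (((hv (mom i)).sub (hv (mom (i + 1)))).mul (hs i (i + 1) (i + 1))).smul (1 / 2 : ℝ)
  have h3 := (((hv (mom i)).sub (hv (mom (i + 2)))).mul (hs (i + 2) i (i + 2))).smul (1 / 2 : ℝ)
  have h4 := (hd.mul (hv (mom i))).mul (hf zeta)
  have h5 := ((hd.mul (hv mom₀)).mul (hf chi)).smul (3 : ℝ)
  exact (((h1.sub h2).add h3).add h4).add h5

theorem UniformlyBounded.polyA {A : ℕ × ℕ → Type*} [∀ a, NormedCommRing (A a)]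
    [∀ a, NormedAlgebra ℝ (A a)] {v : ∀ a, BTuple a → Slot → A a}
    (hv : ∀ n, UniformlyBounded fun a z => v a z n) :
    UniformlyBounded fun a z => polyA (v a z) := by
  have h1 := ((hv mom₀).mul (hv mom₀)).smul (3 : ℝ)
  exact ((h1.sub ((hv (mom 1)).mul (hv (mom 2)))).sub ((hv (mom 2)).mul (hv (mom 0)))).sub
    ((hv (mom 0)).mul (hv (mom 1)))

theorem UniformlyBounded.linA {A : ℕ × ℕ → Type*} [∀ a, NormedAddCommGroup (A a)]
    [∀ a, NormedSpace ℝ (A a)] {v : ∀ a, BTuple a → Slot → A a}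
    (hv : ∀ n, UniformlyBounded fun a z => v a z n) :
    UniformlyBounded fun a z => linA p p₀ (v a z) :=
  ((hv mom₀).smul (6 * p₀)).sub (.sum _ fun i => (hv (mom i)).smul (p (i + 1) + p (i + 2)))

theorem UniformlyBounded.linB {A : ℕ × ℕ → Type*} [∀ a, NormedAddCommGroup (A a)]
    [∀ a, NormedSpace ℝ (A a)] {dv : ∀ a, BTuple a → Fin 3 → Slot → A a}
    (h : ∀ b n, UniformlyBounded fun a z => dv a z b n) (i : Fin 3) :
    UniformlyBounded fun a z => linB p p₀ i (dv a z) := by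
  have h1 := ((h i (mom (i + 1))).add (h i (mom (i + 2)))).smul (-(1 / 2 : ℝ))
  have h2 := (((h i (frame (i + 1) (i + 1))).sub (h (i + 1) (frame i (i + 1)))).smul
    (p i - p (i + 1))).smul (1 / 2 : ℝ)
  have h3 := (((h (i + 2) (frame i (i + 2))).sub (h i (frame (i + 2) (i + 2)))).smul
    (p i - p (i + 2))).smul (1 / 2 : ℝ)
  have h4 := (h i zeta).smul (p i)
  have h5 := ((h i chi).smul p₀).smul (3 : ℝ)
  exact (((h1.sub h2).add h3).add h4).add h5

theorem uniformlyBounded_hatPolyB (i : Fin 3) :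
    UniformlyBounded fun a (z : BTuple a) => hatPolyB p p₀ a i z :=
  UniformlyBounded.polyB (A := LowAlg) (uniformlyBounded_hatLowVal p p₀) uniformlyBounded_lowDeriv i

theorem uniformlyBounded_hatResA :
    UniformlyBounded fun a (z : BTuple a) => hatResA p p₀ a z :=
  (UniformlyBounded.linA (A := HighAlg) p p₀ uniformlyBounded_proj).sub
    (UniformlyBounded.polyA (A := HighAlg) (uniformlyBounded_hatVal p p₀))

theorem uniformlyBounded_hatResB (i : Fin 3) :
    UniformlyBounded fun a (z : BTuple a) => hatResB p p₀ a i z := by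
  simp only [hatResB, linB_clm_apply]
  exact (UniformlyBounded.linB (A := LowAlg) p p₀ uniformlyBounded_lowDeriv i).sub
    (uniformlyBounded_hatPolyB p p₀ i)

theorem uniformlyBounded_hatNonlinear :
    UniformlyBounded fun a (z : BTuple a) => hatNonlinear p p₀ a z :=
  ((uniformlyBounded_hatResA p p₀).clm_comp (hatLiftA p₀) (norm_hatLiftA_le p₀)).add
    (.sum _ fun i => (uniformlyBounded_hatResB p p₀ i).clm_comp (fun a => hatLiftB p p₀ a i)
      fun a => norm_hatLiftB_le p p₀ a i)

/-! ### The linearization at the origin -/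

theorem differentiableAt_of_uniformlyBounded {Y : ℕ × ℕ → Type*}
    [∀ a, NormedAddCommGroup (Y a)] [∀ a, NormedSpace ℝ (Y a)] {f : ∀ a, BTuple a → Y a}
    (h : UniformlyBounded f) (a : ℕ × ℕ) : DifferentiableAt ℝ (f a) 0 :=
  (h.contDiff a).differentiable (by simp) 0

theorem hatLowVal_zero (a : ℕ × ℕ) :
    hatLowVal p p₀ a 0 = fun n => algebraMap ℝ (LowAlg a) (background p p₀ n) := by
  funext n
  rw [hatLowVal, map_zero, add_zero]

theorem cofactor_background (b j : Fin 3) :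
    cofactor (background p p₀) b j = if b = j then 1 else 0 := by
  fin_cases b <;> fin_cases j <;> simp [cofactor, background]

theorem frameDet_background : frameDet (background p p₀) = 1 := by
  simp [frameDet, cofactor_background, background]

theorem cofactor_zero (a : ℕ × ℕ) (b j : Fin 3) :
    cofactor (hatLowVal p p₀ a 0) b j = algebraMap ℝ (LowAlg a) (if b = j then 1 else 0) := by
  rw [hatLowVal_zero, ← cofactor_background p p₀, cofactor, cofactor]
  simp only [map_sub, map_mul]

theorem frameDet_zero (a : ℕ × ℕ) : frameDet (hatLowVal p p₀ a 0) = algebraMap ℝ (LowAlg a) 1 := by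
  rw [← frameDet_background p p₀, hatLowVal_zero, frameDet, frameDet]
  simp only [map_sum, map_mul, cofactor, map_sub]

theorem sum_ite_smul {M : Type*} [AddCommGroup M] [Module ℝ M] (i : Fin 3) (T : Fin 3 → M) :
    ∑ b, (if b = i then (1 : ℝ) else 0) • T b = T i := by
  simp [ite_smul]

theorem hasFDerivAt_frameDeriv (a : ℕ × ℕ) (i : Fin 3) (n : Slot) :
    HasFDerivAt (fun z : BTuple a => frameDeriv (hatLowVal p p₀ a z) (fun b n => lowDeriv a b n z) i n)
      (lowDeriv a i n) 0 := by
  have h : ∀ b ∈ Finset.univ, HasFDerivAt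
      (fun z : BTuple a => hatLowVal p p₀ a z (frame i b) * lowDeriv a b n z)
      ((if b = i then (1 : ℝ) else 0) • lowDeriv a b n) 0 := fun b _ =>
    hasFDerivAt_mul_of_eq_zero
      (differentiableAt_of_uniformlyBounded (uniformlyBounded_hatLowVal p p₀ _) a)
      (by rw [hatLowVal_zero]; exact congrArg _ (if_congr eq_comm rfl rfl)) (lowDeriv a b n).hasFDerivAt (map_zero _)
  have h2 := HasFDerivAt.fun_sum h
  rw [sum_ite_smul] at h2
  exact h2

theorem hasFDerivAt_comm (a : ℕ × ℕ) (i j c : Fin 3) :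
    HasFDerivAt (fun z : BTuple a => comm (hatLowVal p p₀ a z) (fun b n => lowDeriv a b n z) i j c)
      (lowDeriv a i (frame j c) - lowDeriv a j (frame i c)) 0 := by
  have h : ∀ i n b, HasFDerivAt
      (fun z : BTuple a => hatLowVal p p₀ a z (frame i b) * lowDeriv a b n z)
      ((if b = i then (1 : ℝ) else 0) • lowDeriv a b n) 0 := fun i n b =>
    hasFDerivAt_mul_of_eq_zero
      (differentiableAt_of_uniformlyBounded (uniformlyBounded_hatLowVal p p₀ _) a)
      (by rw [hatLowVal_zero]; exact congrArg _ (if_congr eq_comm rfl rfl)) (lowDeriv a b n).hasFDerivAt (map_zero _)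
  have h2 := HasFDerivAt.fun_sum (u := Finset.univ)
    fun b _ => (h i (frame j c) b).fun_sub (h j (frame i c) b)
  rw [Finset.sum_sub_distrib, sum_ite_smul i, sum_ite_smul j] at h2
  exact h2

theorem comm_zero (a : ℕ × ℕ) (i j c : Fin 3) :
    comm (hatLowVal p p₀ a 0) (fun b n => lowDeriv a b n 0) i j c = 0 := by
  simp [comm]

theorem frameDeriv_zero (a : ℕ × ℕ) (i : Fin 3) (n : Slot) :
    frameDeriv (hatLowVal p p₀ a 0) (fun b n => lowDeriv a b n 0) i n = 0 := by
  simp [frameDeriv]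

theorem scaledStructure_zero (a : ℕ × ℕ) (i j k : Fin 3) :
    scaledStructure (hatLowVal p p₀ a 0) (fun b n => lowDeriv a b n 0) i j k = 0 := by
  simp only [scaledStructure, comm_zero, mul_zero, Finset.sum_const_zero]

theorem hasFDerivAt_scaledStructure (a : ℕ × ℕ) (i j k : Fin 3) :
    HasFDerivAt (fun z : BTuple a =>
      scaledStructure (hatLowVal p p₀ a z) (fun b n => lowDeriv a b n z) i j k)
      (lowDeriv a i (frame j k) - lowDeriv a j (frame i k)) 0 := by
  have h : ∀ c ∈ Finset.univ, HasFDerivAt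
      (fun z : BTuple a => cofactor (hatLowVal p p₀ a z) c k *
        comm (hatLowVal p p₀ a z) (fun b n => lowDeriv a b n z) i j c)
      ((if c = k then (1 : ℝ) else 0) • (lowDeriv a i (frame j c) - lowDeriv a j (frame i c))) 0 :=
    fun c _ => hasFDerivAt_mul_of_eq_zero
      (differentiableAt_of_uniformlyBounded (uniformlyBounded_cofactor p p₀ c k) a)
      (cofactor_zero p p₀ a c k) (hasFDerivAt_comm p p₀ a i j c) (comm_zero p p₀ a i j c)
  have h2 := HasFDerivAt.fun_sum h
  rw [sum_ite_smul k fun c => lowDeriv a i (frame j c) - lowDeriv a j (frame i c)] at h2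
  exact h2

/-- Directional derivatives and structure functions vanish on the constant background, so each
product contributes its differentiated factor times the background value of its coefficient. -/
theorem hasFDerivAt_hatPolyB (a : ℕ × ℕ) (i : Fin 3) :
    HasFDerivAt (hatPolyB p p₀ a i) (linB p p₀ i fun b n => lowDeriv a b n) 0 := by
  have hv := fun n => differentiableAt_of_uniformlyBounded (uniformlyBounded_hatLowVal p p₀ n) a
  have hd := differentiableAt_of_uniformlyBounded (uniformlyBounded_frameDet p p₀) a
  have hv0 : ∀ n, hatLowVal p p₀ a 0 n = algebraMap ℝ (LowAlg a) (background p p₀ n) :=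
    congrFun (hatLowVal_zero p p₀ a)
  have hf := hasFDerivAt_frameDeriv p p₀ a i
  have hf0 := frameDeriv_zero p p₀ a i
  have hs := hasFDerivAt_scaledStructure p p₀ a
  have hs0 := scaledStructure_zero p p₀ a
  have h1 := (hasFDerivAt_mul_of_eq_zero hd (frameDet_zero p p₀ a)
    ((hf (mom (i + 1))).fun_add (hf (mom (i + 2)))) (by rw [hf0, hf0, add_zero])).fun_const_smul
      (-(1 / 2 : ℝ))
  have h2 := (hasFDerivAt_mul_of_eq_zero ((hv (mom i)).fun_sub (hv (mom (i + 1))))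
    (c := p i - p (i + 1)) (by rw [hv0, hv0, map_sub]; rfl) (hs i (i + 1) (i + 1))
    (hs0 _ _ _)).fun_const_smul (1 / 2 : ℝ)
  have h3 := (hasFDerivAt_mul_of_eq_zero ((hv (mom i)).fun_sub (hv (mom (i + 2))))
    (c := p i - p (i + 2)) (by rw [hv0, hv0, map_sub]; rfl) (hs (i + 2) i (i + 2))
    (hs0 _ _ _)).fun_const_smul (1 / 2 : ℝ)
  have h4 := hasFDerivAt_mul_of_eq_zero (hd.fun_mul (hv (mom i))) (c := p i)
    (by rw [frameDet_zero, hv0, map_one, one_mul]; rfl) (hf zeta) (hf0 zeta)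
  have h5 := (hasFDerivAt_mul_of_eq_zero (hd.fun_mul (hv mom₀)) (c := p₀)
    (by rw [frameDet_zero, hv0, map_one, one_mul]; rfl) (hf chi) (hf0 chi)).fun_const_smul (3 : ℝ)
  have h6 := (((h1.fun_sub h2).fun_add h3).fun_add h4).fun_add h5
  rw [one_smul] at h6
  exact h6

theorem hasFDerivAt_hatResB (a : ℕ × ℕ) (i : Fin 3) :
    HasFDerivAt (hatResB p p₀ a i) (0 : BTuple a →L[ℝ] LowAlg a) 0 := by
  have hl (T : BTuple a →L[ℝ] LowAlg a) : HasFDerivAt T T 0 := T.hasFDerivAt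
  have h := (hl (linB p p₀ i fun b n => lowDeriv a b n)).fun_sub (hasFDerivAt_hatPolyB p p₀ a i)
  rwa [sub_self] at h

theorem hasFDerivAt_hatVal_mul (a : ℕ × ℕ) (n l : Slot) :
    HasFDerivAt (fun z : BTuple a => hatVal p p₀ a z n * hatVal p p₀ a z l)
      (background p p₀ n • (ContinuousLinearMap.proj l : BTuple a →L[ℝ] HighAlg a) +
        background p p₀ l • (ContinuousLinearMap.proj n : BTuple a →L[ℝ] HighAlg a)) 0 := by
  have h : ∀ n, HasFDerivAt (fun z : BTuple a => hatVal p p₀ a z n)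
      (ContinuousLinearMap.proj n : BTuple a →L[ℝ] HighAlg a) 0 := fun n =>
    (ContinuousLinearMap.proj n : BTuple a →L[ℝ] HighAlg a).hasFDerivAt.const_add _
  have h2 := (h n).mul (h l)
  have h3 : ∀ n, hatVal p p₀ a 0 n = algebraMap ℝ (HighAlg a) (background p p₀ n) := fun n => by
    rw [hatVal, Pi.zero_apply, add_zero]
  have h4 : background p p₀ n • (ContinuousLinearMap.proj l : BTuple a →L[ℝ] HighAlg a) +
        background p p₀ l • (ContinuousLinearMap.proj n : BTuple a →L[ℝ] HighAlg a) =
      hatVal p p₀ a 0 n • (ContinuousLinearMap.proj l : BTuple a →L[ℝ] HighAlg a) +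
        hatVal p p₀ a 0 l • (ContinuousLinearMap.proj n : BTuple a →L[ℝ] HighAlg a) := by
    refine ContinuousLinearMap.ext fun z => ?_
    rw [h3, h3]
    simp [Algebra.smul_def]
  rw [h4]
  exact h2

theorem hasFDerivAt_hatResA (a : ℕ × ℕ) :
    HasFDerivAt (hatResA p p₀ a) (0 : BTuple a →L[ℝ] HighAlg a) 0 := by
  have h := hasFDerivAt_hatVal_mul p p₀ a
  have h1 := ((((h mom₀ mom₀).fun_const_smul (3 : ℝ)).fun_sub (h (mom 1) (mom 2))).fun_sub
    (h (mom 2) (mom 0))).fun_sub (h (mom 0) (mom 1))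
  have hl (T : BTuple a →L[ℝ] HighAlg a) : HasFDerivAt T T 0 := T.hasFDerivAt
  have h2 := (hl (linA p p₀ fun n => ContinuousLinearMap.proj n)).fun_sub h1
  have h3 : ∀ z : BTuple a, linA p p₀ (fun n => (ContinuousLinearMap.proj n :
      BTuple a →L[ℝ] HighAlg a)) z = linA p p₀ z := fun z => by
    simp [linA]
  simp only [h3] at h2
  have h4 : ∀ i, background p p₀ (mom i) = p i := fun i => rfl
  have h5 : background p p₀ mom₀ = p₀ := rfl
  refine h2.congr_fderiv ?_
  simp only [linA, Fin.sum_univ_three, h4, h5, zero_add, Fin.isValue, Fin.reduceAdd]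
  module

theorem hasFDerivAt_clm_comp_zero {X Y Z : Type*} [NormedAddCommGroup X] [NormedSpace ℝ X]
    [NormedAddCommGroup Y] [NormedSpace ℝ Y] [NormedAddCommGroup Z] [NormedSpace ℝ Z]
    (T : Y →L[ℝ] Z) {f : X → Y} {x : X} (hf : HasFDerivAt f (0 : X →L[ℝ] Y) x) :
    HasFDerivAt (fun z => T (f z)) (0 : X →L[ℝ] Z) x := by
  have h := T.hasFDerivAt.comp x hf
  rwa [ContinuousLinearMap.comp_zero] at h

theorem hasFDerivAt_hatNonlinear (a : ℕ × ℕ) :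
    HasFDerivAt (hatNonlinear p p₀ a) (0 : BTuple a →L[ℝ] BTuple a) 0 := by
  have h1 := hasFDerivAt_clm_comp_zero (hatLiftA p₀ a) (hasFDerivAt_hatResA p p₀ a)
  have h2 : ∀ i ∈ Finset.univ, HasFDerivAt (fun z => hatLiftB p p₀ a i (hatResB p p₀ a i z))
      (0 : BTuple a →L[ℝ] BTuple a) 0 := fun i _ =>
    hasFDerivAt_clm_comp_zero (hatLiftB p p₀ a i) (hasFDerivAt_hatResB p p₀ a i)
  have h3 := h1.fun_add (HasFDerivAt.fun_sum h2)
  rw [Finset.sum_const_zero, add_zero] at h3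
  exact h3

end RightInverse

end TorusConstraints

end

/-! ### The contraction and the projection -/

noncomputable section

namespace TorusConstraints

open SmoothTorus Slot Filter

theorem assemble_comp (z : Tuple) : assemble (fun n => comp n z) = z :=
  tuple_ext fun n => comp_assemble n _

theorem tendsto_tuple {ι : Type*} {l : Filter ι} {u : ι → Tuple} {z : Tuple}
    (h : ∀ n, Tendsto (fun i => comp n (u i)) l (𝓝 (comp n z))) : Tendsto u l (𝓝 z) := by
  have h1 := (continuous_assemble.tendsto _).comp (tendsto_pi_nhds.2 h)
  rw [assemble_comp] at h1
  exact h1.congr fun i => assemble_comp (u i)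

theorem emb_injective (w : Weight) : Function.Injective (Hat.emb w) := by
  refine (injective_iff_map_eq_zero _).2 fun f hf => ext_coeff fun k => ?_
  have h1 := norm_coeff_le_wnorm w f k
  rw [← Hat.norm_emb, hf, norm_zero] at h1
  rw [map_zero]
  exact norm_le_zero_iff.1 h1

theorem embTuple_injective (a : ℕ × ℕ) : Function.Injective (embTuple a) := fun _ _ h =>
  tuple_ext fun n => emb_injective _ (congrFun h n)

theorem norm_embTuple_zero_le (a : ℕ × ℕ) (z : Tuple) : ‖embTuple (0, 0) z‖ ≤ ‖embTuple a z‖ := by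
  refine (pi_norm_le_iff_of_nonneg (norm_nonneg _)).2 fun n => ?_
  refine le_trans ?_ (norm_le_pi_norm (embTuple a z) n)
  rw [embTuple_apply, embTuple_apply, Hat.norm_emb, Hat.norm_emb]
  exact wnorm_high_zero_le _ _ _

/-- Only finitely many slots have to be made small, and each does so for all large `m`. No order of
smoothness shrinks the neighborhood. -/
theorem exists_norm_embTuple_lt {u : Tuple} {r : ℝ} (hu : ‖embTuple (0, 0) u‖ < r) (s : ℕ) :
    ∃ m : ℕ, ‖embTuple (s, m) u‖ < r := by
  have hr : 0 < r := (norm_nonneg _).trans_lt hu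
  have h1 : ∀ n, ∀ᶠ m : ℕ in atTop, ‖embTuple (s, m) u n‖ < r := fun n => by
    simp only [embTuple_apply, Hat.norm_emb]
    refine (tendsto_wnorm_high s (comp n u)).eventually_lt_const ?_
    have h2 := (pi_norm_lt_iff hr).1 hu n
    rwa [embTuple_apply, Hat.norm_emb] at h2
  obtain ⟨m, hm⟩ := (eventually_all.2 h1).exists
  exact ⟨m, (pi_norm_lt_iff hr).2 hm⟩

section RightInverse

variable {p : Fin 3 → ℝ} {p₀ : ℝ}

theorem polyA_background (hC : constraintMap (homogeneous p p₀) = 0) :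
    polyA (background p p₀) = 0 := by
  have h1 : constraintA (homogeneous p p₀) = 0 := congrArg Prod.fst hC
  rw [constraintA_eq] at h1
  simp only [comp_homogeneous] at h1
  have h2 := map_polyA (background p p₀) (Algebra.ofId ℝ SmoothTorus)
  exact congrArg (fun f : SmoothTorus => f 0) (h2.trans h1)

theorem hatResA_zero (h : polyA (background p p₀) = 0) (a : ℕ × ℕ) : hatResA p p₀ a 0 = 0 := by
  have h1 : polyA (hatVal p p₀ a 0) = 0 := by
    have h2 := map_polyA (background p p₀) (Algebra.ofId ℝ (HighAlg a))
    rw [h, map_zero] at h2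
    rw [h2]
    congr 1
    funext n
    rw [hatVal, Pi.zero_apply, add_zero]
    rfl
  rw [hatResA, h1, sub_zero]
  simp [linA]

theorem hatPolyB_zero (a : ℕ × ℕ) (i : Fin 3) : hatPolyB p p₀ a i 0 = 0 := by
  simp only [hatPolyB, polyB, frameDeriv_zero, scaledStructure_zero, add_zero, mul_zero, smul_zero,
    sub_zero]

theorem hatResB_zero (a : ℕ × ℕ) (i : Fin 3) : hatResB p p₀ a i 0 = 0 := by
  rw [hatResB, hatPolyB_zero, map_zero, sub_zero]

theorem hatNonlinear_zero (h : polyA (background p p₀) = 0) (a : ℕ × ℕ) :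
    hatNonlinear p p₀ a 0 = 0 := by
  simp only [hatNonlinear, hatResA_zero h, hatResB_zero, map_zero, Finset.sum_const_zero, add_zero]

/-- The maps have neither constant nor linear part, and their bounds are uniform over all `(s, m)`,
so one radius makes all of them contractions. -/
theorem exists_contractionScale (h : polyA (background p p₀) = 0) :
    ∃ ε > 0, ∀ ε', 0 < ε' → ε' ≤ ε →
      ContractionScale embTuple (0, 0) (nonlinear p p₀) (hatNonlinear p p₀) ε' := by
  obtain ⟨ε, hε, hc⟩ := (uniformlyBounded_hatNonlinear p p₀).exists_isHalfContraction
    (hatNonlinear_zero h) fun a => (hasFDerivAt_hatNonlinear p p₀ a).fderiv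
  refine ⟨ε, hε, fun ε' h0 hle => ⟨hc ε' h0 hle, fun a z => hatNonlinear_emb p p₀ a z,
    embTuple_injective _, norm_embTuple_zero_le, fun u hu y => ?_, fun u hu s hs => ?_⟩⟩
  -- One norm of each order `s`, with `m` depending on `u`, is available and already determines the
  -- Fréchet topology.
  · choose m hm using exists_norm_embTuple_lt hu
    refine tendsto_id'.1 (tendsto_tuple fun n => (tendsto_iff_emb m _ _).2 fun s => ?_)
    have h1 : (⨅ (a) (_ : ‖embTuple a u‖ < ε' / 2), comap (embTuple a) (𝓝 (embTuple a y))) ≤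
        comap (embTuple (s, m s)) (𝓝 (embTuple (s, m s) y)) := iInf₂_le (s, m s) (hm s)
    exact ((continuous_apply n).tendsto _).comp (tendsto_comap.mono_left h1)
  · choose m hm using exists_norm_embTuple_lt hu
    have h1 : ∀ n, ∃ f, Tendsto (fun i => comp n (s i)) atTop (𝓝 f) := fun n =>
      exists_tendsto_of_cauchySeq m _ fun k =>
        (hs (k, m k) (hm k)).map (Pi.uniformContinuous_proj _ n)
    choose f hf using h1
    refine ⟨assemble f, tendsto_tuple fun n => ?_⟩
    rw [comp_assemble]
    exact hf n

end RightInverse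

/-! ### Continuous linear operators on tuples -/

/-- Without rescaling, the scale closes up under a shift of the order; this gives the continuity of
`∂ₐ` on `𝒮`. -/
theorem high_zero_eq_low (s : ℕ) (f : SmoothTorus) :
    wnorm (Weight.high s 0) f = wnorm (Weight.low (s + 1) 0) f := by
  refine tsum_congr fun k => ?_
  rw [Weight.high_val, Weight.low_val, Weight.low_val, pow_succ']
  simp

/-- The component functions of a tuple, as continuous linear maps. -/
def compL (n : Slot) : Tuple →L[ℝ] SmoothTorus := ⟨comp n, continuous_comp n⟩

/-- Tuples from component functions, as a continuous linear map. -/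
def assembleL : (Slot → SmoothTorus) →L[ℝ] Tuple := ⟨assemble, continuous_assemble⟩

theorem continuous_of_forall_emb {T : SmoothTorus →ₗ[ℝ] SmoothTorus}
    (h : ∀ s, Continuous fun f => Hat.emb (Weight.high s 0) (T f)) : Continuous T :=
  continuous_iff_continuousAt.2 fun f => (tendsto_iff_emb (fun _ => 0) _ _).2 fun s =>
    (h s).tendsto f

/-- The partial derivatives as continuous linear maps. -/
def pderivL (a : Fin 3) : SmoothTorus →L[ℝ] SmoothTorus :=
  ⟨pderivₗ a, continuous_of_forall_emb fun s =>
    continuous_of_bound ((Hat.emb (Weight.high s 0)).toLinearMap.comp (pderivₗ a))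
      (Weight.high (s + 1) 0) 1 zero_le_one fun f => by
        refine (Hat.norm_emb _ _).trans_le ?_
        rw [high_zero_eq_low]
        exact wnorm_pderiv_le a _ _ f⟩

/-- The operator `∂ₐ Δ⁻¹` as a continuous linear map. -/
def invLapL (a : Fin 3) : SmoothTorus →L[ℝ] SmoothTorus :=
  ⟨invLap a, continuous_of_forall_emb fun s =>
    continuous_of_bound ((Hat.emb (Weight.high s 0)).toLinearMap.comp (invLap a))
      (Weight.low s 0) 2 zero_le_two fun f =>
        (Hat.norm_emb _ _).trans_le (wnorm_invLap_le a _ _ f)⟩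

section Operators

variable (p : Fin 3 → ℝ) (p₀ : ℝ)

/-- The linearization of `A` at the background. -/
def opA : Tuple →L[ℝ] SmoothTorus := linA p p₀ compL

/-- The linearization of `B_i` at the background. -/
def opB (i : Fin 3) : Tuple →L[ℝ] SmoothTorus :=
  linB p p₀ i fun a n => (pderivL a).comp (compL n)

theorem opA_apply (z : Tuple) : opA p p₀ z = linA p p₀ fun n => comp n z := by
  simp only [opA, linA]
  rfl

theorem opB_apply (i : Fin 3) (z : Tuple) :
    opB p p₀ i z = linB p p₀ i fun a n => pderiv a (comp n z) := by
  rfl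

/-- The map `liftA` as a continuous linear map. -/
def liftAL : SmoothTorus →L[ℝ] Tuple :=
  assembleL.comp (ContinuousLinearMap.pi fun n => coeffA p₀ n • ContinuousLinearMap.id ℝ SmoothTorus)

/-- The map `liftB` as a continuous linear map. -/
def liftBL (i : Fin 3) : SmoothTorus →L[ℝ] Tuple :=
  assembleL.comp (ContinuousLinearMap.pi fun n => coeffB p p₀ i n • invLapL (axis i n))

theorem liftAL_apply (f : SmoothTorus) : liftAL p₀ f = liftA p₀ f := rfl

theorem liftBL_apply (i : Fin 3) (f : SmoothTorus) : liftBL p p₀ i f = liftB p p₀ i f := rfl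

theorem comp_liftA (f : SmoothTorus) (n : Slot) : comp n (liftAL p₀ f) = coeffA p₀ n • f :=
  comp_assemble n _

theorem comp_liftB (i : Fin 3) (f : SmoothTorus) (n : Slot) :
    comp n (liftBL p p₀ i f) = coeffB p p₀ i n • invLap (axis i n) f :=
  comp_assemble n _

theorem pderiv_zero (a : Fin 3) : pderiv a 0 = 0 := (pderivₗ a).map_zero

theorem pderiv_neg (a : Fin 3) (f : SmoothTorus) : pderiv a (-f) = -pderiv a f :=
  (pderivₗ a).map_neg f

theorem pderiv_smul (a : Fin 3) (c : ℝ) (f : SmoothTorus) : pderiv a (c • f) = c • pderiv a f :=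
  (pderivₗ a).map_smul c f

variable {p p₀}

theorem opA_liftA (h0 : p₀ ≠ 0) (f : SmoothTorus) : opA p p₀ (liftAL p₀ f) = f := by
  rw [opA_apply, linA]
  simp only [comp_liftA, coeffA, zero_smul, smul_zero, Finset.sum_const_zero, sub_zero, smul_smul]
  rw [mul_inv_cancel₀ (by positivity), one_smul]

theorem opB_liftA (i : Fin 3) (f : SmoothTorus) : opB p p₀ i (liftAL p₀ f) = 0 := by
  rw [opB_apply, linB]
  simp [comp_liftA, coeffA, pderiv_zero]

theorem opA_liftB (h0 : p₀ ≠ 0) (i : Fin 3) (f : SmoothTorus) :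
    opA p p₀ (liftBL p p₀ i f) = 0 := by
  rw [opA_apply, linA]
  simp only [comp_liftB, coeffB, axis, smul_smul, ← Finset.sum_smul]
  rw [mul_inv_cancel_left₀ (by positivity), sub_self]

/-- For `i = j` the `p_l` contribute `∂_i ∂_i Δ⁻¹ f` and each `D_i^b` with `b ≠ i` contributes `∂_b
∂_b Δ⁻¹ f`. For `i ≠ j` the two relevant `p_l` have opposite signs, and the linearized `B_j`
involves only diagonal frame components and those of `D_j`. -/
theorem opB_liftB (hp : ∀ i j, i ≠ j → p i ≠ p j) (i j : Fin 3) (f : SmoothTorus) :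
    opB p p₀ j (liftBL p p₀ i f) = if i = j then f - mean f • (1 : SmoothTorus) else 0 := by
  have h1 : ∀ i j, i ≠ j → p i - p j ≠ 0 := fun i j hij => sub_ne_zero.2 (hp i j hij)
  have h01 := h1 0 1 (by decide)
  have h10 := h1 1 0 (by decide)
  have h12 := h1 1 2 (by decide)
  have h21 := h1 2 1 (by decide)
  have h20 := h1 2 0 (by decide)
  have h02 := h1 0 2 (by decide)
  rw [opB_apply, linB, ← sum_pderiv_invLap, Fin.sum_univ_three]
  fin_cases i <;> fin_cases j <;>
    simp [comp_liftB, coeffB, axis, pderiv_smul, pderiv_zero, pderiv_neg, smul_smul]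
  all_goals match_scalars <;> field_simp <;> ring

/-- Constants are invisible to the right inverse, so the defect `mean f` in `opB_liftB` does not
spoil the idempotence of `proj`. -/
theorem liftB_one (i : Fin 3) : liftBL p p₀ i 1 = 0 :=
  tuple_ext fun n => by rw [comp_liftB, invLap_one, smul_zero, map_zero]

variable (p p₀)

/-- The projection onto the range of the right inverse along the kernel of the linearization. -/
def proj : Tuple →L[ℝ] Tuple :=
  (liftAL p₀).comp (opA p p₀) + ∑ i, (liftBL p p₀ i).comp (opB p p₀ i)

theorem proj_apply (z : Tuple) :
    proj p p₀ z = liftAL p₀ (opA p p₀ z) + ∑ i, liftBL p p₀ i (opB p p₀ i z) := by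
  simp [proj]

/-- The constraint `A` of the perturbed background. -/
def valA (z : Tuple) : SmoothTorus :=
  polyA fun n => algebraMap ℝ SmoothTorus (background p p₀ n) + comp n z

/-- The rescaled constraint `B_i` of the perturbed background. -/
def valB (i : Fin 3) (z : Tuple) : SmoothTorus :=
  polyB (fun n => algebraMap ℝ SmoothTorus (background p p₀ n) + comp n z)
    (fun a n => pderiv a (comp n z)) i

variable {p p₀}

theorem opA_lift (h0 : p₀ ≠ 0) (f : SmoothTorus) (g : Fin 3 → SmoothTorus) :
    opA p p₀ (liftAL p₀ f + ∑ i, liftBL p p₀ i (g i)) = f := by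
  simp only [map_add, map_sum, opA_liftA h0, opA_liftB h0, Finset.sum_const_zero, add_zero]

theorem opB_lift (hp : ∀ i j, i ≠ j → p i ≠ p j) (f : SmoothTorus) (g : Fin 3 → SmoothTorus)
    (j : Fin 3) : opB p p₀ j (liftAL p₀ f + ∑ i, liftBL p p₀ i (g i)) =
      g j - mean (g j) • (1 : SmoothTorus) := by
  simp only [map_add, map_sum, opB_liftA, opB_liftB hp, zero_add]
  simp

theorem proj_lift (h0 : p₀ ≠ 0) (hp : ∀ i j, i ≠ j → p i ≠ p j) (f : SmoothTorus)
    (g : Fin 3 → SmoothTorus) : proj p p₀ (liftAL p₀ f + ∑ i, liftBL p p₀ i (g i)) =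
      liftAL p₀ f + ∑ i, liftBL p p₀ i (g i) := by
  rw [proj_apply, opA_lift h0]
  simp only [opB_lift hp, map_sub, map_smul, liftB_one, smul_zero, sub_zero]

theorem proj_proj (h0 : p₀ ≠ 0) (hp : ∀ i j, i ≠ j → p i ≠ p j) (z : Tuple) :
    proj p p₀ (proj p p₀ z) = proj p p₀ z := by
  rw [proj_apply p p₀ z, proj_lift h0 hp]

/-- In this form the fixed-point equation displays its meaning: when `z - u` equals `proj z`, the
lift of all constraints must vanish. -/
theorem nonlinear_eq (z : Tuple) : nonlinear p p₀ z =
    proj p p₀ z - (liftAL p₀ (valA p p₀ z) + ∑ i, liftBL p p₀ i (valB p p₀ i z)) := by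
  have h1 : resA p p₀ z = opA p p₀ z - valA p p₀ z := by rw [opA_apply]; rfl
  have h2 : ∀ i, resB p p₀ i z = opB p p₀ i z - valB p p₀ i z := fun i => by rw [opB_apply]; rfl
  simp only [nonlinear, ← liftAL_apply, ← liftBL_apply, h1, h2, map_sub, proj_apply,
    Finset.sum_sub_distrib]
  abel

theorem proj_nonlinear (h0 : p₀ ≠ 0) (hp : ∀ i j, i ≠ j → p i ≠ p j) (z : Tuple) :
    proj p p₀ (nonlinear p p₀ z) = nonlinear p p₀ z := by
  rw [nonlinear_eq, map_sub, proj_proj h0 hp, proj_lift h0 hp]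

/-- Applying the linearization to the vanishing lift recovers `A` completely and each `B_i` up to
its mean. Only three scalar equations remain. -/
theorem valA_valB_eq_zero (h0 : p₀ ≠ 0) (hp : ∀ i j, i ≠ j → p i ≠ p j) {z : Tuple}
    (hz : nonlinear p p₀ z = proj p p₀ z) (hm : ∀ i, mean (valB p p₀ i z) = 0) :
    valA p p₀ z = 0 ∧ ∀ i, valB p p₀ i z = 0 := by
  rw [nonlinear_eq, sub_eq_self] at hz
  constructor
  · rw [← opA_lift h0 (valA p p₀ z) fun i => valB p p₀ i z, hz, map_zero]
  · intro i
    have h1 := opB_lift (p₀ := p₀) hp (valA p p₀ z) (fun i => valB p p₀ i z) i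
    rw [hz, map_zero, hm, zero_smul, sub_zero] at h1
    exact h1.symm

theorem comp_homogeneous_add (z : Tuple) (n : Slot) : comp n (homogeneous p p₀ + z) =
    algebraMap ℝ SmoothTorus (background p p₀ n) + comp n z := by
  rw [map_add, comp_homogeneous]

theorem constraintMap_eq_zero_iff {z : Tuple} (hz : homogeneous p p₀ + z ∈ domainN) :
    constraintMap (homogeneous p p₀ + z) = 0 ↔ valA p p₀ z = 0 ∧ ∀ i, valB p p₀ i z = 0 := by
  have hA : constraintA (homogeneous p p₀ + z) = valA p p₀ z := by
    rw [constraintA_eq]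
    simp only [comp_homogeneous_add]
    rfl
  have hB : ∀ i, valB p p₀ i z = (Matrix.of (homogeneous p p₀ + z).1).det *
      constraintB i (homogeneous p p₀ + z) := fun i => by
    rw [← det_mul_constraintB hz]
    have h1 : (fun a n => pderiv a (comp n (homogeneous p p₀ + z))) =
        fun a n => pderiv a (comp n z) := by
      funext a n
      rw [comp_homogeneous_add, ← pderivₗ_apply, map_add, pderivₗ_apply, pderiv_algebraMap, zero_add,
        pderivₗ_apply]
    rw [h1]
    simp only [comp_homogeneous_add]
    rfl
  have hd : IsUnit (Matrix.of (homogeneous p p₀ + z).1).det := IsFrame.isUnit_det hz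
  simp only [hB, hd.mul_right_eq_zero]
  rw [← hA, constraintMap, Prod.mk_eq_zero]
  exact and_congr_right fun _ => funext_iff

theorem abs_apply_le_wnorm (f : SmoothTorus) (x : Fin 3 → ℝ) :
    |f x| ≤ wnorm (Weight.high 0 0) f := by
  have h1 : ‖iteratedFDeriv ℝ 0 f x‖ ≤ seminorm 0 f := le_ciSup (bddAbove_iteratedFDeriv 0 f) x
  rw [norm_iteratedFDeriv_zero, Real.norm_eq_abs] at h1
  have h2 := seminorm_le_wnorm 0 0 f
  simp only [pow_zero, one_mul] at h2
  exact h1.trans h2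

theorem mem_domainN_of_norm_lt {z : Tuple} (hz : ‖embTuple (0, 0) z‖ < 1 / 6) :
    homogeneous p p₀ + z ∈ domainN := by
  intro x
  have hs : ∀ i a, |z.1 i a x| < 1 / 6 := fun i a => by
    have h1 := (pi_norm_lt_iff (by norm_num)).1 hz (frame i a)
    rw [embTuple_apply, Hat.norm_emb] at h1
    exact (abs_apply_le_wnorm _ x).trans_lt h1
  let M : Matrix (Fin 3) (Fin 3) ℝ := fun i a => (homogeneous p p₀ + z).1 i a x
  have hM : ∀ i a, M i a = (if i = a then 1 else 0) + z.1 i a x := fun i a => by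
    have h1 := congrArg (fun f : SmoothTorus => f x) (comp_homogeneous_add (p := p) (p₀ := p₀) z (frame i a))
    exact h1
  have hdet : M.det ≠ 0 := by
    refine det_ne_zero_of_sum_row_lt_diag fun i => ?_
    -- Strict diagonal dominance: the two off-diagonal entries add up to at most `1/3`, the diagonal
    -- one exceeds `5/6`.
    have h1 : ∑ a ∈ Finset.univ.erase i, ‖M i a‖ ≤ ∑ a ∈ Finset.univ.erase i, (1 / 6 : ℝ) := by
      refine Finset.sum_le_sum fun a ha => ?_
      rw [hM, if_neg (Finset.ne_of_mem_erase ha).symm, zero_add]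
      exact (hs i a).le
    refine h1.trans_lt ?_
    rw [Finset.sum_const, Finset.card_erase_of_mem (Finset.mem_univ i), hM, if_pos rfl,
      Real.norm_eq_abs]
    have h2 := (abs_lt.1 (hs i i)).1
    rw [abs_of_pos (by linarith)]
    norm_num
    linarith
  exact Matrix.linearIndependent_rows_iff_isUnit.2
    ((Matrix.isUnit_iff_isUnit_det M).2 hdet.isUnit)

end Operators

end TorusConstraints

end

/-! ### Good intersections from dual bases -/

noncomputable section

namespace TorusConstraints

open SmoothTorus Slot Filter

/-- The pairs `e i, f i` span hyperbolic planes, mutually orthogonal for all the forms. As `W`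
serves the common kernel of the functionals `β i (e i)` and `β i (f i)`, which is closed and
complementary because these functionals are dual to the pairs up to `c`. -/
theorem isGoodIntersection_of_dual {E : Type*} [AddCommGroup E] [Module ℝ E] [TopologicalSpace E]
    [IsTopologicalAddGroup E] [ContinuousSMul ℝ E] [T2Space E] {n : ℕ}
    (β : Fin n → LinearMap.BilinForm ℝ E) (hcont : ∀ i, Continuous fun q : E × E => β i q.1 q.2)
    (hsymm : ∀ i u w, β i u w = β i w u) (e f : Fin n → E) {c : ℝ} (hc : c ≠ 0)
    (hee : ∀ i j k, β i (e j) (e k) = 0) (hff : ∀ i j k, β i (f j) (f k) = 0)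
    (hef : ∀ i j k, β i (e j) (f k) = if i = j ∧ i = k then c else 0) : IsGoodIntersection β := by
  have hfe : ∀ i j k, β i (f j) (e k) = if i = k ∧ i = j then c else 0 := fun i j k => by
    rw [hsymm, hef]
  let V : Fin n → Submodule ℝ E := fun i => Submodule.span ℝ {e i, f i}
  let W : Submodule ℝ E := ⨅ i, (β i (e i)).ker ⊓ (β i (f i)).ker
  have hV : ∀ {i u}, u ∈ V i ↔ ∃ a b : ℝ, a • e i + b • f i = u := Submodule.mem_span_pair
  have hW : ∀ {u}, u ∈ W ↔ ∀ i, β i (e i) u = 0 ∧ β i (f i) u = 0 := fun {u} => by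
    simp only [W, Submodule.mem_iInf, Submodule.mem_inf, LinearMap.mem_ker]
  have heV : ∀ i, e i ∈ V i := fun i => Submodule.subset_span (by simp)
  have hfV : ∀ i, f i ∈ V i := fun i => Submodule.subset_span (by simp)
  have hbV : ∀ i j (a b : ℝ), β i (e i) (a • e j + b • f j) = if i = j then b * c else 0 :=
    fun i j a b => by simp [hee, hef]
  have hbV' : ∀ i j (a b : ℝ), β i (f i) (a • e j + b • f j) = if i = j then a * c else 0 :=
    fun i j a b => by simp [hff, hfe]
  have hfin : ∀ i, FiniteDimensional ℝ (V i) := fun i =>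
    FiniteDimensional.span_of_finite ℝ (Set.toFinite _)
  refine ⟨hcont, hsymm, V, W, ?_, ?_, fun i => ?_, hfin, ?_, fun i => ?_⟩
  · refine (DirectSum.isInternal_submodule_iff_iSupIndep_and_iSup_eq_top _).2 ⟨?_, ?_⟩
    · rw [iSupIndep_iff_finsetSum_eq_zero_imp_eq_zero]
      intro s v hv hsum
      classical
      -- Outside `s` the family `v` is arbitrary; extension by zero allows sums over all indices.
      let y : Option (Fin n) → E := fun o => if o ∈ s then v o else 0
      have hy : ∀ o, y o ∈ o.elim W V := fun o => by
        by_cases ho : o ∈ s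
        · simp only [y, if_pos ho, hv o ho]
        · simp only [y, if_neg ho, Submodule.zero_mem]
      have hysum : y none + ∑ i, y (some i) = 0 := by
        rw [← Fintype.sum_option, ← hsum]
        simp [y]
      choose a b hab using fun i => hV.1 (hy (some i))
      have h0 := hW.1 (hy none)
      simp only [← hab] at hysum
      have ha : ∀ i, a i = 0 := fun i => by
        have h1 := congrArg (β i (f i)) hysum
        simp only [map_add (β i (f i)) (y none), map_sum, hbV', h0, map_zero, zero_add] at h1
        simpa [hc] using h1
      have hb : ∀ i, b i = 0 := fun i => by
        have h1 := congrArg (β i (e i)) hysum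
        simp only [map_add (β i (e i)) (y none), map_sum, hbV, h0, map_zero, zero_add] at h1
        simpa [hc] using h1
      have hall : ∀ o, y o = 0 := fun o => by
        cases o with
        | none => simpa [ha, hb] using hysum
        | some i => simp [← hab, ha, hb]
      intro o ho
      have h1 := hall o
      simpa only [y, if_pos ho] using h1
    · refine eq_top_iff.2 fun u _ => ?_
      let v : Fin n → E := fun i => (β i (f i) u / c) • e i + (β i (e i) u / c) • f i
      have h1 : u - ∑ i, v i ∈ W := hW.2 fun i => by
        simp only [map_sub, map_sum, v, hbV, hbV']
        simp [hc]
      have h2 : ∀ o : Option (Fin n), o.elim W V ≤ ⨆ o : Option (Fin n), o.elim W V := fun o =>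
        le_iSup (fun o : Option (Fin n) => o.elim W V) o
      rw [← sub_add_cancel u (∑ i, v i)]
      exact Submodule.add_mem _ (h2 none h1) (Submodule.sum_mem _ fun i _ =>
        h2 (some i) (hV.2 ⟨_, _, rfl⟩))
  · have h1 : (W : Set E) = ⋂ i, ({u | β i (e i) u = 0} ∩ {u | β i (f i) u = 0}) := by
      ext u
      simp only [SetLike.mem_coe, hW, Set.mem_iInter, Set.mem_inter_iff, Set.mem_ofPred_eq]
    rw [h1]
    refine isClosed_iInter fun i => ?_
    have h2 : ∀ x : E, IsClosed {u | β i x u = 0} := fun x =>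
      isClosed_eq ((hcont i).comp (Continuous.prodMk_right x)) continuous_const
    exact (h2 _).inter (h2 _)
  · exact Submodule.closed_of_finiteDimensional _
  · intro i j k hijk u hu w hw
    obtain ⟨a, b, rfl⟩ := hV.1 hu
    obtain ⟨a', b', rfl⟩ := hV.1 hw
    have h1 : ¬(i = j ∧ i = k) := fun h => hijk ⟨h.1, h.1.symm.trans h.2⟩
    have h2 : ¬(i = k ∧ i = j) := fun h => h1 h.symm
    simp only [map_add, map_smul, LinearMap.add_apply, LinearMap.smul_apply, hee, hff, hef, hfe, if_neg h1, if_neg h2]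
    simp
  · have h1 : ∀ a b : ℝ, β i (a • e i + b • f i) (a • e i + b • f i) = 2 * (a * b) * c :=
      fun a b => by
        simp only [map_add, map_smul, LinearMap.add_apply, LinearMap.smul_apply, hee, hff, hef, hfe, smul_eq_mul]
        simp
        ring
    have h2 : 0 < c ^ 2 := by positivity
    -- On `a e + b f` the form equals `2abc`, so `b = ± c` gives `± 2c²` whatever the sign of `c`.
    refine ⟨⟨(1 : ℝ) • e i + c • f i, hV.2 ⟨_, _, rfl⟩, ?_⟩,
      ⟨(1 : ℝ) • e i + (-c) • f i, hV.2 ⟨_, _, rfl⟩, ?_⟩⟩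
    · rw [h1]
      nlinarith
    · rw [h1]
      nlinarith

/-! ### Second derivatives -/

section Second

variable {X Y : Type*} [NormedAddCommGroup X] [NormedSpace ℝ X] [NormedAddCommGroup Y]
  [NormedSpace ℝ Y]

/-- A change of variables tangent to the identity does not change the second derivative at a
critical point. -/
theorem fderiv_fderiv_comp {Q : X → Y} {g : X → X} (hQ : ContDiff ℝ ∞ Q)
    (hg : ContDiffAt ℝ ∞ g 0) (hg0 : g 0 = 0) (hg1 : HasFDerivAt g (.id ℝ X) 0)
    (hQ1 : fderiv ℝ Q 0 = 0) : fderiv ℝ (fderiv ℝ (Q ∘ g)) 0 = fderiv ℝ (fderiv ℝ Q) 0 := by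
  have hQd : Differentiable ℝ Q := hQ.differentiable (by simp)
  have h1 : fderiv ℝ (Q ∘ g) =ᶠ[𝓝 0] fun x => (fderiv ℝ Q (g x)).comp (fderiv ℝ g x) := by
    filter_upwards [(hg.of_le (show (1 : WithTop ℕ∞) ≤ ∞ by simp)).eventually (by simp)] with x hx
    exact fderiv_comp x (hQd _) (hx.differentiableAt (by simp))
  have h2 : DifferentiableAt ℝ (fderiv ℝ Q) (g 0) :=
    (hQ.fderiv_right (m := ∞) (by simp)).differentiable (by simp) _
  have h3 : DifferentiableAt ℝ (fderiv ℝ g) 0 :=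
    (hg.fderiv_right (m := ∞) (by simp)).differentiableAt (by simp)
  have h4 := (h2.hasFDerivAt.comp (0 : X) hg1).clm_comp h3.hasFDerivAt
  rw [h1.fderiv_eq]
  -- The product rule adds a term `DQ(0) ∘ D²g(0)`, which vanishes because `0` is critical for `Q`.
  refine h4.fderiv.trans ?_
  ext a b
  simp [hg0, hQ1, hg1.fderiv]

theorem fderiv_comp_of_tangent {Q : X → Y} {g : X → X} (hQ : ContDiff ℝ ∞ Q) (hg0 : g 0 = 0)
    (hg1 : HasFDerivAt g (.id ℝ X) 0) : fderiv ℝ (Q ∘ g) 0 = fderiv ℝ Q 0 := by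
  rw [fderiv_comp 0 (hQ.differentiable (by simp) _) hg1.differentiableAt, hg0, hg1.fderiv,
    ContinuousLinearMap.comp_id]

theorem fderiv_fderiv_comm {Q : X → Y} (hQ : ContDiff ℝ ∞ Q) (x a b : X) :
    fderiv ℝ (fderiv ℝ Q) x a b = fderiv ℝ (fderiv ℝ Q) x b a :=
  (hQ.contDiffAt.isSymmSndFDerivAt (by
    rw [minSmoothness_of_isRCLikeNormedField]
    exact WithTop.coe_le_coe.2 (show (2 : ℕ∞) ≤ ⊤ from le_top))).eq a b

/-- The second derivative of a map that is quadratic along a line. -/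
theorem fderiv_fderiv_apply_self {Q : X → Y} (hQ : ContDiff ℝ ∞ Q) {a : X} {c : Y}
    (h : ∀ t : ℝ, Q (t • a) = t ^ 2 • c) : fderiv ℝ (fderiv ℝ Q) 0 a a = (2 : ℝ) • c := by
  have hl : ∀ t : ℝ, HasDerivAt (fun t : ℝ => t • a) a t := fun t => by
    simpa using (hasDerivAt_id t).smul_const a
  have h1 : ∀ t : ℝ, fderiv ℝ Q (t • a) a = (2 * t) • c := fun t => by
    have h2 : HasDerivAt (fun t : ℝ => Q (t • a)) (fderiv ℝ Q (t • a) a) t :=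
      (hQ.differentiable (by simp) (t • a)).hasFDerivAt.comp_hasDerivAt t (hl t)
    have h3 : HasDerivAt (fun t : ℝ => t ^ 2 • c) ((2 * t) • c) t := by
      simpa using (hasDerivAt_pow 2 t).smul_const c
    simp only [h] at h2
    exact h2.unique h3
  have hd : Differentiable ℝ (fderiv ℝ Q) :=
    (hQ.fderiv_right (m := ∞) (by simp)).differentiable (by simp)
  have h2 : HasDerivAt (fun t : ℝ => fderiv ℝ Q (t • a)) (fderiv ℝ (fderiv ℝ Q) ((0 : ℝ) • a) a) 0 :=
    (hd ((0 : ℝ) • a)).hasFDerivAt.comp_hasDerivAt (0 : ℝ) (hl 0)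
  have h3 : HasDerivAt (fun t : ℝ => fderiv ℝ Q (t • a) a)
      (fderiv ℝ (fderiv ℝ Q) ((0 : ℝ) • a) a a) 0 :=
    (ContinuousLinearMap.apply ℝ Y a).hasFDerivAt.comp_hasDerivAt (0 : ℝ) h2
  have h4 : HasDerivAt (fun t : ℝ => (2 * t) • c) ((2 : ℝ) • c) 0 := by
    simpa using ((hasDerivAt_id (0 : ℝ)).const_mul 2).smul_const c
  simp only [h1] at h3
  rw [← h3.unique h4, zero_smul]

/-- The second derivative of a map that is a quadratic form on a subspace. -/
theorem fderiv_fderiv_apply_of_quadratic {E : Type*} [AddCommGroup E] [Module ℝ E] {Q : X → Y}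
    (hQ : ContDiff ℝ ∞ Q) (T : E →ₗ[ℝ] X) (q : E →ₗ[ℝ] E →ₗ[ℝ] Y) (h : ∀ z, Q (T z) = q z z)
    (u w : E) : fderiv ℝ (fderiv ℝ Q) 0 (T u) (T w) = q u w + q w u := by
  have h1 : ∀ z, fderiv ℝ (fderiv ℝ Q) 0 (T z) (T z) = (2 : ℝ) • q z z := fun z =>
    fderiv_fderiv_apply_self hQ fun t => by
      rw [← map_smul, h]
      simp [pow_two, smul_smul]
  -- Polarization: the diagonal values together with the symmetry of the second derivative determine
  -- it.
  have h2 := h1 (u + w)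
  simp only [map_add, _root_.add_apply, h1, smul_add] at h2
  rw [fderiv_fderiv_comm hQ 0 (T w) (T u)] at h2
  have h3 : (2 : ℝ) • fderiv ℝ (fderiv ℝ Q) 0 (T u) (T w) = (2 : ℝ) • (q u w + q w u) := by
    rw [two_smul]
    have h4 := congrArg (fun y => y - ((2 : ℝ) • q u u + (2 : ℝ) • q w w)) h2
    calc _ = _ := ?_
      _ = _ := h4
      _ = _ := ?_
    · abel
    · simp only [LinearMap.add_apply, smul_add]
      abel
  exact smul_right_injective Y (two_ne_zero (α := ℝ)) h3

end Second

end TorusConstraints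

end

/-! ### Trigonometric functions on the torus -/

noncomputable section

namespace TorusConstraints

open SmoothTorus Slot Filter

theorem periodic_comp_coord {g : ℝ → ℝ} (hg : Function.Periodic g (2 * Real.pi)) (a b : Fin 3)
    (x : Fin 3 → ℝ) : g ((x + Pi.single b (2 * Real.pi) : Fin 3 → ℝ) a) = g (x a) := by
  by_cases h : a = b
  · subst h
    rw [Pi.add_apply, Pi.single_eq_same, hg]
  · rw [Pi.add_apply, Pi.single_eq_of_ne h, add_zero]

/-- The function `sin x_a`. -/
def sinC (a : Fin 3) : SmoothTorus :=
  ⟨fun x => Real.sin (x a), Real.contDiff_sin.comp (contDiff_apply ℝ ℝ a),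
    fun x b => periodic_comp_coord Real.sin_periodic a b x⟩

/-- The function `cos x_a`. -/
def cosC (a : Fin 3) : SmoothTorus :=
  ⟨fun x => Real.cos (x a), Real.contDiff_cos.comp (contDiff_apply ℝ ℝ a),
    fun x b => periodic_comp_coord Real.cos_periodic a b x⟩

theorem pderiv_eq_of_hasDerivAt {g g' : ℝ → ℝ} (hg : ∀ t, HasDerivAt g (g' t) t) {a : Fin 3}
    {f : SmoothTorus} (hf : ∀ x, f x = g (x a)) (b : Fin 3) (x : Fin 3 → ℝ) :
    pderiv b f x = if a = b then g' (x a) else 0 := by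
  have h1 : (f : (Fin 3 → ℝ) → ℝ) = fun x => g (x a) := funext hf
  have h2 : HasFDerivAt (fun x : Fin 3 → ℝ => g (x a))
      (g' (x a) • (ContinuousLinearMap.proj a : (Fin 3 → ℝ) →L[ℝ] ℝ)) x :=
    (hg (x a)).comp_hasFDerivAt x
      (ContinuousLinearMap.proj a : (Fin 3 → ℝ) →L[ℝ] ℝ).hasFDerivAt
  rw [pderiv_apply, h1, h2.fderiv]
  change g' (x a) * (Pi.single b 1 : Fin 3 → ℝ) a = _
  simp [Pi.single_apply]

theorem pderiv_sinC (b a : Fin 3) : pderiv b (sinC a) = if a = b then cosC a else 0 := by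
  ext x
  rw [pderiv_eq_of_hasDerivAt Real.hasDerivAt_sin (fun _ => rfl) b x]
  split_ifs <;> rfl

theorem pderiv_cosC (b a : Fin 3) : pderiv b (cosC a) = if a = b then -sinC a else 0 := by
  ext x
  rw [pderiv_eq_of_hasDerivAt Real.hasDerivAt_cos (fun _ => rfl) b x]
  split_ifs <;> rfl

theorem pderiv_mul (a : Fin 3) (f g : SmoothTorus) :
    pderiv a (f * g) = f * pderiv a g + g * pderiv a f := by
  ext x
  have h := fderiv_mul (f.contDiff.differentiable (by simp) x) (g.contDiff.differentiable (by simp) x)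
  exact congrArg (fun T : (Fin 3 → ℝ) →L[ℝ] ℝ => T (Pi.single a 1)) h

/-- The factor `cos x_j` is constant along `x_i`, so the product is a derivative in that direction.
-/
theorem mean_cosC_mul_sinC {i j : Fin 3} (h : j ≠ i) : mean (cosC j * sinC i) = 0 := by
  have h1 : cosC j * sinC i = -pderiv i (cosC j * cosC i) := by
    rw [pderiv_mul, pderiv_cosC, pderiv_cosC, if_pos rfl, if_neg h]
    ring
  rw [h1, map_neg, mean_pderiv, neg_zero]

/-- `sin² + cos² = 1` has mean one, and `cos² - sin²` is a derivative, so both squares share the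
mean equally. -/
theorem mean_sinC_mul_sinC (i : Fin 3) : mean (sinC i * sinC i) = 1 / 2 := by
  have h1 : sinC i * sinC i + cosC i * cosC i = 1 := by
    ext x
    change Real.sin (x i) * Real.sin (x i) + Real.cos (x i) * Real.cos (x i) = 1
    nlinarith [Real.sin_sq_add_cos_sq (x i)]
  have h2 : pderiv i (sinC i * cosC i) = cosC i * cosC i - sinC i * sinC i := by
    rw [pderiv_mul, pderiv_cosC, pderiv_sinC, if_pos rfl, if_pos rfl]
    ring
  have h3 := congrArg mean h1
  have h4 := mean_pderiv i (sinC i * cosC i)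
  rw [h2, map_sub] at h4
  rw [map_add, mean_one] at h3
  linarith

/-! ### The kernel directions -/

section Kernel

variable (p : Fin 3 → ℝ) (p₀ : ℝ)

/-- A direction in the kernel of the linearization in which only `p_i` and `p₀` vary. -/
def kerMom (i : Fin 3) : Tuple := assemble fun
  | .inr (.inl l) => if l = i then sinC i else 0
  | .inr (.inr 0) => ((6 * p₀)⁻¹ * (p (i + 1) + p (i + 2))) • sinC i
  | _ => 0

/-- A direction in the kernel of the linearization in which `ζ` varies. -/
def kerZeta (i : Fin 3) : Tuple := assemble fun
  | .inr (.inl l) => if l = i + 1 then (2 * p i) • cosC i else 0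
  | .inr (.inr 0) => ((6 * p₀)⁻¹ * ((p (i + 2) + p i) * (2 * p i))) • cosC i
  | .inr (.inr 1) => cosC i
  | _ => 0

variable {p p₀}

theorem proj_eq_zero {z : Tuple} (hA : opA p p₀ z = 0) (hB : ∀ i, opB p p₀ i z = 0) :
    proj p p₀ z = 0 := by
  simp [proj_apply, hA, hB]

theorem proj_kerMom (h0 : p₀ ≠ 0) (i : Fin 3) : proj p p₀ (kerMom p p₀ i) = 0 := by
  refine proj_eq_zero ?_ fun j => ?_
  · rw [opA_apply, linA, Fin.sum_univ_three]
    fin_cases i <;> simp [kerMom, comp_assemble, smul_smul] <;> match_scalars <;> field_simp <;> ring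
  · rw [opB_apply, linB]
    fin_cases i <;> fin_cases j <;>
      simp [kerMom, comp_assemble, pderiv_zero, pderiv_sinC]

/-- The variation `2 p_i cos x_i` of `p_{i+1}` cancels `p_i ∂_i ζ` against `-½ ∂_i p_{i+1}`, and
that of `p₀` restores `A`. The other `B_j` differentiate in directions in which `cos x_i` is
constant. -/
theorem proj_kerZeta (h0 : p₀ ≠ 0) (i : Fin 3) : proj p p₀ (kerZeta p p₀ i) = 0 := by
  refine proj_eq_zero ?_ fun j => ?_
  · rw [opA_apply, linA, Fin.sum_univ_three]
    fin_cases i <;> simp [kerZeta, comp_assemble, smul_smul] <;> match_scalars <;> field_simp <;> ring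
  · rw [opB_apply, linB]
    fin_cases i <;> fin_cases j <;>
      simp [kerZeta, comp_assemble, pderiv_zero, pderiv_cosC, pderiv_smul, smul_smul]

/-- The tuples without variation of the frame and of `χ`. -/
def frozen : Submodule ℝ Tuple := (⨅ i, ⨅ a, (comp (frame i a)).ker) ⊓ (comp chi).ker

theorem mem_frozen {z : Tuple} :
    z ∈ frozen ↔ (∀ i a, comp (frame i a) z = 0) ∧ comp chi z = 0 := by
  simp [frozen]

theorem kerMom_mem_frozen (i : Fin 3) : kerMom p p₀ i ∈ frozen :=
  mem_frozen.2 ⟨fun _ _ => comp_assemble _ _, comp_assemble _ _⟩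

theorem kerZeta_mem_frozen (i : Fin 3) : kerZeta p p₀ i ∈ frozen :=
  mem_frozen.2 ⟨fun _ _ => comp_assemble _ _, comp_assemble _ _⟩

/-- The coordinate frame commutes and has determinant one, so the structure functions disappear and
`p_i ∂_i ζ` is the only nonlinear term left. -/
theorem valB_of_mem_frozen {z : Tuple} (hz : z ∈ frozen) (i : Fin 3) : valB p p₀ i z =
    (-(1 / 2 : ℝ)) • (pderiv i (comp (mom (i + 1)) z) + pderiv i (comp (mom (i + 2)) z)) +
      (p i • pderiv i (comp zeta z) + comp (mom i) z * pderiv i (comp zeta z)) := by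
  obtain ⟨h1, h2⟩ := mem_frozen.1 hz
  have hv : ∀ i a, algebraMap ℝ SmoothTorus (background p p₀ (frame i a)) + comp (frame i a) z =
      if i = a then 1 else 0 := fun i a => by
    rw [h1, add_zero, background, apply_ite (algebraMap ℝ SmoothTorus), map_one, map_zero]
  have hd : frameDet (fun n => algebraMap ℝ SmoothTorus (background p p₀ n) + comp n z) = 1 := by
    simp only [frameDet, cofactor, hv, Fin.sum_univ_three]
    simp
  have hf : ∀ n, frameDeriv (fun n => algebraMap ℝ SmoothTorus (background p p₀ n) + comp n z)
      (fun a n => pderiv a (comp n z)) i n = pderiv i (comp n z) := fun n => by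
    simp only [frameDeriv, hv]
    simp
  have hs : ∀ i j k, scaledStructure
      (fun n => algebraMap ℝ SmoothTorus (background p p₀ n) + comp n z)
      (fun a n => pderiv a (comp n z)) i j k = 0 := fun i j k => by
    simp [scaledStructure, comm, h1, pderiv_zero]
  have hm : background p p₀ (mom i) = p i := rfl
  rw [valB, polyB, hd, hs, hs, hf, hf, hf, hf, h2, pderiv_zero, hm]
  simp only [one_mul, mul_zero, sub_zero, add_zero, add_mul, Algebra.smul_def]

theorem mean_valB_of_mem_frozen {z : Tuple} (hz : z ∈ frozen) (i : Fin 3) :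
    mean (valB p p₀ i z) = mean (comp (mom i) z * pderiv i (comp zeta z)) := by
  rw [valB_of_mem_frozen hz]
  simp [mean_pderiv]

/-- The quadratic form of the constraint `B_i` on `frozen`. -/
def quad (i : Fin 3) : Tuple →ₗ[ℝ] Tuple →ₗ[ℝ] ℝ :=
  ((LinearMap.mul ℝ SmoothTorus).compl₁₂ (comp (mom i)) ((pderivₗ i).comp (comp zeta))).compr₂ mean

theorem quad_apply (i : Fin 3) (u w : Tuple) :
    quad i u w = mean (comp (mom i) u * pderiv i (comp zeta w)) := rfl

theorem quad_kerMom (i k : Fin 3) (u : Tuple) : quad i u (kerMom p p₀ k) = 0 := by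
  have h1 : comp zeta (kerMom p p₀ k) = 0 := comp_assemble _ _
  rw [quad_apply, h1, pderiv_zero, mul_zero, map_zero]

/-- A nonzero integrand requires `i = j + 1` and `k = i`. It is then a multiple of `cos x_j sin x_i`
with `j ≠ i`, whose mean is zero. -/
theorem quad_kerZeta_kerZeta (i j k : Fin 3) :
    quad i (kerZeta p p₀ j) (kerZeta p p₀ k) = 0 := by
  have h1 : comp zeta (kerZeta p p₀ k) = cosC k := comp_assemble _ _
  have h2 : comp (mom i) (kerZeta p p₀ j) = if i = j + 1 then (2 * p j) • cosC j else 0 :=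
    comp_assemble _ _
  rw [quad_apply, h1, h2, pderiv_cosC]
  by_cases hi : i = j + 1
  · have hj : j ≠ i := fun h => by
      subst h
      revert hi
      fin_cases j <;> decide
    by_cases hk : k = i
    · subst hk
      rw [if_pos hi, if_pos rfl, mul_neg, smul_mul_assoc, map_neg, map_smul, mean_cosC_mul_sinC hj,
        smul_zero, neg_zero]
    · rw [if_neg hk, mul_zero, map_zero]
  · rw [if_neg hi, zero_mul, map_zero]

theorem quad_kerMom_kerZeta (i j k : Fin 3) :
    quad i (kerMom p p₀ j) (kerZeta p p₀ k) = if i = j ∧ i = k then -(1 / 2) else 0 := by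
  have h1 : comp zeta (kerZeta p p₀ k) = cosC k := comp_assemble _ _
  have h2 : comp (mom i) (kerMom p p₀ j) = if i = j then sinC j else 0 := comp_assemble _ _
  rw [quad_apply, h1, h2, pderiv_cosC]
  by_cases hj : i = j
  · by_cases hk : i = k
    · subst hj hk
      rw [if_pos rfl, if_pos rfl, if_pos ⟨rfl, rfl⟩, mul_neg, map_neg, mean_sinC_mul_sinC]
    · rw [if_neg fun h : k = i => hk h.symm, if_neg fun h : i = j ∧ i = k => hk h.2, mul_zero, map_zero]
  · rw [if_neg hj, if_neg fun h : i = j ∧ i = k => hj h.1, zero_mul, map_zero]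

end Kernel

/-! ### The obstruction map -/

section Obstruction

variable (p : Fin 3 → ℝ) (p₀ : ℝ)

/-- The mean value on the completion. -/
def hatMean : LowAlg (0, 0) →L[ℝ] ℝ := Hat.lift (w := Weight.low 0 0) mean 1 (abs_mean_le _)

theorem hatMean_emb (f : SmoothTorus) : hatMean (Hat.emb (Weight.low 0 0) f) = mean f :=
  Hat.lift_emb _ _ _ f

/-- The mean values of the rescaled constraints `B_i` on the base Banach space. -/
def hatObs (z : BTuple (0, 0)) (i : Fin 3) : ℝ := hatMean (hatPolyB p p₀ (0, 0) i z)

/-- The mean values of the rescaled constraints `B_i`. -/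
def obs (z : Tuple) (i : Fin 3) : ℝ := mean (valB p p₀ i z)

theorem obs_eq (z : Tuple) : obs p p₀ z = hatObs p p₀ (embTuple (0, 0) z) :=
  funext fun i => by
    rw [obs, hatObs, hatPolyB_emb, hatMean_emb]
    rfl

theorem contDiff_hatObs : ContDiff ℝ ∞ (hatObs p p₀) :=
  contDiff_pi.2 fun i =>
    hatMean.contDiff.comp ((uniformlyBounded_hatPolyB p p₀ i).contDiff (0, 0))

/-- True on smooth functions by `mean_pderiv`, and on the completion by density. -/
theorem hatMean_lowDeriv (b : Fin 3) (n : Slot) (z : BTuple (0, 0)) :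
    hatMean (lowDeriv (0, 0) b n z) = 0 := by
  refine (Hat.denseRange_emb (Weight.high 0 0)).induction_on
    (p := fun y => hatMean (Hat.lift (w := Weight.high 0 0)
      ((Hat.emb (Weight.low 0 0)).toLinearMap.comp (pderivₗ b)) 1
      (fun f => (Hat.norm_emb _ _).le.trans (wnorm_pderiv_le b 0 0 f)) y) = 0) (z n) ?_ fun f => ?_
  · exact isClosed_eq (hatMean.continuous.comp (ContinuousLinearMap.continuous _)) continuous_const
  · exact (congrArg hatMean (Hat.lift_emb _ _ _ f)).trans
      ((hatMean_emb _).trans (mean_pderiv b f))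

/-- The linearized `B_i` is a combination of partial derivatives with constant coefficients, so its
mean is zero. This is the reason for `DB(0) = 0`. -/
theorem hasFDerivAt_hatObs :
    HasFDerivAt (hatObs p p₀) (0 : BTuple (0, 0) →L[ℝ] Fin 3 → ℝ) 0 := by
  refine hasFDerivAt_pi'.2 fun i => ?_
  have h1 := hatMean.hasFDerivAt.comp (0 : BTuple (0, 0)) (hasFDerivAt_hatPolyB p p₀ (0, 0) i)
  refine h1.congr_fderiv (ContinuousLinearMap.ext fun z => ?_)
  change hatMean (linB p p₀ i (fun b n => lowDeriv (0, 0) b n) z) = 0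
  rw [linB_clm_apply]
  refine (map_linB p p₀ (hatMean : LowAlg (0, 0) →ₗ[ℝ] ℝ) i _).trans ?_
  simp [linB, hatMean_lowDeriv]

theorem hatObs_zero : hatObs p p₀ 0 = 0 := funext fun i => by
  rw [hatObs, hatPolyB_zero, map_zero, Pi.zero_apply]

/-- The second derivative of the obstruction on the embedded tuples. -/
def obsForm (i : Fin 3) : LinearMap.BilinForm ℝ Tuple :=
  LinearMap.mk₂ ℝ (fun u w => fderiv ℝ (fderiv ℝ (hatObs p p₀)) 0 (embTuple (0, 0) u)
    (embTuple (0, 0) w) i)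
    (fun _ _ _ => by simp) (fun _ _ _ => by simp) (fun _ _ _ => by simp) (fun _ _ _ => by simp)

theorem obsForm_apply (i : Fin 3) (u w : Tuple) : obsForm p p₀ i u w =
    fderiv ℝ (fderiv ℝ (hatObs p p₀)) 0 (embTuple (0, 0) u) (embTuple (0, 0) w) i := rfl

theorem obsForm_symm (i : Fin 3) (u w : Tuple) : obsForm p p₀ i u w = obsForm p p₀ i w u := by
  rw [obsForm_apply, fderiv_fderiv_comm (contDiff_hatObs p p₀)]
  rfl

theorem continuous_obsForm (i : Fin 3) :
    Continuous fun q : Tuple × Tuple => obsForm p p₀ i q.1 q.2 := by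
  simp only [obsForm_apply]
  fun_prop

/-- On `frozen` the obstruction is not merely approximated by but equal to a quadratic form, so its
second derivative there is the polarization. -/
theorem obsForm_of_mem_frozen (i : Fin 3) {u w : Tuple} (hu : u ∈ frozen) (hw : w ∈ frozen) :
    obsForm p p₀ i u w = quad i u w + quad i w u := by
  let q : frozen →ₗ[ℝ] frozen →ₗ[ℝ] Fin 3 → ℝ := LinearMap.mk₂ ℝ (fun u w j => quad j u w)
    (fun _ _ _ => by ext; simp) (fun _ _ _ => by ext; simp) (fun _ _ _ => by ext; simp)
    (fun _ _ _ => by ext; simp)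
  have h1 := fderiv_fderiv_apply_of_quadratic (contDiff_hatObs p p₀)
    ((embTuple (0, 0) : Tuple →ₗ[ℝ] BTuple (0, 0)).comp frozen.subtype) q (fun z => by
      funext j
      refine (congrFun (obs_eq p p₀ z) j).symm.trans ?_
      exact mean_valB_of_mem_frozen z.2 j) ⟨u, hu⟩ ⟨w, hw⟩
  exact congrFun h1 i

end Obstruction

end TorusConstraints

end

/-! ### The local structure of the solution space -/

noncomputable section

namespace TorusConstraints

open SmoothTorus Slot Filter

section Local

variable {p : Fin 3 → ℝ} {p₀ ε : ℝ}
  (h : ContractionScale embTuple (0, 0) (nonlinear p p₀) (hatNonlinear p p₀) ε)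

/-- Apply `proj` to the fixed-point equation: it kills `u` and fixes the nonlinear part, which lies
in its range. -/
theorem nonlinear_sol (h0 : p₀ ≠ 0) (hp : ∀ i j, i ≠ j → p i ≠ p j) {u : Tuple}
    (hu : proj p p₀ u = 0) (hun : ‖embTuple (0, 0) u‖ < ε / 2) :
    nonlinear p p₀ (h.sol u) = proj p p₀ (h.sol u) := by
  have h1 := congrArg (proj p p₀) (h.sol_eq hun)
  rw [map_add, hu, zero_add, proj_nonlinear h0 hp] at h1
  exact h1.symm

theorem sol_eq_add_proj (h0 : p₀ ≠ 0) (hp : ∀ i j, i ≠ j → p i ≠ p j) {u : Tuple}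
    (hu : proj p p₀ u = 0) (hun : ‖embTuple (0, 0) u‖ < ε / 2) :
    h.sol u = u + proj p p₀ (h.sol u) := by
  rw [← nonlinear_sol h h0 hp hu hun]
  exact h.sol_eq hun

theorem norm_proj_sol_lt (h0 : p₀ ≠ 0) (hp : ∀ i j, i ≠ j → p i ≠ p j) {u : Tuple}
    (hu : proj p p₀ u = 0) (hun : ‖embTuple (0, 0) u‖ < ε / 2) :
    ‖embTuple (0, 0) (proj p p₀ (h.sol u))‖ < ε / 2 := by
  rw [← nonlinear_sol h h0 hp hu hun, hatNonlinear_emb]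
  have h1 := (h.contraction (0, 0)).norm_le (h.norm_sol_lt hun)
  have h2 := h.norm_sol_le hun
  linarith

theorem sol_zero (hε : 0 < ε) : h.sol 0 = 0 := by
  have h1 := h.norm_sol_le (a := (0, 0)) (u := 0) (by simpa using hε)
  rw [map_zero, norm_zero, mul_zero] at h1
  exact h.injective ((norm_le_zero_iff.1 h1).trans (map_zero _).symm)

/-- When all constraints vanish, the nonlinear part reduces to `proj (u + v) = v`, so `u + v` solves
the fixed-point equation. Uniqueness in the ball of radius `ε` concludes. -/
theorem eq_sol_of_constraintMap_eq_zero (hε : ε ≤ 1 / 6) {u v : Tuple} (hu : proj p p₀ u = 0)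
    (hv : proj p p₀ v = v) (hun : ‖embTuple (0, 0) u‖ < ε / 2) (hvn : ‖embTuple (0, 0) v‖ < ε / 2)
    (hC : constraintMap (homogeneous p p₀ + (u + v)) = 0) : u + v = h.sol u := by
  have hz : ‖embTuple (0, 0) (u + v)‖ < ε := by
    rw [map_add]
    linarith [norm_add_le (embTuple (0, 0) u) (embTuple (0, 0) v)]
  obtain ⟨hA, hB⟩ := (constraintMap_eq_zero_iff (mem_domainN_of_norm_lt (hz.trans_le hε))).1 hC
  refine h.sol_eq_of_eq hun hz ?_
  simp only [nonlinear_eq, hA, hB, map_zero, Finset.sum_const_zero, add_zero, sub_zero, map_add, hu,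
    hv, zero_add]

theorem constraintMap_sol_eq_zero_iff (h0 : p₀ ≠ 0) (hp : ∀ i j, i ≠ j → p i ≠ p j) (hε : ε ≤ 1 / 6)
    {u : Tuple} (hu : proj p p₀ u = 0) (hun : ‖embTuple (0, 0) u‖ < ε / 2) :
    homogeneous p p₀ + h.sol u ∈ domainN ∧
      (constraintMap (homogeneous p p₀ + h.sol u) = 0 ↔ obs p p₀ (h.sol u) = 0) := by
  have hN := mem_domainN_of_norm_lt (p := p) (p₀ := p₀) ((h.norm_sol_lt hun).trans_le hε)
  refine ⟨hN, (constraintMap_eq_zero_iff hN).trans ⟨fun hAB => ?_, fun hm => ?_⟩⟩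
  · funext i
    rw [obs, hAB.2, map_zero, Pi.zero_apply]
  · exact valA_valB_eq_zero h0 hp (nonlinear_sol h h0 hp hu hun) (congrFun hm)

theorem solutions_eq (h0 : p₀ ≠ 0) (hp : ∀ i j, i ≠ j → p i ≠ p j) (hε : ε ≤ 1 / 6)
    (V : Submodule ℝ Tuple) (hV : ∀ v ∈ V, proj p p₀ v = v) (φ : (proj p p₀).ker → V)
    (hφ : ∀ u, (φ u : Tuple) = proj p p₀ (h.sol u)) :
    {x | x ∈ domainN ∧ constraintMap x = 0} ∩
        {x | ∃ u ∈ {u : (proj p p₀).ker | ‖embTuple (0, 0) u‖ < ε / 2},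
          ∃ v ∈ {v : V | ‖embTuple (0, 0) v‖ < ε / 2}, x = homogeneous p p₀ + (u : Tuple) + v} =
      {x | ∃ u ∈ {u : (proj p p₀).ker | ‖embTuple (0, 0) u‖ < ε / 2}, obs p p₀ (h.sol u) = 0 ∧
        x = homogeneous p p₀ + ((u : Tuple) + φ u)} := by
  have hadd : ∀ u : (proj p p₀).ker, ‖embTuple (0, 0) u‖ < ε / 2 → (u : Tuple) + φ u = h.sol u :=
    fun u hu => by rw [hφ, ← sol_eq_add_proj h h0 hp u.2 hu]
  refine Set.Subset.antisymm ?_ ?_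
  · rintro x ⟨⟨-, hx⟩, u, hu, v, hv, rfl⟩
    rw [add_assoc] at hx
    have hsol := eq_sol_of_constraintMap_eq_zero h hε u.2 (hV v v.2) hu hv hx
    rw [hsol] at hx
    refine ⟨u, hu, (constraintMap_sol_eq_zero_iff h h0 hp hε u.2 hu).2.1 hx, ?_⟩
    rw [hadd u hu, add_assoc, hsol]
  · rintro x ⟨u, hu, hB, rfl⟩
    have hsol := constraintMap_sol_eq_zero_iff h h0 hp hε u.2 hu
    refine ⟨?_, u, hu, φ u, ?_, (add_assoc _ _ _).symm⟩
    · rw [hadd u hu]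
      exact ⟨hsol.1, hsol.2.2 hB⟩
    · change ‖embTuple (0, 0) (φ u : Tuple)‖ < ε / 2
      rw [hφ]
      exact norm_proj_sol_lt h h0 hp u.2 hu

include h in
theorem contDiffAt_inv_zero (hε : 0 < ε) :
    ContDiffAt ℝ ∞ (IsHalfContraction.inv (hatNonlinear p p₀ (0, 0)) ε) 0 ∧
      IsHalfContraction.inv (hatNonlinear p p₀ (0, 0)) ε 0 = 0 := by
  have hun : ‖embTuple (0, 0) 0‖ < ε / 2 := by simpa using hε
  have h1 := h.contDiffAt_inv hun
  have h2 := h.emb_sol hun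
  rw [sol_zero h hε, map_zero] at h2
  rw [map_zero] at h1
  exact ⟨h1, h2.symm⟩

/-- The obstruction map on the solutions of the reduced equation and its derivatives. -/
theorem exists_hasSmoothDerivs_obs (hε : 0 < ε) :
    ∃ D, HasSmoothDerivs (fun u => obs p p₀ (h.sol u)) D {u | ‖embTuple (0, 0) u‖ < ε / 2} ∧
      (∀ v, D 1 0 v = 0) ∧ ∀ v i, D 2 0 v i = obsForm p p₀ i (v 1) (v 0) := by
  obtain ⟨D, hD, hD2⟩ := h.exists_hasSmoothDerivs_comp_sol (obs p p₀) (hatObs p p₀)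
    (contDiff_hatObs p p₀) (obs_eq p p₀)
  have hun : ‖embTuple (0, 0) 0‖ < ε / 2 := by simpa using hε
  obtain ⟨hi1, hi0⟩ := contDiffAt_inv_zero h hε
  have hi := (h.contraction (0, 0)).hasFDerivAt_inv_zero (hasFDerivAt_hatNonlinear p p₀ (0, 0)).fderiv
  have hQ1 := (hasFDerivAt_hatObs p p₀).fderiv
  refine ⟨D, hD, fun v => ?_, fun v i => ?_⟩
  · rw [hD2 0 hun, map_zero, iteratedFDeriv_one_apply,
      fderiv_comp_of_tangent (contDiff_hatObs p p₀) hi0 hi, hQ1]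
    rfl
  -- The solution map is tangent to the identity and `0` is critical, so the change of variables
  -- does not affect the second derivative. The order `v 1`, `v 0` reflects the reversal of
  -- directions.
  · rw [hD2 0 hun, map_zero, iteratedFDeriv_two_apply,
      fderiv_fderiv_comp (contDiff_hatObs p p₀) hi1 hi0 hi hQ1]
    rfl

variable (p p₀) in
/-- The second derivative of the obstruction on the kernel of the linearization. -/
def kerForm (i : Fin 3) : LinearMap.BilinForm ℝ (proj p p₀).ker :=
  (obsForm p p₀ i).compl₁₂ (proj p p₀).ker.subtype (proj p p₀).ker.subtype

theorem kerForm_apply (i : Fin 3) (u w : (proj p p₀).ker) :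
    kerForm p p₀ i u w = obsForm p p₀ i u w := rfl

/-- The second derivative of the obstruction defines a good intersection. -/
theorem isGoodIntersection_kerForm (h0 : p₀ ≠ 0) : IsGoodIntersection (kerForm p p₀) := by
  refine isGoodIntersection_of_dual (c := -(1 / 2)) _ (fun i => ?_)
    (fun i u w => obsForm_symm p p₀ i u w)
    (fun j => ⟨kerMom p p₀ j, proj_kerMom h0 j⟩) (fun j => ⟨kerZeta p p₀ j, proj_kerZeta h0 j⟩)
    (by norm_num) (fun i j k => ?_) (fun i j k => ?_) (fun i j k => ?_)
  · exact (continuous_obsForm p p₀ i).comp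
      (f := fun q : (proj p p₀).ker × (proj p p₀).ker => ((q.1 : Tuple), (q.2 : Tuple))) (by fun_prop)
  · refine (obsForm_of_mem_frozen p p₀ i (kerMom_mem_frozen j) (kerMom_mem_frozen k)).trans ?_
    rw [quad_kerMom, quad_kerMom, add_zero]
  · refine (obsForm_of_mem_frozen p p₀ i (kerZeta_mem_frozen j) (kerZeta_mem_frozen k)).trans ?_
    rw [quad_kerZeta_kerZeta, quad_kerZeta_kerZeta, add_zero]
  · refine (obsForm_of_mem_frozen p p₀ i (kerMom_mem_frozen j) (kerZeta_mem_frozen k)).trans ?_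
    rw [quad_kerMom_kerZeta, quad_kerMom, add_zero]

end Local

end TorusConstraints

end

/-! ### The splitting and the local description of the solutions -/

theorem mainTheorem9
    (p : Fin 3 → ℝ) (hpos : ∀ i, 0 < p i) (hne : ∀ i j, i ≠ j → p i ≠ p j)
    (p₀ : ℝ) (hp₀ : 0 < p₀)
    (hC : TorusConstraints.constraintMap (TorusConstraints.homogeneous p p₀) = 0) :
    ∃ (U V : Submodule ℝ TorusConstraints.Tuple) (_ : Submodule.IsTopCompl U V)
      (ΩU : Set U) (ΩV : Set V) (φ : U → V) (B : U → Fin 3 → ℝ)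
      (DB : (k : ℕ) → U → (Fin k → U) → Fin 3 → ℝ)
      (β : Fin 3 → LinearMap.BilinForm ℝ U),
      IsClosed (U : Set TorusConstraints.Tuple) ∧ IsClosed (V : Set TorusConstraints.Tuple) ∧
      IsOpen ΩU ∧ 0 ∈ ΩU ∧ IsOpen ΩV ∧ 0 ∈ ΩV ∧
      Set.MapsTo φ ΩU ΩV ∧ TorusConstraints.IsSmoothOn φ ΩU ∧ φ 0 = 0 ∧
      TorusConstraints.HasSmoothDerivs B DB ΩU ∧ B 0 = 0 ∧ (∀ u : U, DB 1 0 ![u] = 0) ∧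
      (∀ i (u w : U), β i u w = DB 2 0 ![u, w] i) ∧
      TorusConstraints.IsGoodIntersection β ∧
      {x | x ∈ TorusConstraints.domainN ∧ TorusConstraints.constraintMap x = 0} ∩
          {x | ∃ u ∈ ΩU, ∃ v ∈ ΩV,
            x = TorusConstraints.homogeneous p p₀ + (u : TorusConstraints.Tuple) + v} =
        {x | ∃ u ∈ ΩU, B u = 0 ∧
          x = TorusConstraints.homogeneous p p₀ + ((u : TorusConstraints.Tuple) + φ u)} := by
  obtain ⟨ε₀, hε₀, hscale⟩ :=
    TorusConstraints.exists_contractionScale (TorusConstraints.polyA_background hC)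
  have h0 : p₀ ≠ 0 := hp₀.ne'
  -- The bound `1 / 6` guarantees that all tuples in the ball are frames; `ε₀` guarantees the
  -- contraction.
  have hε : 0 < min ε₀ (1 / 6) := by positivity
  have h := hscale _ hε (min_le_left _ _)
  have hε' : min ε₀ (1 / 6 : ℝ) ≤ 1 / 6 := min_le_right _ _
  generalize min ε₀ (1 / 6 : ℝ) = ε at hε h hε'
  obtain ⟨D, hD, hD1, hD2⟩ := TorusConstraints.exists_hasSmoothDerivs_obs h hε
  -- Idempotence and continuity together make the kernel and the range closed topological
  -- complements.
  have hP : IsIdempotentElem (TorusConstraints.proj p p₀) :=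
    ContinuousLinearMap.ext fun z => TorusConstraints.proj_proj h0 hne z
  have hcompl : Submodule.IsTopCompl (TorusConstraints.proj p p₀).ker
      (TorusConstraints.proj p p₀).range :=
    (ContinuousLinearMap.IsIdempotentElem.isTopCompl hP).symm
  have hopen : IsOpen {u | ‖TorusConstraints.embTuple (0, 0) u‖ < ε / 2} :=
    isOpen_lt (TorusConstraints.embTuple (0, 0)).continuous.norm continuous_const
  have hzero : ‖TorusConstraints.embTuple (0, 0) 0‖ < ε / 2 := by simpa using hε
  have hrange : ∀ v ∈ (TorusConstraints.proj p p₀).range, TorusConstraints.proj p p₀ v = v := by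
    rintro _ ⟨z, rfl⟩
    exact TorusConstraints.proj_proj h0 hne z
  obtain ⟨Dsol, hDsol⟩ := h.isSmoothOn_sol
  let T : TorusConstraints.Tuple →L[ℝ] (TorusConstraints.proj p p₀).range :=
    (TorusConstraints.proj p p₀).codRestrict _ fun z => LinearMap.mem_range_self _ z
  refine ⟨(TorusConstraints.proj p p₀).ker, (TorusConstraints.proj p p₀).range, hcompl,
    {u | ‖TorusConstraints.embTuple (0, 0) u‖ < ε / 2},
    {v | ‖TorusConstraints.embTuple (0, 0) v‖ < ε / 2},
    fun u => T (h.sol u), fun u => TorusConstraints.obs p p₀ (h.sol u),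
    fun k u v => D k u fun m => v m,
    TorusConstraints.kerForm p p₀,
    hcompl.isClosed, hcompl.symm.isClosed, hopen.preimage continuous_subtype_val, hzero,
    hopen.preimage continuous_subtype_val, hzero, ?_, ?_, ?_, ?_, ?_, ?_, ?_, ?_, ?_⟩
  · exact fun u hu => TorusConstraints.norm_proj_sol_lt h h0 hne u.2 hu
  · exact ⟨_, (hDsol.clm_comp T).comp_clm (TorusConstraints.proj p p₀).ker.subtypeL⟩
  · refine Subtype.ext ?_
    change TorusConstraints.proj p p₀ (h.sol 0) = 0
    rw [TorusConstraints.sol_zero h hε, map_zero]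
  · exact hD.comp_clm (TorusConstraints.proj p p₀).ker.subtypeL
  · change TorusConstraints.obs p p₀ (h.sol 0) = 0
    rw [TorusConstraints.sol_zero h hε, TorusConstraints.obs_eq, map_zero,
      TorusConstraints.hatObs_zero]
  · exact fun u => hD1 _
  · intro i u w
    have h2 := hD2 (fun m => ((![u, w] m : (TorusConstraints.proj p p₀).ker) :
      TorusConstraints.Tuple)) i
    -- Symmetry undoes the reversed order of the two directions in the iterated derivative.
    rw [TorusConstraints.kerForm_apply, TorusConstraints.obsForm_symm]
    exact h2.symm
  · exact TorusConstraints.isGoodIntersection_kerForm h0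
  · exact TorusConstraints.solutions_eq h h0 hne hε' _ hrange _ fun u => rfl
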